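/- Let $M$ be a smooth $n$-dimensional manifold (Hausdorff, second countable, without boundary), $T^*M$ its cotangent bundle with canonical coordinates $(q^i,p_i)$, canonical Poisson bracket $\{f,g\}=\sum_i\big(\partial_{q^i}f\,\partial_{p_i}g-\partial_{q^i}g\,\partial_{p_i}f\big)$ and symplectic volume $dV=d^nq\,d^np$. Fix an integer $A\ge 0$. *Kinetic side.* Let $C^\infty(T^*M)_+$ be the set of smooth $f:T^*M\to(0,\infty)$ that decay in $p$ in the following sense: in canonical coordinates over any chart of $M$, uniformly for $q$ in compact subsets of the chart, $f\cdot\|D^k\log f\|^j=O\big((1+|p|)^{-(n+2)}\big)$ for all integers $k,j\ge0$. The function $\delta F/\delta f\in C^\infty(T^*M)$ is the functional derivative of a functional $F$ at $f$ if $\frac{d}{dt}\big|_{0}F[f_t]=\int_{T^*M}\frac{\delta F}{\delta f}\,\partial_tf_t|_{t=0}\,dV$ for every smooth curve $f_t$ in $C^\infty(T^*M)_+$ with $f_0=f$ that is constant in $t$ outside a compact subset of $T^*M$. The bracket is $\{F,G\}_{KT}[f]=\int_{T^*M}f\,\big\{\frac{\delta F}{\delta f},\frac{\delta G}{\delta f}\big\}\,dV$.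 *Fluid side.* Let $\mathfrak s_A=\mathrm{Vect}(M)\ltimes C^\infty(M,\mathbb R^{A+1})$, with bracket $[(u,g),(v,h)]=\big([u,v],(\mathcal L_uh_a-\mathcal L_vg_a)_a\big)$, and let $\mathfrak s_A^*$ be its smooth dual, the space of all $\mu=(m,(s_0,\dots,s_A))$ with $m$ a smooth $1$-form density and $s_a$ smooth densities on $M$ (top-degree forms, if $M$ is oriented), paired by $\langle\mu,(u,g)\rangle=\int_M\big(m(u)+\sum_as_ag_a\big)$. The element $\delta F/\delta\mu=\big(\frac{\delta F}{\delta m},(\frac{\delta F}{\delta s_a})_a\big)\in\mathfrak s_A$ is the functional derivative of $F$ at $\mu$ if $\frac{d}{dt}\big|_{0}F(\mu_t)=\langle\partial_t\mu_t|_{t=0},\frac{\delta F}{\delta\mu}\rangle$ for every smooth curve $\mu_t$ in $\mathfrak s_A^*$ with $\mu_0=\mu$ that is constant in $t$ outside a compact subset of $M$. The bracket is the $(-)$-Lie–Poisson bracket $\{F,G\}_{\mathfrak s_A^*}(\mu)=-\big\langle\mu,\big[\frac{\delta F}{\delta\mu},\frac{\delta G}{\delta\mu}\big]\big\rangle$.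 For $f\in C^\infty(T^*M)_+$ let $\mathcal J_A[f]=(m,(s_0,\dots,s_A))$ with $m=\int p\,f\,d^np$ and $s_a=\int f(\log f)^a\,d^np$, the integrals being over the cotangent fibres. Then $\mathcal J_A$ is a Poisson map, in the following precise sense. 1. For every $f\in C^\infty(T^*M)_+$ the fibre integrals converge absolutely and $\mathcal J_A[f]\in\mathfrak s_A^*$. 2. If a functional $F$ on $\mathfrak s_A^*$ has the functional derivative $(u,(g_a)_a)$ at $\mathcal J_A[f]$, then $F\circ\mathcal J_A$ has at $f$ the functional derivative $\langle u,p\rangle+\sum_{a=0}^A y_a'(f)\,g_a$, where $y_a(x)=x(\log x)^a$. 3. Let $F,G$ have the functional derivatives $\xi=(u,g)$, $\eta=(v,h)$ at $\mathcal J_A[f]$, and suppose that the following decay conditions hold at infinity in $M$: for some compact $K\subseteq M$, the integrands of the two brackets, $f\,\{\langle u,p\rangle+\sum_ay_a'(f)g_a,\ \langle v,p\rangle+\sum_ay_a'(f)h_a\}$ on $T^*M$ and $m([u,v])+\sum_as_a(\mathcal L_uh_a-\mathcal L_vg_a)$ on $M$, are absolutely integrable over the part lying over $M\setminus K$; and for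 some smooth $w:M\to\mathbb R$ with all sublevel sets $\{w\le c\}$ compact, $s_{a-1}g_a\,\mathcal L_vw$ and $s_{a-1}h_a\,\mathcal L_uw$ are absolutely integrable over $M\setminus K$ for $1\le a\le A$. (These conditions are void if $M$ is compact, or if $\xi,\eta$ have compact support.) Then both brackets are defined by absolutely convergent integrals, and $$\{F\circ\mathcal J_A,\,G\circ\mathcal J_A\}_{KT}[f]=\{F,G\}_{\mathfrak s_A^*}(\mathcal J_A[f]).$$ In particular the component $s_1$ of $\mathcal J_1[f]$, the hydrodynamic entropy density, is the fibre integral $\int f\log f\,d^np$. -/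

import Mathlib

open Bundle Manifold MeasureTheory Set
open scoped ContDiff

noncomputable section

namespace KineticFluid

/-- The model space `ℝⁿ`. -/
abbrev Eu (n : ℕ) := EuclideanSpace ℝ (Fin n)

/-- The cotangent bundle `T*M`, with Mathlib's topology and manifold structure on the bundle of
continuous linear maps from the tangent bundle to the trivial line bundle. -/
abbrev Cot (n : ℕ) (M : Type*) [TopologicalSpace M] [ChartedSpace (Eu n) M]
    [IsManifold (𝓡 n) ∞ M] :=
  TotalSpace (Eu n →L[ℝ] ℝ)
    (fun q : M => TangentSpace (𝓡 n) q →L[ℝ] Bundle.Trivial M ℝ q)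

instance instMeasurableSpaceCot (n : ℕ) (M : Type*) [TopologicalSpace M] [ChartedSpace (Eu n) M]
    [IsManifold (𝓡 n) ∞ M] : MeasurableSpace (Cot n M) := borel _

instance instBorelSpaceCot (n : ℕ) (M : Type*) [TopologicalSpace M] [ChartedSpace (Eu n) M]
    [IsManifold (𝓡 n) ∞ M] : BorelSpace (Cot n M) := ⟨rfl⟩

section Geometry

variable {n : ℕ} {M : Type*} [TopologicalSpace M] [ChartedSpace (Eu n) M] [IsManifold (𝓡 n) ∞ M]

/-- The smooth charts of `M`. -/
abbrev charts (n : ℕ) (M : Type*) [TopologicalSpace M] [ChartedSpace (Eu n) M] :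
    Set (OpenPartialHomeomorph M (Eu n)) :=
  IsManifold.maximalAtlas (𝓡 n) ∞ M

/-- The coordinate vector `∂/∂eⁱ` at the point `e.symm x`, for a chart `e` and `x ∈ e.target`. -/
def coordVec (e : OpenPartialHomeomorph M (Eu n)) (x : Eu n) (i : Fin n) :
    TangentSpace (𝓡 n) (e.symm x) :=
  mfderiv (𝓡 n) (𝓡 n) e.symm x (EuclideanSpace.single i (1 : ℝ) : Eu n)

/-! ### Canonical coordinates, Poisson bracket and symplectic volume on the cotangent bundle -/

/-- The canonical coordinates `(qⁱ, pᵢ)`, `pᵢ = ⟨p, ∂/∂qⁱ⟩`, of a point of `T*M` in the chart `e`. -/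
def canon (e : OpenPartialHomeomorph M (Eu n)) (z : Cot n M) : Eu n × Eu n :=
  (e z.proj, WithLp.toLp 2 fun i =>
    z.snd (mfderiv (𝓡 n) (𝓡 n) e.symm (e z.proj) (EuclideanSpace.single i (1 : ℝ) : Eu n)))

/-- The inverse of the canonical coordinates: `(x, p) ↦ (e⁻¹ x, ∑ pᵢ deⁱ)`. -/
def canonSymm (e : OpenPartialHomeomorph M (Eu n)) (y : Eu n × Eu n) : Cot n M :=
  ⟨e.symm y.1, (innerSL ℝ y.2 : Eu n →L[ℝ] ℝ).comp (mfderiv (𝓡 n) (𝓡 n) e (e.symm y.1))⟩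

/-- Smooth functions on `T*M`. -/
def SmoothCot (f : Cot n M → ℝ) : Prop :=
  ContMDiff ((𝓡 n).prod 𝓘(ℝ, Eu n →L[ℝ] ℝ)) 𝓘(ℝ, ℝ) ∞ f

/-- Smooth functions on `ℝ × T*M`, i.e. smooth one-parameter families of functions on `T*M`. -/
def SmoothCotFamily (f : ℝ → Cot n M → ℝ) : Prop :=
  ContMDiff (𝓘(ℝ, ℝ).prod ((𝓡 n).prod 𝓘(ℝ, Eu n →L[ℝ] ℝ))) 𝓘(ℝ, ℝ) ∞
    (fun y : ℝ × Cot n M => f y.1 y.2)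

/-- The partial derivative `∂f/∂qⁱ` in the canonical coordinates of the chart `e`. -/
def dq (e : OpenPartialHomeomorph M (Eu n)) (f : Cot n M → ℝ) (i : Fin n) (z : Cot n M) : ℝ :=
  fderiv ℝ (f ∘ canonSymm e) (canon e z) ((EuclideanSpace.single i (1 : ℝ) : Eu n), (0 : Eu n))

/-- The partial derivative `∂f/∂pᵢ` in the canonical coordinates of the chart `e`. -/
def dp (e : OpenPartialHomeomorph M (Eu n)) (f : Cot n M → ℝ) (i : Fin n) (z : Cot n M) : ℝ :=
  fderiv ℝ (f ∘ canonSymm e) (canon e z) ((0 : Eu n), (EuclideanSpace.single i (1 : ℝ) : Eu n))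

/-- The canonical Poisson bracket `{f, g} = ∂f/∂qⁱ ∂g/∂pᵢ - ∂g/∂qⁱ ∂f/∂pᵢ` on `T*M`; it does not
depend on the chart, and the preferred chart at the base point is used. -/
def poisson (f g : Cot n M → ℝ) (z : Cot n M) : ℝ :=
  ∑ i : Fin n,
    (dq (chartAt (Eu n) z.proj) f i z * dp (chartAt (Eu n) z.proj) g i z
      - dq (chartAt (Eu n) z.proj) g i z * dp (chartAt (Eu n) z.proj) f i z)

/-- The measure of the symplectic volume form `ωⁿ/n!` on `T*M`. In every system of canonical
coordinates it is the Lebesgue measure `dq dp`. Since these local measures agree on overlaps, the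
global one is their least upper bound. -/
def liouville (n : ℕ) (M : Type*) [TopologicalSpace M] [ChartedSpace (Eu n) M]
    [IsManifold (𝓡 n) ∞ M] : Measure (Cot n M) :=
  ⨆ e : charts n M, ((volume : Measure (Eu n × Eu n)).restrict
    ((e : OpenPartialHomeomorph M (Eu n)).target ×ˢ univ)).map (canonSymm e.1)

/-! ### Densities on the base

Mathlib identifies `TangentSpace (𝓡 n) q` with `ℝⁿ`, so that every tangent space has a standard
frame. A density on `M` (a top-degree form, if `M` is oriented) is represented by the function
`d : M → ℝ` of its values on these standard frames. -/

/-- The component of the density `d` in the chart `e`, i.e. the value of `d` on the frame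
`∂/∂e¹, …, ∂/∂eⁿ`, which is `|det|` times its value on the standard frame. In the chart, the
density is `(densCoord e d) dⁿq`. -/
def densCoord (e : OpenPartialHomeomorph M (Eu n)) (d : M → ℝ) (x : Eu n) : ℝ :=
  d (e.symm x) * |ContinuousLinearMap.det (mfderiv (𝓡 n) (𝓡 n) e.symm x : Eu n →L[ℝ] Eu n)|

/-- A density is smooth if its components in all charts are smooth. -/
def SmoothDensity (d : M → ℝ) : Prop :=
  ∀ e ∈ charts n M, ContDiffOn ℝ ∞ (densCoord e d) e.target

variable (n) in
/-- The measure on `M` given by the positive part of a density: in each chart `e` it is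
`max (densCoord e d) 0` times Lebesgue measure, and the global measure is the least upper bound of
these local ones, which agree on overlaps. -/
def densMeasure [MeasurableSpace M] (d : M → ℝ) : Measure M :=
  ⨆ e : charts n M, (((volume : Measure (Eu n)).restrict
      (e : OpenPartialHomeomorph M (Eu n)).target).withDensity
        (fun x => ENNReal.ofReal (densCoord e.1 d x))).map e.1.symm

variable (n) in
/-- The density `d` is (absolutely) integrable over `M`. -/
def DensIntegrable [MeasurableSpace M] (d : M → ℝ) : Prop :=
  densMeasure n d univ < ⊤ ∧ densMeasure n (fun q => -d q) univ < ⊤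

variable (n) in
/-- The integral `∫_M d` of a density: integral of the positive part minus integral of the
negative part. -/
def densIntegral [MeasurableSpace M] (d : M → ℝ) : ℝ :=
  (densMeasure n d univ).toReal - (densMeasure n (fun q => -d q) univ).toReal

/-- The density on `M` obtained by integrating a function over the cotangent fibres, `∫ h dⁿp`. The
momentum coordinates on the fibre over `q` are those dual to the standard frame of
`TangentSpace (𝓡 n) q`. -/
def fibreIntegral (h : Cot n M → ℝ) (q : M) : ℝ :=
  ∫ p : Eu n, h ⟨q, (innerSL ℝ p : Eu n →L[ℝ] ℝ)⟩

end Geometry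

/-! ### The semidirect product Lie algebra and its smooth dual -/

/-- Elements `(u, (g₀, …, g_A))` of `Vect(M) ⋉ C^∞(M, ℝ^{A+1})`, before smoothness is imposed. -/
structure SemiAlg (n : ℕ) (M : Type*) [TopologicalSpace M] [ChartedSpace (Eu n) M] (A : ℕ) where
  /-- the vector field -/
  u : ∀ q : M, TangentSpace (𝓡 n) q
  /-- the functions -/
  g : Fin (A + 1) → M → ℝ

/-- Elements `(m, (s₀, …, s_A))` of the dual: a one-form density and `A + 1` densities, before
smoothness is imposed. All densities are given by their values on the standard frames. -/
structure SemiDual (n : ℕ) (M : Type*) [TopologicalSpace M] [ChartedSpace (Eu n) M] (A : ℕ) where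
  /-- the momentum density -/
  m : ∀ q : M, TangentSpace (𝓡 n) q →L[ℝ] ℝ
  /-- the generalised entropy densities -/
  s : Fin (A + 1) → M → ℝ

section Fluid

variable {n : ℕ} {M : Type*} [TopologicalSpace M] [ChartedSpace (Eu n) M] [IsManifold (𝓡 n) ∞ M]
variable {A : ℕ}

/-- The derivative `ℒ_u h` of the function `h` along the vector field `u`. -/
def lieDer (u : ∀ q : M, TangentSpace (𝓡 n) q) (h : M → ℝ) (q : M) : ℝ :=
  (mfderiv (𝓡 n) 𝓘(ℝ, ℝ) h q : TangentSpace (𝓡 n) q →L[ℝ] ℝ) (u q)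

/-- Membership in the Lie algebra `𝔰_A = Vect(M) ⋉ C^∞(M, ℝ^{A+1})`. -/
def SemiAlg.Smooth (ξ : SemiAlg n M A) : Prop :=
  ContMDiff (𝓡 n) (𝓡 n).tangent ∞ (fun q => (⟨q, ξ.u q⟩ : TangentBundle (𝓡 n) M)) ∧
  ∀ a, ContMDiff (𝓡 n) 𝓘(ℝ, ℝ) ∞ (ξ.g a)

/-- The Lie bracket `[(u, g), (v, h)] = ([u, v], ℒ_u h - ℒ_v g)` of `𝔰_A`. -/
def SemiAlg.bracket (ξ η : SemiAlg n M A) : SemiAlg n M A where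
  u := VectorField.mlieBracket (𝓡 n) ξ.u η.u
  g := fun a q => lieDer ξ.u (η.g a) q - lieDer η.u (ξ.g a) q

/-- The component of the momentum density along `∂/∂eⁱ`, in the chart `e`. -/
def SemiDual.mCoord (e : OpenPartialHomeomorph M (Eu n)) (μ : SemiDual n M A) (i : Fin n)
    (x : Eu n) : ℝ :=
  μ.m (e.symm x) (coordVec e x i) *
    |ContinuousLinearMap.det (mfderiv (𝓡 n) (𝓡 n) e.symm x : Eu n →L[ℝ] Eu n)|

/-- Membership in the smooth dual `𝔰_A^*`. -/
def SemiDual.Smooth (μ : SemiDual n M A) : Prop :=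
  (∀ e ∈ charts n M, ∀ i, ContDiffOn ℝ ∞ (μ.mCoord e i) e.target) ∧
  ∀ a, SmoothDensity (n := n) (μ.s a)

/-- The density `m(u) + ∑ s_a g_a` on `M`, whose integral is the dual pairing of `𝔰_A^*` with
`𝔰_A`. -/
def pairDensity (μ : SemiDual n M A) (ξ : SemiAlg n M A) (q : M) : ℝ :=
  μ.m q (ξ.u q) + ∑ a, μ.s a q * ξ.g a q

/-- A smooth compactly supported variation of `μ`: a curve in `𝔰_A^*` through `μ`, smooth jointly
in the parameter and the point, that agrees with `μ` outside a compact subset of `M`. -/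
structure FluidVariation (μ : SemiDual n M A) (c : ℝ → SemiDual n M A) : Prop where
  zero : c 0 = μ
  smooth_m : ∀ e ∈ charts n M, ∀ i, ContDiffOn ℝ ∞
    (fun y : ℝ × Eu n => (c y.1).mCoord e i y.2) (univ ×ˢ e.target)
  smooth_s : ∀ e ∈ charts n M, ∀ a, ContDiffOn ℝ ∞
    (fun y : ℝ × Eu n => densCoord e ((c y.1).s a) y.2) (univ ×ˢ e.target)
  support : ∃ K : Set M, IsCompact K ∧ ∀ t, ∀ q ∉ K,
    (c t).m q = μ.m q ∧ ∀ a, (c t).s a q = μ.s a q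

/-- `ξ = (δF/δm, (δF/δs₀, …, δF/δs_A)) ∈ 𝔰_A` is the functional derivative of `F` at `μ`: along every
smooth compactly supported variation `μ_t` of `μ`, the derivative of `F(μ_t)` at `t = 0` is
`⟨∂_t μ_t, ξ⟩`. -/
def HasFluidDeriv [MeasurableSpace M] (F : SemiDual n M A → ℝ) (μ : SemiDual n M A)
    (ξ : SemiAlg n M A) : Prop :=
  ξ.Smooth ∧ ∀ c : ℝ → SemiDual n M A, FluidVariation μ c →
    HasDerivAt (fun t => F (c t))
      (densIntegral n fun q => deriv (fun t => pairDensity (c t) ξ q) 0) 0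

/-- `r` is the value at `μ` of the (-)-Lie--Poisson bracket
`{F, G}(μ) = -⟨μ, [δF/δμ, δG/δμ]⟩` on `𝔰_A^*`. -/
def IsFluidBracket [MeasurableSpace M] (F G : SemiDual n M A → ℝ) (μ : SemiDual n M A)
    (r : ℝ) : Prop :=
  ∃ ξ η : SemiAlg n M A, HasFluidDeriv F μ ξ ∧ HasFluidDeriv G μ η ∧
    DensIntegrable n (pairDensity μ (ξ.bracket η)) ∧
    r = -densIntegral n (pairDensity μ (ξ.bracket η))

end Fluid

/-! ### Kinetic theory -/

section Kinetic

variable {n : ℕ} {M : Type*} [TopologicalSpace M] [ChartedSpace (Eu n) M] [IsManifold (𝓡 n) ∞ M]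

/-- The space `C^∞(T*M)_+` of positive distribution functions: smooth positive functions with decay
at large momenta. The decay condition says that in canonical coordinates, locally uniformly in `q`,
`f` times any power of any derivative of `log f` is `O((1 + |p|)^{-(n+2)})`. Nothing is required at
infinity in `M`. -/
structure PosDist (f : Cot n M → ℝ) : Prop where
  smooth : SmoothCot f
  pos : ∀ z, 0 < f z
  decay : ∀ e ∈ charts n M, ∀ K ⊆ e.target, IsCompact K → ∀ k j : ℕ, ∃ C : ℝ,
    ∀ x ∈ K, ∀ p : Eu n,
      (1 + ‖p‖) ^ (n + 2) * (f (canonSymm e (x, p)) *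
        ‖iteratedFDeriv ℝ k (fun y => Real.log (f (canonSymm e y))) (x, p)‖ ^ j) ≤ C

/-- A smooth compactly supported variation of `f` within `C^∞(T*M)_+`. -/
structure KineticVariation (f : Cot n M → ℝ) (c : ℝ → Cot n M → ℝ) : Prop where
  zero : c 0 = f
  smooth : SmoothCotFamily c
  mem : ∀ t, PosDist (c t)
  support : ∃ K : Set (Cot n M), IsCompact K ∧ ∀ t, ∀ z ∉ K, c t z = f z

/-- `φ = δF/δf ∈ C^∞(T*M)` is the functional derivative of `F` at `f`: along every smooth compactly
supported variation `f_t` of `f`, the derivative of `F[f_t]` at `t = 0` is `∫ φ ∂_t f_t dV`. -/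
def HasKineticDeriv (F : (Cot n M → ℝ) → ℝ) (f φ : Cot n M → ℝ) : Prop :=
  SmoothCot φ ∧ ∀ c : ℝ → Cot n M → ℝ, KineticVariation f c →
    HasDerivAt (fun t => F (c t)) (∫ z, φ z * deriv (fun t => c t z) 0 ∂(liouville n M)) 0

/-- `r` is the value at `f` of the (+)-Lie--Poisson bracket
`{F, G}[f] = ∫ f {δF/δf, δG/δf} dV` of kinetic theory. -/
def IsKineticBracket (F G : (Cot n M → ℝ) → ℝ) (f : Cot n M → ℝ) (r : ℝ) : Prop :=
  ∃ φ ψ : Cot n M → ℝ, HasKineticDeriv F f φ ∧ HasKineticDeriv G f ψ ∧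
    Integrable (fun z => f z * poisson φ ψ z) (liouville n M) ∧
    r = ∫ z, f z * poisson φ ψ z ∂(liouville n M)

/-! ### The map from kinetic theory to fluids -/

/-- The functions `y_a(x) = x (log x)^a`. -/
def yFun (a : ℕ) (x : ℝ) : ℝ := x * Real.log x ^ a

/-- The map `J_A[f] = (m, (s₀, …, s_A))` with `m = ∫ p f dⁿp` and `s_a = ∫ f (log f)^a dⁿp`. -/
def JMap (A : ℕ) (f : Cot n M → ℝ) : SemiDual n M A where
  m := fun q => (∫ p : Eu n, f ⟨q, (innerSL ℝ p : Eu n →L[ℝ] ℝ)⟩ • innerSL ℝ p : Eu n →L[ℝ] ℝ)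
  s := fun a => fibreIntegral fun z => f z * Real.log (f z) ^ (a : ℕ)

/-- The fibre integrals that define `J_A[f]` converge absolutely. -/
def MomentsConverge (A : ℕ) (f : Cot n M → ℝ) : Prop :=
  ∀ q : M,
    Integrable (fun p : Eu n =>
      (f ⟨q, (innerSL ℝ p : Eu n →L[ℝ] ℝ)⟩ • innerSL ℝ p : Eu n →L[ℝ] ℝ)) ∧
    ∀ a : Fin (A + 1), Integrable (fun p : Eu n =>
      f ⟨q, (innerSL ℝ p : Eu n →L[ℝ] ℝ)⟩ *
        Real.log (f ⟨q, (innerSL ℝ p : Eu n →L[ℝ] ℝ)⟩) ^ (a : ℕ))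

/-- The function `⟨u, p⟩ + ∑ y_a'(f) g_a` on `T*M`. -/
def liftDeriv {A : ℕ} (f : Cot n M → ℝ) (ξ : SemiAlg n M A) (z : Cot n M) : ℝ :=
  (z.snd : TangentSpace (𝓡 n) z.proj →L[ℝ] ℝ) (ξ.u z.proj) +
    ∑ a : Fin (A + 1), deriv (yFun a) (f z) * ξ.g a z.proj

/-- Decay at infinity in `M`, for a distribution function `f` and functional derivatives
`ξ = (u, g)`, `η = (v, h)`. Outside some compact set the integrands of the two brackets are
integrable, and the currents `s_{a-1} g_a v` and `s_{a-1} h_a u` (`1 ≤ a ≤ A`) have integrable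
component along `dw` for some smooth exhaustion function `w` of `M`. There is no condition if `M` is
compact (`K = M`, `w = 0`), nor if `ξ` and `η` have compact support. -/
def DecaysAtInfinity [MeasurableSpace M] {A : ℕ} (f : Cot n M → ℝ) (ξ η : SemiAlg n M A) : Prop :=
  ∃ K : Set M, IsCompact K ∧
    IntegrableOn (fun z => f z * poisson (liftDeriv f ξ) (liftDeriv f η) z)
      {z : Cot n M | z.proj ∉ K} (liouville n M) ∧
    DensIntegrable n (Kᶜ.indicator (pairDensity (JMap A f) (ξ.bracket η))) ∧
    ∃ w : M → ℝ, ContMDiff (𝓡 n) 𝓘(ℝ, ℝ) ∞ w ∧ (∀ c : ℝ, IsCompact {q | w q ≤ c}) ∧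
      ∀ a b : Fin (A + 1), (b : ℕ) + 1 = a →
        DensIntegrable n (Kᶜ.indicator fun q => (JMap A f).s b q * ξ.g a q * lieDer η.u w q) ∧
        DensIntegrable n (Kᶜ.indicator fun q => (JMap A f).s b q * η.g a q * lieDer ξ.u w q)

end Kinetic

end KineticFluid

end

set_option linter.unusedSectionVars false
set_option linter.unusedVariables false

/-! Write `f = exp L` and `Y_a = X ^ a`. Then `y_a(f) = f Y_a(L)` and `y_a'(f) = (Y_a + Y_a')(L)`,
so the problem becomes calculus with polynomials in `L`. The formula for the functional derivative
is the chain rule applied under the fibre integral, followed by Fubini (`HasFluidDeriv.comp_JMap`).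

For the brackets, expand `f {⟨u,p⟩ + ∑ y_a'(f) g_a, ⟨v,p⟩ + ∑ y_a'(f) h_a}`. The terms without `dL`
are `-f ⟨[u,v],p⟩` and `-f ∑ (Y_a + Y_a')(L) (ℒ_u h_a - ℒ_v g_a)`. The parts with `Y_a` form the
fluid integrand. The excess `-f Y_a'(L) ℒ_u h_a` combines with `f h_a (Y_a + Y_a')'(L) {⟨u,p⟩, L} =
h_a {⟨u,p⟩, f Y_a'(L)}` into the single bracket `{⟨u,p⟩, h_a f Y_a'(L)}`, and similarly for `v` and
`g_a`. What remains are terms `f g_a Q(L) {h_b, L}` with `Q = (Y_a + Y_a')' (Y_b + Y_b')`, and their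
mirror images. If `Z + Z' = Q`, such a term is the bracket `{h_b, g_a f Z(L)}`; a polynomial `Z`
exists because differentiation is nilpotent on polynomials of bounded degree
(`exists_add_derivative_eq`). A Poisson bracket is a divergence, so all these leftovers integrate to
zero (`LogDecay.integral_pb_eq_zero`).

Since nothing need decay along `M`, a cutoff `r` on the base is carried along. Placed in the second
slot of the exact brackets, it leaves only the boundary term `∑ a s_{a-1} (h_a ℒ_u r - g_a ℒ_v r)`
(`LogDecay.integral_bracket`). The resulting identity is additive in `r`, so a partition of unity
extends it from charts to all compactly supported `r` (`PosDist.bracketIdentity`). Finally `r` runs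
through cutoffs made from the exhaustion function `w`. Their derivatives are `O(1/k) dw`, so the
boundary term tends to zero, and dominated convergence gives the two brackets
(`PosDist.brackets_of_decay`).

The analytic input is that `f`, times polynomials in derivatives of `L`, times one factor `1 + |p|`,
is still `O((1 + |p|)^{-(n+1)})`, hence integrable over the fibres. The geometric input is that the
Poisson bracket, the Liouville measure and the integral of a density can be computed in any chart.
-/

namespace KineticFluid

/-! ### Smooth dependence of integrals on a parameter. -/

section ParametricIntegral

open Filter Topology

variable {Y E G : Type} [NormedAddCommGroup Y] [NormedSpace ℝ Y]
  [NormedAddCommGroup E] [NormedSpace ℝ E] [FiniteDimensional ℝ E] [MeasurableSpace E]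
  [BorelSpace E] [NormedAddCommGroup G] [NormedSpace ℝ G]

/-- All derivatives of `Φ : Y × E → G` are, locally uniformly in `y ∈ U`, dominated by integrable
functions on `E`. -/
def LocallyDominated (μ : Measure E) (U : Set Y) (Φ : Y × E → G) : Prop :=
  ∀ k : ℕ, ∀ y₀ ∈ U, ∃ V ∈ 𝓝 y₀, ∃ b : E → ℝ, Integrable b μ ∧
    ∀ y ∈ V, ∀ p, ‖iteratedFDeriv ℝ k Φ (y, p)‖ ≤ b p

theorem slice_continuous {U : Set Y} {Φ : Y × E → G} (hΦ : ContinuousOn Φ (U ×ˢ univ)) {y : Y}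
    (hy : y ∈ U) : Continuous fun p => Φ (y, p) :=
  hΦ.comp_continuous (by fun_prop) fun p => ⟨hy, mem_univ p⟩

variable {μ : Measure E} {U : Set Y} {Φ : Y × E → G}

theorem LocallyDominated.integrable (hb : LocallyDominated μ U Φ) (hU : IsOpen U)
    (hΦ : ContDiffOn ℝ ∞ Φ (U ×ˢ univ)) {y : Y} (hy : y ∈ U) :
    Integrable (fun p => Φ (y, p)) μ := by
  obtain ⟨V, hV, b, hbi, hb⟩ := hb 0 y hy
  refine hbi.mono' (slice_continuous hΦ.continuousOn hy).aestronglyMeasurable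
    (Eventually.of_forall fun p => ?_)
  simpa using hb y (mem_of_mem_nhds hV) p

/-- The partial derivative in the parameter. -/
noncomputable def fderivLeft (Φ : Y × E → G) (z : Y × E) : Y →L[ℝ] G :=
  (fderiv ℝ Φ z).comp (ContinuousLinearMap.inl ℝ Y E)

theorem contDiffOn_fderivLeft (hU : IsOpen U) (hΦ : ContDiffOn ℝ ∞ Φ (U ×ˢ univ)) :
    ContDiffOn ℝ ∞ (fderivLeft Φ) (U ×ˢ univ) := by
  have h1 : ContDiffOn ℝ ∞ (fderiv ℝ Φ) (U ×ˢ univ) :=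
    hΦ.fderiv_of_isOpen (hU.prod isOpen_univ) (by simp)
  exact h1.clm_comp contDiffOn_const

/-- Restricting a derivative to the parameter directions is a linear map of norm at most one, so the
order `k` bound follows from the order `k + 1` bound of `Φ`. -/
theorem LocallyDominated.fderivLeft (hb : LocallyDominated μ U Φ) (hU : IsOpen U)
    (hΦ : ContDiffOn ℝ ∞ Φ (U ×ˢ univ)) : LocallyDominated μ U (fderivLeft Φ) := by
  intro k y₀ hy₀
  obtain ⟨V, hV, b, hbi, hb⟩ := hb (k + 1) y₀ hy₀
  refine ⟨V ∩ U, inter_mem hV (hU.mem_nhds hy₀), b, hbi, fun y hy p => ?_⟩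
  refine le_trans ?_ (hb y hy.1 p)
  have hz : U ×ˢ (univ : Set E) ∈ 𝓝 (y, p) := (hU.prod isOpen_univ).mem_nhds ⟨hy.2, mem_univ p⟩
  have h1 : ContDiffAt ℝ k (fderiv ℝ Φ) (y, p) :=
    ((hΦ.fderiv_of_isOpen (m := ∞) (hU.prod isOpen_univ) (by simp)).contDiffAt hz).of_le
      (by exact_mod_cast le_top)
  set R : ((Y × E) →L[ℝ] G) →L[ℝ] (Y →L[ℝ] G) :=
    (ContinuousLinearMap.compL ℝ Y (Y × E) G).flip (ContinuousLinearMap.inl ℝ Y E) with hR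
  have hRn : ‖R‖ ≤ 1 := by
    refine ContinuousLinearMap.opNorm_le_bound _ zero_le_one fun T => ?_
    simp only [hR, ContinuousLinearMap.flip_apply, ContinuousLinearMap.compL_apply, one_mul]
    refine (T.opNorm_comp_le _).trans ?_
    exact mul_le_of_le_one_right (norm_nonneg _) (ContinuousLinearMap.norm_inl_le_one ℝ Y E)
  have h2 : KineticFluid.fderivLeft Φ = R ∘ fderiv ℝ Φ := rfl
  rw [h2, ← norm_iteratedFDeriv_fderiv]
  refine (R.norm_iteratedFDeriv_comp_left h1 le_rfl).trans ?_
  exact mul_le_of_le_one_left (norm_nonneg _) hRn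

theorem LocallyDominated.hasFDerivAt (hb : LocallyDominated μ U Φ) (hU : IsOpen U)
    (hΦ : ContDiffOn ℝ ∞ Φ (U ×ˢ univ)) {y : Y} (hy : y ∈ U) :
    HasFDerivAt (fun y => ∫ p, Φ (y, p) ∂μ) (∫ p, KineticFluid.fderivLeft Φ (y, p) ∂μ) y := by
  obtain ⟨V, hV, b, hbi, hbb⟩ := hb.fderivLeft hU hΦ 0 y hy
  refine hasFDerivAt_integral_of_dominated_of_fderiv_le (s := V ∩ U) (bound := b)
    (F' := fun y p => KineticFluid.fderivLeft Φ (y, p)) (inter_mem hV (hU.mem_nhds hy)) ?_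
    (hb.integrable hU hΦ hy) ?_ (Eventually.of_forall fun p y hy => ?_) hbi
    (Eventually.of_forall fun p y hy => ?_)
  · filter_upwards [hU.mem_nhds hy] with y hy
    exact (slice_continuous hΦ.continuousOn hy).aestronglyMeasurable
  · exact (slice_continuous (contDiffOn_fderivLeft hU hΦ).continuousOn hy).aestronglyMeasurable
  · simpa using hbb y hy.1 p
  · have hz : U ×ˢ (univ : Set E) ∈ 𝓝 (y, p) :=
      (hU.prod isOpen_univ).mem_nhds ⟨hy.2, mem_univ p⟩
    have h1 : HasFDerivAt Φ (fderiv ℝ Φ (y, p)) (y, p) :=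
      ((hΦ.contDiffAt hz).differentiableAt (by simp)).hasFDerivAt
    exact h1.comp y (hasFDerivAt_prodMk_left y p)

theorem LocallyDominated.contDiffOn (hb : LocallyDominated μ U Φ) (hU : IsOpen U)
    (hΦ : ContDiffOn ℝ ∞ Φ (U ×ˢ univ)) : ContDiffOn ℝ ∞ (fun y => ∫ p, Φ (y, p) ∂μ) U := by
  rw [contDiffOn_infty]
  intro k
  -- The derivative of the integral is again an integral of the same type, but with values in `Y
  -- →L[ℝ] G`.
  induction k generalizing G with
  | zero =>
    exact contDiffOn_zero.2 fun y hy => (hb.hasFDerivAt hU hΦ hy).continuousAt.continuousWithinAt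
  | succ k ih =>
    have h := ih (hb.fderivLeft hU hΦ) (contDiffOn_fderivLeft hU hΦ)
    push_cast
    rw [contDiffOn_succ_iff_fderiv_of_isOpen hU]
    refine ⟨fun y hy => (hb.hasFDerivAt hU hΦ hy).differentiableAt.differentiableWithinAt,
      by simp, h.congr fun y hy => (hb.hasFDerivAt hU hΦ hy).fderiv⟩

end ParametricIntegral

/-! ### Functions with derivatives controlled by a weight and the jet of `L`. -/

section Tame

variable {Z : Type} [NormedAddCommGroup Z] [NormedSpace ℝ Z]

/-- The size of the first `m` derivatives of `L`. -/
noncomputable def jetSize (L : Z → ℝ) (m : ℕ) (z : Z) : ℝ :=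
  1 + ∑ i ∈ Finset.range (m + 1), ‖iteratedFDeriv ℝ i L z‖

/-- Being at least one makes powers of the jet size monotone in the exponent, so that different
bounds can be brought to common exponents. -/
theorem one_le_jetSize (L : Z → ℝ) (m : ℕ) (z : Z) : 1 ≤ jetSize L m z :=
  le_add_of_nonneg_right (Finset.sum_nonneg fun _ _ => norm_nonneg _)

theorem jetSize_mono (L : Z → ℝ) {m m' : ℕ} (h : m ≤ m') (z : Z) :
    jetSize L m z ≤ jetSize L m' z := by
  unfold jetSize
  gcongr

theorem norm_iteratedFDeriv_le_jetSize (L : Z → ℝ) {k m : ℕ} (h : k ≤ m) (z : Z) :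
    ‖iteratedFDeriv ℝ k L z‖ ≤ jetSize L m z :=
  (Finset.single_le_sum (f := fun i => ‖iteratedFDeriv ℝ i L z‖) (fun _ _ => norm_nonneg _)
    (Finset.mem_range.2 (Nat.lt_succ_of_le h))).trans (le_add_of_nonneg_left zero_le_one)

theorem jetSize_pow_mono (L : Z → ℝ) {m m' N N' : ℕ} (h : m ≤ m') (hN : N ≤ N') (z : Z) :
    jetSize L m z ^ N ≤ jetSize L m' z ^ N' :=
  (pow_le_pow_left₀ (zero_le_one.trans (one_le_jetSize L m z)) (jetSize_mono L h z) N).trans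
    (pow_le_pow_right₀ (one_le_jetSize L m' z) hN)

/-- `Ψ` is smooth on `O`, and on `S` its derivatives are bounded by the weight `w` times powers of
the derivatives of `L`. -/
structure Tame (L : Z → ℝ) (O S : Set Z) (w Ψ : Z → ℝ) : Prop where
  smooth : ContDiffOn ℝ ∞ Ψ O
  bound : ∀ k : ℕ, ∃ (C : ℝ) (m N : ℕ), 0 ≤ C ∧
    ∀ z ∈ S, ‖iteratedFDeriv ℝ k Ψ z‖ ≤ C * w z * jetSize L m z ^ N

variable {L : Z → ℝ} {O S : Set Z} {w w' Ψ Ψ' : Z → ℝ}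

theorem Tame.mono_weight (h : Tame L O S w Ψ) (hw : ∀ z ∈ S, w z ≤ w' z) : Tame L O S w' Ψ := by
  refine ⟨h.smooth, fun k => ?_⟩
  obtain ⟨C, m, N, hC, hb⟩ := h.bound k
  refine ⟨C, m, N, hC, fun z hz => (hb z hz).trans ?_⟩
  have := zero_le_one.trans (one_le_jetSize L m z)
  gcongr
  exact hw z hz

/-- Bounds for all derivatives up to order `k` with common constants. -/
theorem Tame.bound_uniform (h : Tame L O S w Ψ) (hw : ∀ z ∈ S, 0 ≤ w z) (k : ℕ) :
    ∃ (C : ℝ) (m N : ℕ), 0 ≤ C ∧ ∀ i ≤ k, ∀ z ∈ S,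
      ‖iteratedFDeriv ℝ i Ψ z‖ ≤ C * w z * jetSize L m z ^ N := by
  induction k with
  | zero =>
    obtain ⟨C, m, N, hC, hb⟩ := h.bound 0
    exact ⟨C, m, N, hC, fun i hi => by obtain rfl := Nat.le_zero.1 hi; exact hb⟩
  | succ k ih =>
    obtain ⟨C, m, N, hC, hb⟩ := h.bound (k + 1)
    obtain ⟨C', m', N', hC', hb'⟩ := ih
    refine ⟨max C C', max m m', max N N', le_max_of_le_left hC, fun i hi z hz => ?_⟩
    have h0 := hw z hz
    have h1 := jetSize_pow_mono L (le_max_left m m') (le_max_left N N') z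
    have h2 := jetSize_pow_mono L (le_max_right m m') (le_max_right N N') z
    have h3 := zero_le_one.trans (one_le_jetSize L m z)
    have h4 := zero_le_one.trans (one_le_jetSize L m' z)
    rcases Nat.lt_or_ge i (k + 1) with hik | hik
    · refine (hb' i (Nat.lt_succ_iff.1 hik) z hz).trans ?_
      gcongr
      exact le_max_right _ _
    · obtain rfl := le_antisymm hi hik
      refine (hb z hz).trans ?_
      gcongr
      exact le_max_left _ _

theorem iteratedFDeriv_eqOn_within (hO : IsOpen O) (k : ℕ) :
    EqOn (iteratedFDerivWithin ℝ k Ψ O) (iteratedFDeriv ℝ k Ψ) O :=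
  iteratedFDerivWithin_of_isOpen k hO

theorem Tame.add (hO : IsOpen O) (hS : S ⊆ O) (hw : ∀ z ∈ S, 0 ≤ w z) (h : Tame L O S w Ψ)
    (h' : Tame L O S w Ψ') : Tame L O S w (fun z => Ψ z + Ψ' z) := by
  refine ⟨h.smooth.add h'.smooth, fun k => ?_⟩
  obtain ⟨C, m, N, hC, hb⟩ := h.bound k
  obtain ⟨C', m', N', hC', hb'⟩ := h'.bound k
  refine ⟨C + C', max m m', max N N', add_nonneg hC hC', fun z hz => ?_⟩
  have hn := hO.mem_nhds (hS hz)
  have e1 : iteratedFDeriv ℝ k (fun z => Ψ z + Ψ' z) z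
      = iteratedFDeriv ℝ k Ψ z + iteratedFDeriv ℝ k Ψ' z :=
    iteratedFDeriv_add_apply ((h.smooth.contDiffAt hn).of_le (by exact_mod_cast le_top))
      ((h'.smooth.contDiffAt hn).of_le (by exact_mod_cast le_top))
  have h0 := hw z hz
  have h1 := jetSize_pow_mono L (le_max_left m m') (le_max_left N N') z
  have h2 := jetSize_pow_mono L (le_max_right m m') (le_max_right N N') z
  rw [e1, add_mul, add_mul]
  refine (norm_add_le _ _).trans (add_le_add ((hb z hz).trans ?_) ((hb' z hz).trans ?_))
  · gcongr
  · gcongr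

/-- By Leibniz's rule the weights multiply and the exponents of the jet size add. All orders up to
`k` enter the sum, hence the uniform constants. -/
theorem Tame.mul (hO : IsOpen O) (hS : S ⊆ O) (hw : ∀ z ∈ S, 0 ≤ w z) (hw' : ∀ z ∈ S, 0 ≤ w' z)
    (h : Tame L O S w Ψ) (h' : Tame L O S w' Ψ') :
    Tame L O S (fun z => w z * w' z) (fun z => Ψ z * Ψ' z) := by
  refine ⟨h.smooth.mul h'.smooth, fun k => ?_⟩
  obtain ⟨C, m, N, hC, hb⟩ := h.bound_uniform hw k
  obtain ⟨C', m', N', hC', hb'⟩ := h'.bound_uniform hw' k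
  refine ⟨∑ i ∈ Finset.range (k + 1), (k.choose i : ℝ) * (C * C'), max m m', N + N',
    by positivity, fun z hz => ?_⟩
  have hle := norm_iteratedFDerivWithin_mul_le h.smooth h'.smooth hO.uniqueDiffOn (hS hz)
    (n := k) (by exact_mod_cast le_top)
  rw [iteratedFDeriv_eqOn_within hO k (hS hz)] at hle
  refine hle.trans ?_
  rw [Finset.sum_mul, Finset.sum_mul]
  refine Finset.sum_le_sum fun i hi => ?_
  rw [iteratedFDeriv_eqOn_within hO _ (hS hz), iteratedFDeriv_eqOn_within hO _ (hS hz)]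
  have hi' : i ≤ k := Nat.lt_succ_iff.1 (Finset.mem_range.1 hi)
  have h0 := hw z hz
  have h0' := hw' z hz
  have h1 := jetSize_pow_mono L (le_max_left m m') (le_refl N) z
  have h2 := jetSize_pow_mono L (le_max_right m m') (le_refl N') z
  have h3 := zero_le_one.trans (one_le_jetSize L m z)
  have h4 := zero_le_one.trans (one_le_jetSize L m' z)
  have h5 := zero_le_one.trans (one_le_jetSize L (max m m') z)
  have a1 := (hb i hi' z hz).trans (mul_le_mul_of_nonneg_left h1 (by positivity))
  have a2 := (hb' (k - i) (Nat.sub_le _ _) z hz).trans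
    (mul_le_mul_of_nonneg_left h2 (by positivity))
  calc (k.choose i : ℝ) * ‖iteratedFDeriv ℝ i Ψ z‖ * ‖iteratedFDeriv ℝ (k - i) Ψ' z‖
      ≤ (k.choose i : ℝ) * (C * w z * jetSize L (max m m') z ^ N)
          * (C' * w' z * jetSize L (max m m') z ^ N') := by gcongr
    _ = _ := by rw [pow_add]; ring

theorem tame_const (c : ℝ) : Tame L O S (fun _ => 1) (fun _ => c) := by
  refine ⟨contDiffOn_const, fun k => ⟨|c|, 0, 0, abs_nonneg c, fun z hz => ?_⟩⟩
  rcases k with _ | k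
  · simp
  · simp [iteratedFDeriv_const_of_ne]

theorem Tame.const_mul (hO : IsOpen O) (hS : S ⊆ O) (hw : ∀ z ∈ S, 0 ≤ w z)
    (h : Tame L O S w Ψ) (c : ℝ) : Tame L O S w (fun z => c * Ψ z) := by
  simpa using (tame_const c).mul hO hS (by simp) hw h

theorem Tame.of_weight_one_mul (hO : IsOpen O) (hS : S ⊆ O) (hw : ∀ z ∈ S, 0 ≤ w z)
    (h : Tame L O S (fun _ => 1) Ψ) (h' : Tame L O S w Ψ') :
    Tame L O S w (fun z => Ψ z * Ψ' z) := by
  simpa using h.mul hO hS (by simp) hw h'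

theorem tame_zero (hw : ∀ z ∈ S, 0 ≤ w z) : Tame L O S w (fun _ => 0) := by
  refine ⟨contDiffOn_const, fun k => ⟨0, 0, 0, le_rfl, fun z hz => ?_⟩⟩
  have : iteratedFDeriv ℝ k (fun _ : Z => (0 : ℝ)) = 0 := iteratedFDeriv_fun_zero
  simp [this]

theorem Tame.sum (hO : IsOpen O) (hS : S ⊆ O) (hw : ∀ z ∈ S, 0 ≤ w z) {ι : Type*}
    (s : Finset ι) {Ψ : ι → Z → ℝ} (h : ∀ i ∈ s, Tame L O S w (Ψ i)) :
    Tame L O S w (fun z => ∑ i ∈ s, Ψ i z) := by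
  classical
  induction s using Finset.induction_on with
  | empty => simpa using tame_zero hw
  | insert a s ha ih =>
    simp only [Finset.sum_insert ha]
    exact (h a (Finset.mem_insert_self a s)).add hO hS hw
      (ih fun i hi => h i (Finset.mem_insert_of_mem hi))

/-- `L` is unbounded where `f` is small; it is tame of weight one because the bounds allow powers of
its own jet. -/
theorem tame_self (hL : ContDiffOn ℝ ∞ L O) : Tame L O S (fun _ => 1) L :=
  ⟨hL, fun k => ⟨1, k, 1, zero_le_one, fun z _ => by
    simpa using norm_iteratedFDeriv_le_jetSize L le_rfl z⟩⟩

theorem tame_pow (hO : IsOpen O) (hS : S ⊆ O) (hL : ContDiffOn ℝ ∞ L O) (j : ℕ) :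
    Tame L O S (fun _ => 1) (fun z => L z ^ j) := by
  induction j with
  | zero => simpa using tame_const (L := L) (O := O) (S := S) 1
  | succ j ih =>
    simp only [pow_succ]
    simpa using ih.mul hO hS (by simp) (by simp) (tame_self hL)

theorem tame_polynomial (hO : IsOpen O) (hS : S ⊆ O) (hL : ContDiffOn ℝ ∞ L O)
    (P : Polynomial ℝ) : Tame L O S (fun _ => 1) (fun z => P.eval (L z)) := by
  simp only [Polynomial.eval_eq_sum_range]
  exact Tame.sum hO hS (by simp) _ fun j _ =>
    (tame_pow hO hS hL j).const_mul hO hS (by simp) _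

/-- Faà di Bruno's formula: every derivative of `exp` at `L z` is the weight itself, and the inner
derivatives contribute at most `k` factors of the jet size. The constant `k!` comes from the general
bound for compositions. -/
theorem tame_exp (hO : IsOpen O) (hS : S ⊆ O) (hL : ContDiffOn ℝ ∞ L O) :
    Tame L O S (fun z => Real.exp (L z)) (fun z => Real.exp (L z)) := by
  refine ⟨Real.contDiff_exp.comp_contDiffOn hL, fun k => ⟨k.factorial, k, k, by positivity,
    fun z hz => ?_⟩⟩
  have h := norm_iteratedFDerivWithin_comp_le (g := Real.exp) (f := L) (n := k) (N := ∞)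
    (t := univ) Real.contDiff_exp.contDiffOn hL (by exact_mod_cast le_top) uniqueDiffOn_univ
    hO.uniqueDiffOn (mapsTo_univ _ _) (hS hz) (C := Real.exp (L z)) (D := jetSize L k z)
    (fun i _ => ?_) (fun i hi hik => ?_)
  · rwa [iteratedFDeriv_eqOn_within hO k (hS hz)] at h
  · rw [iteratedFDerivWithin_univ, norm_iteratedFDeriv_eq_norm_iteratedDeriv]
    simp [iteratedDeriv_eq_iterate, abs_of_pos (Real.exp_pos _)]
  · rw [iteratedFDeriv_eqOn_within hO i (hS hz)]
    exact (norm_iteratedFDeriv_le_jetSize L hik z).trans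
      -- The composition bound wants the `i`th inner derivative below `D ^ i`; as `1 ≤ D` and `i ≥
      -- 1`, the bound `D` suffices.
      (le_self_pow₀ (one_le_jetSize L k z) (by omega))

theorem Tame.fderiv (hO : IsOpen O) (hS : S ⊆ O) (hw : ∀ z ∈ S, 0 ≤ w z) (h : Tame L O S w Ψ)
    (v : Z) : Tame L O S w (fun z => fderiv ℝ Ψ z v) := by
  have hs : ContDiffOn ℝ ∞ (_root_.fderiv ℝ Ψ) O := h.smooth.fderiv_of_isOpen hO (by simp)
  refine ⟨hs.clm_apply contDiffOn_const, fun k => ?_⟩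
  obtain ⟨C, m, N, hC, hb⟩ := h.bound (k + 1)
  refine ⟨‖v‖ * C, m, N, by positivity, fun z hz => ?_⟩
  have h1 : ContDiffAt ℝ k (_root_.fderiv ℝ Ψ) z :=
    (hs.contDiffAt (hO.mem_nhds (hS hz))).of_le (by exact_mod_cast le_top)
  have h2 := norm_iteratedFDeriv_clm_apply_const (c := v) h1 (le_refl (k : ℕ∞ω))
  refine h2.trans ?_
  rw [norm_iteratedFDeriv_fderiv, mul_assoc, mul_assoc]
  gcongr
  simpa [mul_assoc] using hb z hz

end Tame

/-! ### Tame functions of the position and of the momentum alone. -/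

section TameProd

variable {Y E : Type} [NormedAddCommGroup Y] [NormedSpace ℝ Y]
  [NormedAddCommGroup E] [NormedSpace ℝ E]

theorem tame_comp_fst {L : Y × E → ℝ} {U K : Set Y} (hU : IsOpen U) (hK : IsCompact K)
    (hKU : K ⊆ U) {g : Y → ℝ} (hg : ContDiffOn ℝ ∞ g U) :
    Tame L (U ×ˢ univ) (K ×ˢ univ) (fun _ => 1) (fun z => g z.1) := by
  have hO : IsOpen (U ×ˢ (univ : Set E)) := hU.prod isOpen_univ
  refine ⟨hg.comp contDiffOn_fst fun z hz => hz.1, fun k => ?_⟩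
  have hc : ContinuousOn (fun x => ‖iteratedFDerivWithin ℝ k g U x‖) K :=
    (hg.continuousOn_iteratedFDerivWithin (by exact_mod_cast le_top) hU.uniqueDiffOn).norm.mono hKU
  obtain ⟨C, hC⟩ := hK.bddAbove_image hc
  refine ⟨max C 0, 0, 0, le_max_right _ _, fun z hz => ?_⟩
  have hpre : (ContinuousLinearMap.fst ℝ Y E) ⁻¹' U = U ×ˢ (univ : Set E) := by ext; simp
  have h1 := (ContinuousLinearMap.fst ℝ Y E).iteratedFDerivWithin_comp_right (f := g) (s := U)
    (n := ∞) hg hU.uniqueDiffOn (by rw [hpre]; exact hO.uniqueDiffOn) (x := z) (hKU hz.1) (i := k)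
    (by exact_mod_cast le_top)
  rw [hpre, iteratedFDeriv_eqOn_within hO k ⟨hKU hz.1, mem_univ _⟩] at h1
  have h2 : (g ∘ (ContinuousLinearMap.fst ℝ Y E)) = fun z : Y × E => g z.1 := rfl
  rw [h2] at h1
  rw [h1]
  refine (ContinuousMultilinearMap.norm_compContinuousLinearMap_le _ _).trans ?_
  have h3 : ∏ _i : Fin k, ‖ContinuousLinearMap.fst ℝ Y E‖ ≤ 1 :=
    Finset.prod_le_one (fun _ _ => norm_nonneg _) fun _ _ =>
      ContinuousLinearMap.norm_fst_le ℝ Y E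
  have h4 : ‖iteratedFDerivWithin ℝ k g U z.1‖ ≤ max C 0 :=
    (hC ⟨z.1, hz.1, rfl⟩).trans (le_max_left _ _)
  simpa using mul_le_mul h4 h3 (by positivity) (le_max_right _ _)

/-- Order zero grows linearly in the momentum, order one is constant, and all higher orders vanish.
-/
theorem tame_clm_snd {L : Y × E → ℝ} {O S : Set (Y × E)} (ℓ : E →L[ℝ] ℝ) :
    Tame L O S (fun z => 1 + ‖z.2‖) (fun z => ℓ z.2) := by
  set T : Y × E →L[ℝ] ℝ := ℓ.comp (ContinuousLinearMap.snd ℝ Y E) with hT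
  have hTn : ‖T‖ ≤ ‖ℓ‖ := (ℓ.opNorm_comp_le _).trans
    (mul_le_of_le_one_right (norm_nonneg _) (ContinuousLinearMap.norm_snd_le ℝ Y E))
  have hTe : (fun z : Y × E => ℓ z.2) = T := rfl
  rw [hTe]
  refine ⟨T.contDiff.contDiffOn, fun k => ⟨‖ℓ‖, 0, 0, norm_nonneg _, fun z _ => ?_⟩⟩
  rw [pow_zero, mul_one, mul_add, mul_one]
  have h0 : 0 ≤ ‖ℓ‖ * ‖z.2‖ := by positivity
  rcases k with _ | _ | k
  · simpa [hT] using (ℓ.le_opNorm z.2).trans (le_add_of_nonneg_left (norm_nonneg _))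
  · rw [← norm_iteratedFDeriv_fderiv, norm_iteratedFDeriv_zero, T.fderiv]
    exact hTn.trans (le_add_of_nonneg_right h0)
  · have : fderiv ℝ (T : Y × E → ℝ) = fun _ => T := by ext1 z; exact T.fderiv
    rw [← norm_iteratedFDeriv_fderiv, this, iteratedFDeriv_const_of_ne (by omega)]
    simp only [Pi.zero_apply, norm_zero]
    positivity

end TameProd

/-! ### Decay in the momenta and vanishing of integrals of derivatives. -/

section Decay

variable {n : ℕ}

/-- The function `L` on `U × ℝⁿ` is smooth and `exp L` has the decay required of distribution
functions. -/
structure LogDecay (U : Set (Eu n)) (L : Eu n × Eu n → ℝ) : Prop where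
  isOpen : IsOpen U
  smooth : ContDiffOn ℝ ∞ L (U ×ˢ univ)
  decay : ∀ K ⊆ U, IsCompact K → ∀ k j : ℕ, ∃ C : ℝ, ∀ x ∈ K, ∀ p : Eu n,
    (1 + ‖p‖) ^ (n + 2) * (Real.exp (L (x, p)) * ‖iteratedFDeriv ℝ k L (x, p)‖ ^ j) ≤ C

/-- `Ψ` is tame with weight `w` over all compact subsets of `U`. -/
def TameOn (U : Set (Eu n)) (L w Ψ : Eu n × Eu n → ℝ) : Prop :=
  ∀ K ⊆ U, IsCompact K → Tame L (U ×ˢ univ) (K ×ˢ univ) w Ψ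

variable {U : Set (Eu n)} {L w Ψ : Eu n × Eu n → ℝ}

theorem TameOn.smooth (h : TameOn U L w Ψ) : ContDiffOn ℝ ∞ Ψ (U ×ˢ univ) :=
  (h ∅ (empty_subset _) isCompact_empty).smooth

theorem LogDecay.isOpen_prod (h : LogDecay U L) : IsOpen (U ×ˢ (univ : Set (Eu n))) :=
  h.isOpen.prod isOpen_univ

/-- Convexity of the `N`th power, one summand at a time. It is needed because the decay condition
controls powers of one derivative at a time, whereas the jet size mixes them. -/
theorem exists_one_add_sum_pow_le (s : Finset ℕ) (N : ℕ) :
    ∃ C : ℝ, 0 ≤ C ∧ ∀ a : ℕ → ℝ, (∀ i, 0 ≤ a i) →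
      (1 + ∑ i ∈ s, a i) ^ N ≤ C * (1 + ∑ i ∈ s, a i ^ N) := by
  induction s using Finset.induction_on with
  | empty => exact ⟨1, zero_le_one, fun a _ => by simp⟩
  | insert j s hj ih =>
    obtain ⟨C, hC, h⟩ := ih
    refine ⟨2 ^ (N - 1) * (C + 1), by positivity, fun a ha => ?_⟩
    have h1 := add_pow_le (add_nonneg zero_le_one (Finset.sum_nonneg fun i (_ : i ∈ s) => ha i))
      (ha j) N
    have h2 : 0 ≤ ∑ i ∈ s, a i ^ N := Finset.sum_nonneg fun i _ => pow_nonneg (ha i) N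
    have h3 : 0 ≤ a j ^ N := pow_nonneg (ha j) N
    rw [Finset.sum_insert hj, Finset.sum_insert hj, add_comm (a j), ← add_assoc]
    refine h1.trans ?_
    rw [mul_assoc]
    gcongr
    nlinarith [h a ha, mul_nonneg hC h3]

/-- The decay condition is spent here: the pair `(0, 0)` handles the summand `1` of the jet size,
and the pairs `(i, N)` handle the derivatives. -/
theorem LogDecay.exp_mul_jetSize_pow_le (h : LogDecay U L) {K : Set (Eu n)} (hKU : K ⊆ U)
    (hK : IsCompact K) (m N : ℕ) : ∃ C : ℝ, 0 ≤ C ∧ ∀ x ∈ K, ∀ p : Eu n,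
      Real.exp (L (x, p)) * jetSize L m (x, p) ^ N * (1 + ‖p‖) ^ (n + 2) ≤ C := by
  obtain ⟨c, hc, hs⟩ := exists_one_add_sum_pow_le (Finset.range (m + 1)) N
  choose C hC using fun k j => h.decay K hKU hK k j
  refine ⟨c * (|C 0 0| + ∑ i ∈ Finset.range (m + 1), |C i N|), by positivity, fun x hx p => ?_⟩
  have h1 := hs (fun i => ‖iteratedFDeriv ℝ i L (x, p)‖) fun i => norm_nonneg _
  have h2 : (1 + ‖p‖) ^ (n + 2) * Real.exp (L (x, p)) ≤ |C 0 0| := by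
    simpa using (hC 0 0 x hx p).trans (le_abs_self _)
  have h3 : ∀ i, (1 + ‖p‖) ^ (n + 2) * (Real.exp (L (x, p)) *
      ‖iteratedFDeriv ℝ i L (x, p)‖ ^ N) ≤ |C i N| := fun i => (hC i N x hx p).trans (le_abs_self _)
  calc Real.exp (L (x, p)) * jetSize L m (x, p) ^ N * (1 + ‖p‖) ^ (n + 2)
      ≤ Real.exp (L (x, p)) * (c * (1 + ∑ i ∈ Finset.range (m + 1),
          ‖iteratedFDeriv ℝ i L (x, p)‖ ^ N)) * (1 + ‖p‖) ^ (n + 2) := by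
        gcongr
        exact h1
    _ = c * ((1 + ‖p‖) ^ (n + 2) * Real.exp (L (x, p)) + ∑ i ∈ Finset.range (m + 1),
          (1 + ‖p‖) ^ (n + 2) * (Real.exp (L (x, p)) *
            ‖iteratedFDeriv ℝ i L (x, p)‖ ^ N)) := by
        rw [← Finset.mul_sum, ← Finset.mul_sum]
        ring
    _ ≤ _ := by
        gcongr with i
        exact h3 i

/-- The weight `exp L (1 + |p|)` of the integrands of first moments. -/
noncomputable def momentWeight (L : Eu n × Eu n → ℝ) (z : Eu n × Eu n) : ℝ :=
  Real.exp (L z) * (1 + ‖z.2‖)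

theorem momentWeight_nonneg (L : Eu n × Eu n → ℝ) (z : Eu n × Eu n) : 0 ≤ momentWeight L z := by
  unfold momentWeight; positivity

/-- An integrable function on `ℝⁿ`. -/
noncomputable def tailBound (n : ℕ) (p : Eu n) : ℝ := (1 + ‖p‖) ^ (-((n : ℝ) + 1))

/-- The exponent `n + 1` still exceeds the dimension. It is what is left of the decay exponent `n +
2` after one factor `1 + |p|` is given to first moments. -/
theorem integrable_tailBound : Integrable (tailBound n) :=
  integrable_one_add_norm (by simp)

theorem tailBound_pos (p : Eu n) : 0 < tailBound n p := by unfold tailBound; positivity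

theorem LogDecay.norm_iteratedFDeriv_le (h : LogDecay U L) (hΨ : TameOn U L (momentWeight L) Ψ)
    {K : Set (Eu n)} (hKU : K ⊆ U) (hK : IsCompact K) (k : ℕ) : ∃ C : ℝ, 0 ≤ C ∧
      ∀ x ∈ K, ∀ p : Eu n, ‖iteratedFDeriv ℝ k Ψ (x, p)‖ ≤ C * tailBound n p := by
  obtain ⟨C, m, N, hC, hb⟩ := (hΨ K hKU hK).bound k
  obtain ⟨D, hD, hd⟩ := h.exp_mul_jetSize_pow_le hKU hK m N
  refine ⟨C * D, by positivity, fun x hx p => (hb (x, p) ⟨hx, mem_univ p⟩).trans ?_⟩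
  have hp : 0 < 1 + ‖p‖ := by positivity
  have h1 : tailBound n p = ((1 + ‖p‖) ^ (n + 1))⁻¹ := by
    unfold tailBound
    rw [Real.rpow_neg hp.le]
    congr 1
    exact_mod_cast Real.rpow_natCast (1 + ‖p‖) (n + 1)
  have h2 := hd x hx p
  rw [h1, mul_assoc, mul_assoc]
  refine mul_le_mul_of_nonneg_left ?_ hC
  rw [← div_eq_mul_inv, le_div_iff₀ (by positivity)]
  refine le_trans (le_of_eq ?_) h2
  simp only [momentWeight]
  ring

theorem LogDecay.norm_le (h : LogDecay U L) (hΨ : TameOn U L (momentWeight L) Ψ)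
    {K : Set (Eu n)} (hKU : K ⊆ U) (hK : IsCompact K) : ∃ C : ℝ, 0 ≤ C ∧
      ∀ x ∈ K, ∀ p : Eu n, ‖Ψ (x, p)‖ ≤ C * tailBound n p := by
  simpa using h.norm_iteratedFDeriv_le hΨ hKU hK 0

/-- Link between the decay estimates and parametric integrals: moment integrands are dominated near
each base point by a multiple of `tailBound`. -/
theorem LogDecay.locallyDominated (h : LogDecay U L) (hΨ : TameOn U L (momentWeight L) Ψ) :
    LocallyDominated volume U Ψ := by
  intro k x₀ hx₀
  obtain ⟨K, hK, hx, hKU⟩ := exists_compact_subset h.isOpen hx₀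
  obtain ⟨C, -, hC⟩ := h.norm_iteratedFDeriv_le hΨ hKU hK k
  exact ⟨K, mem_interior_iff_mem_nhds.1 hx, _, integrable_tailBound.const_mul C, hC⟩

theorem TameOn.mono_weight {w' : Eu n × Eu n → ℝ} (h : TameOn U L w Ψ) (hw : ∀ z, w z ≤ w' z) :
    TameOn U L w' Ψ :=
  fun K hKU hK => (h K hKU hK).mono_weight fun z _ => hw z

theorem prod_univ_mono {K : Set (Eu n)} (hKU : K ⊆ U) :
    K ×ˢ (univ : Set (Eu n)) ⊆ U ×ˢ univ := prod_mono hKU Subset.rfl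

theorem TameOn.add (hU : IsOpen U) (hw : ∀ z, 0 ≤ w z) {Ψ' : Eu n × Eu n → ℝ}
    (h : TameOn U L w Ψ) (h' : TameOn U L w Ψ') : TameOn U L w (fun z => Ψ z + Ψ' z) :=
  fun K hKU hK => (h K hKU hK).add (hU.prod isOpen_univ) (prod_univ_mono hKU) (fun z _ => hw z)
    (h' K hKU hK)

theorem TameOn.mul (hU : IsOpen U) {w' : Eu n × Eu n → ℝ} (hw : ∀ z, 0 ≤ w z)
    (hw' : ∀ z, 0 ≤ w' z) {Ψ' : Eu n × Eu n → ℝ}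
    (h : TameOn U L w Ψ) (h' : TameOn U L w' Ψ') :
    TameOn U L (fun z => w z * w' z) (fun z => Ψ z * Ψ' z) :=
  fun K hKU hK => (h K hKU hK).mul (hU.prod isOpen_univ) (prod_univ_mono hKU) (fun z _ => hw z)
    (fun z _ => hw' z) (h' K hKU hK)

theorem TameOn.of_weight_one_mul (hU : IsOpen U) (hw : ∀ z, 0 ≤ w z) {Ψ' : Eu n × Eu n → ℝ}
    (h : TameOn U L (fun _ => 1) Ψ) (h' : TameOn U L w Ψ') :
    TameOn U L w (fun z => Ψ z * Ψ' z) := by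
  simpa using h.mul hU (by simp) hw h'

theorem TameOn.neg (hU : IsOpen U) (hw : ∀ z, 0 ≤ w z) (h : TameOn U L w Ψ) :
    TameOn U L w (fun z => -Ψ z) := by
  have h1 : TameOn U L (fun _ => 1) (fun _ => (-1 : ℝ)) := fun K _ _ => tame_const _
  simpa using h1.of_weight_one_mul hU hw h

theorem TameOn.sum (hU : IsOpen U) (hw : ∀ z, 0 ≤ w z) {ι : Type*} (s : Finset ι)
    {Ψ : ι → Eu n × Eu n → ℝ} (h : ∀ i, TameOn U L w (Ψ i)) :
    TameOn U L w (fun z => ∑ i ∈ s, Ψ i z) :=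
  fun K hKU hK => Tame.sum (hU.prod isOpen_univ) (prod_univ_mono hKU) (fun z _ => hw z) s
    fun i _ => h i K hKU hK

theorem TameOn.fderiv (hU : IsOpen U) (hw : ∀ z, 0 ≤ w z) (h : TameOn U L w Ψ)
    (v : Eu n × Eu n) : TameOn U L w (fun z => fderiv ℝ Ψ z v) :=
  fun K hKU hK => (h K hKU hK).fderiv (hU.prod isOpen_univ) (prod_univ_mono hKU)
    (fun z _ => hw z) v

theorem tameOn_comp_fst (hU : IsOpen U) {g : Eu n → ℝ} (hg : ContDiffOn ℝ ∞ g U) :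
    TameOn U L (fun _ => 1) (fun z => g z.1) :=
  fun _ hKU hK => tame_comp_fst hU hK hKU hg

theorem tameOn_polynomial (h : LogDecay U L) (P : Polynomial ℝ) :
    TameOn U L (fun _ => 1) (fun z => P.eval (L z)) :=
  fun _ hKU _ => tame_polynomial h.isOpen_prod (prod_univ_mono hKU) h.smooth P

theorem tameOn_exp (h : LogDecay U L) :
    TameOn U L (fun z => Real.exp (L z)) (fun z => Real.exp (L z)) :=
  fun _ hKU _ => tame_exp h.isOpen_prod (prod_univ_mono hKU) h.smooth

theorem tameOn_coord (i : Fin n) : TameOn U L (fun z => 1 + ‖z.2‖) (fun z => z.2 i) :=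
  fun _ _ _ => tame_clm_snd (EuclideanSpace.proj i : Eu n →L[ℝ] ℝ)

theorem tameOn_inner (hU : IsOpen U) {u : Eu n → Eu n} (hu : ContDiffOn ℝ ∞ u U) :
    TameOn U L (fun z => 1 + ‖z.2‖) (fun z => inner ℝ z.2 (u z.1)) := by
  have hw : ∀ z : Eu n × Eu n, 0 ≤ 1 + ‖z.2‖ := fun z => by positivity
  have h : ∀ i, TameOn U L (fun z => 1 + ‖z.2‖) (fun z => u z.1 i * z.2 i) := fun i =>
    (tameOn_comp_fst hU ((EuclideanSpace.proj i : Eu n →L[ℝ] ℝ).contDiff.comp_contDiffOn hu)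
      ).of_weight_one_mul hU hw (tameOn_coord i)
  simpa [PiLp.inner_apply] using TameOn.sum hU hw Finset.univ h

/-- Multiplying an integrand of momentum weight `exp L`. -/
theorem TameOn.exp_mul (h : LogDecay U L) (hΨ : TameOn U L (fun z => 1 + ‖z.2‖) Ψ) :
    TameOn U L (momentWeight L) (fun z => Real.exp (L z) * Ψ z) :=
  (tameOn_exp h).mul h.isOpen (fun _ => Real.exp_nonneg _) (fun z => by positivity) hΨ

theorem TameOn.weight_one_le (hΨ : TameOn U L (fun _ => 1) Ψ) :
    TameOn U L (fun z => 1 + ‖z.2‖) Ψ :=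
  hΨ.mono_weight fun z => le_add_of_nonneg_right (norm_nonneg _)

/-- The dominating function is a product: the indicator of the compact set `K` in the base times an
integrable function of the momentum. -/
theorem integrableOn_of_bound {K : Set (Eu n)} (hU : IsOpen U) (hKU : K ⊆ U) (hK : IsCompact K)
    (hc : ContinuousOn Ψ (U ×ˢ univ)) (h0 : ∀ z : Eu n × Eu n, z.1 ∈ U → z.1 ∉ K → Ψ z = 0)
    {C : ℝ} (hC : ∀ x ∈ K, ∀ p : Eu n, ‖Ψ (x, p)‖ ≤ C * tailBound n p) :
    IntegrableOn Ψ (U ×ˢ univ) := by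
  have hm : MeasurableSet (U ×ˢ (univ : Set (Eu n))) := (hU.prod isOpen_univ).measurableSet
  have hb : Integrable (fun z : Eu n × Eu n =>
      K.indicator (fun _ => (1 : ℝ)) z.1 * (C * tailBound n z.2)) :=
    Integrable.mul_prod (f := K.indicator fun _ => (1 : ℝ))
      ((integrable_indicator_iff hK.measurableSet).2
        (integrableOn_const hK.measure_lt_top.ne)) (integrable_tailBound.const_mul C)
  refine hb.integrableOn.mono' (hc.aestronglyMeasurable hm) ?_
  refine (ae_restrict_iff' hm).2 (Filter.Eventually.of_forall fun z hz => ?_)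
  by_cases hzK : z.1 ∈ K
  · simpa [hzK] using hC z.1 hzK z.2
  · simp [hzK, h0 z hz.1 hzK]

theorem fderiv_eq_zero_of_vanish {K : Set (Eu n)} (hU : IsOpen U) (hK : IsClosed K)
    (h0 : ∀ z : Eu n × Eu n, z.1 ∈ U → z.1 ∉ K → Ψ z = 0) {z : Eu n × Eu n} (hz : z.1 ∈ U)
    (hzK : z.1 ∉ K) : fderiv ℝ Ψ z = 0 := by
  have : Ψ =ᶠ[nhds z] fun _ => 0 := by
    have : (U \ K) ×ˢ (univ : Set (Eu n)) ∈ nhds z :=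
      ((hU.sdiff hK).prod isOpen_univ).mem_nhds ⟨⟨hz, hzK⟩, mem_univ _⟩
    filter_upwards [this] with y hy using h0 y hy.1.1 hy.1.2
  rw [this.fderiv_eq]
  simp

/-- The integral of a directional derivative vanishes. -/
theorem LogDecay.integral_fderiv_eq_zero (h : LogDecay U L)
    (hΨ : TameOn U L (momentWeight L) Ψ) {K : Set (Eu n)} (hKU : K ⊆ U) (hK : IsCompact K)
    (h0 : ∀ z : Eu n × Eu n, z.1 ∈ U → z.1 ∉ K → Ψ z = 0) (v : Eu n × Eu n) :
    IntegrableOn (fun z => fderiv ℝ Ψ z v) (U ×ˢ univ) ∧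
      ∫ z in U ×ˢ univ, fderiv ℝ Ψ z v = 0 := by
  have hO := h.isOpen_prod
  have hm := hO.measurableSet
  have hd := hΨ.fderiv h.isOpen (momentWeight_nonneg L) v
  have h0' : ∀ z : Eu n × Eu n, z.1 ∈ U → z.1 ∉ K → fderiv ℝ Ψ z v = 0 := fun z hz hzK => by
    rw [fderiv_eq_zero_of_vanish h.isOpen hK.isClosed h0 hz hzK]; rfl
  obtain ⟨C, -, hC⟩ := h.norm_le hΨ hKU hK
  obtain ⟨C', -, hC'⟩ := h.norm_le hd hKU hK
  have i1 := integrableOn_of_bound h.isOpen hKU hK hΨ.smooth.continuousOn h0 hC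
  have i2 := integrableOn_of_bound h.isOpen hKU hK hd.smooth.continuousOn h0' hC'
  refine ⟨i2, ?_⟩
  -- Since `Ψ` vanishes off the compact subset `K` of `U`, its extension by zero is differentiable
  -- on the whole space.
  set G : Eu n × Eu n → ℝ := (U ×ˢ univ).indicator Ψ with hG
  have hGd : ∀ z, HasFDerivAt G ((U ×ˢ univ).indicator (_root_.fderiv ℝ Ψ) z) z := by
    intro z
    by_cases hz : z ∈ U ×ˢ (univ : Set (Eu n))
    · rw [indicator_of_mem hz]
      have h1 : HasFDerivAt Ψ (_root_.fderiv ℝ Ψ z) z :=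
        ((hΨ.smooth.contDiffAt (hO.mem_nhds hz)).differentiableAt (by simp)).hasFDerivAt
      refine h1.congr_of_eventuallyEq ?_
      filter_upwards [hO.mem_nhds hz] with y hy using indicator_of_mem hy Ψ
    · rw [indicator_of_notMem hz]
      refine (hasFDerivAt_const (0 : ℝ) z).congr_of_eventuallyEq ?_
      have hzK : z.1 ∉ K := fun hk => hz ⟨hKU hk, mem_univ _⟩
      have : Kᶜ ×ˢ (univ : Set (Eu n)) ∈ nhds z :=
        (hK.isClosed.isOpen_compl.prod isOpen_univ).mem_nhds ⟨hzK, mem_univ _⟩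
      filter_upwards [this] with y hy
      by_cases hyU : y ∈ U ×ˢ (univ : Set (Eu n))
      · rw [hG, indicator_of_mem hyU]; exact h0 y hyU.1 hy.1
      · exact indicator_of_notMem hyU Ψ
  have hfd : ∀ z, _root_.fderiv ℝ G z v
      = (U ×ˢ univ).indicator (fun z => _root_.fderiv ℝ Ψ z v) z := by
    intro z
    rw [(hGd z).fderiv]
    by_cases hz : z ∈ U ×ˢ (univ : Set (Eu n))
    · simp only [indicator_of_mem hz]
    · simp only [indicator_of_notMem hz]; rfl
  have iG : Integrable G := (integrable_indicator_iff hm).2 i1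
  have iG' : Integrable (fun z => _root_.fderiv ℝ G z v) := by
    simp only [hfd]
    exact (integrable_indicator_iff hm).2 i2
  have : (volume : Measure (Eu n × Eu n)).IsAddHaarMeasure :=
    inferInstanceAs ((volume : Measure (Eu n)).prod volume).IsAddHaarMeasure
  -- Integration by parts against the constant `1`. Integrability of `G` and of its derivative
  -- stands in for compact support, which fails in the momenta.
  have key := integral_mul_fderiv_eq_neg_fderiv_mul_of_integrable (μ := volume)
    (f := fun _ : Eu n × Eu n => (1 : ℝ)) (g := G) (v := v) (by simp) (by simpa using iG')
    (by simpa using iG) (fun x _ => differentiableAt_const _)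
    (fun x _ => (hGd x).differentiableAt)
  simp only [one_mul, fderiv_fun_const, Pi.zero_apply, _root_.zero_apply, zero_mul,
    integral_zero, neg_zero, hfd] at key
  rwa [integral_indicator hm] at key

end Decay

/-! ### The canonical bracket on `ℝⁿ × ℝⁿ`. -/

section CanonicalBracket

variable {n : ℕ}

/-- The unit vector `∂/∂qⁱ` of `ℝⁿ × ℝⁿ`. -/
noncomputable abbrev qVec (i : Fin n) : Eu n × Eu n := (EuclideanSpace.single i (1 : ℝ), 0)

/-- The unit vector `∂/∂pᵢ` of `ℝⁿ × ℝⁿ`. -/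
noncomputable abbrev pVec (i : Fin n) : Eu n × Eu n := (0, EuclideanSpace.single i (1 : ℝ))

/-- The canonical Poisson structure on covectors of `ℝⁿ × ℝⁿ`. -/
noncomputable def pb (α β : Eu n × Eu n →L[ℝ] ℝ) : ℝ :=
  ∑ i : Fin n, (α (qVec i) * β (pVec i) - β (qVec i) * α (pVec i))

theorem pb_swap (α β : Eu n × Eu n →L[ℝ] ℝ) : pb α β = -pb β α := by
  simp [pb]

theorem pb_self (α : Eu n × Eu n →L[ℝ] ℝ) : pb α α = 0 := by simp [pb]

theorem pb_add_left (α α' β : Eu n × Eu n →L[ℝ] ℝ) : pb (α + α') β = pb α β + pb α' β := by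
  simp only [pb, ← Finset.sum_add_distrib, _root_.add_apply]
  exact Finset.sum_congr rfl fun i _ => by ring

theorem pb_smul_left (c : ℝ) (α β : Eu n × Eu n →L[ℝ] ℝ) : pb (c • α) β = c * pb α β := by
  simp only [pb, Finset.mul_sum, _root_.smul_apply, smul_eq_mul]
  exact Finset.sum_congr rfl fun i _ => by ring

theorem pb_add_right (α β β' : Eu n × Eu n →L[ℝ] ℝ) : pb α (β + β') = pb α β + pb α β' := by
  rw [pb_swap, pb_add_left, pb_swap β, pb_swap β']; ring

theorem pb_smul_right (c : ℝ) (α β : Eu n × Eu n →L[ℝ] ℝ) : pb α (c • β) = c * pb α β := by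
  rw [pb_swap, pb_smul_left, pb_swap β]; ring

theorem pb_sum_left {ι : Type*} (s : Finset ι) (α : ι → (Eu n × Eu n →L[ℝ] ℝ))
    (β : Eu n × Eu n →L[ℝ] ℝ) : pb (∑ a ∈ s, α a) β = ∑ a ∈ s, pb (α a) β := by
  classical
  induction s using Finset.induction_on with
  | empty => simp [pb]
  | insert a s ha ih => rw [Finset.sum_insert ha, Finset.sum_insert ha, pb_add_left, ih]

theorem pb_sum_right {ι : Type*} (s : Finset ι) (α : Eu n × Eu n →L[ℝ] ℝ)
    (β : ι → (Eu n × Eu n →L[ℝ] ℝ)) : pb α (∑ a ∈ s, β a) = ∑ a ∈ s, pb α (β a) := by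
  rw [pb_swap, pb_sum_left, ← Finset.sum_neg_distrib]
  exact Finset.sum_congr rfl fun a _ => (pb_swap _ _).symm

/-- A covector on the base, as a covector on `ℝⁿ × ℝⁿ`. -/
noncomputable abbrev baseCovector (α : Eu n →L[ℝ] ℝ) : Eu n × Eu n →L[ℝ] ℝ :=
  α.comp (ContinuousLinearMap.fst ℝ (Eu n) (Eu n))

theorem pb_baseCovector (α β : Eu n →L[ℝ] ℝ) : pb (baseCovector α) (baseCovector β) = 0 := by
  simp [pb]

theorem sum_inner_single_mul (w : Eu n) (ℓ : Eu n →L[ℝ] ℝ) :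
    ∑ i, ℓ (EuclideanSpace.single i (1 : ℝ)) * w i = ℓ w := by
  conv_rhs => rw [← (EuclideanSpace.basisFun (Fin n) ℝ).sum_repr w, map_sum]
  exact Finset.sum_congr rfl fun i _ => by simp [mul_comm]

/-- The differential of `(x, p) ↦ ⟨p, u x⟩`, if `u` has the derivative `u'`. -/
noncomputable def momentumCovector (p ux : Eu n) (u' : Eu n →L[ℝ] Eu n) :
    Eu n × Eu n →L[ℝ] ℝ :=
  ((innerSL ℝ p).comp u').comp (ContinuousLinearMap.fst ℝ (Eu n) (Eu n)) +
    (innerSL ℝ ux).comp (ContinuousLinearMap.snd ℝ (Eu n) (Eu n))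

theorem hasFDerivAt_momentum {u : Eu n → Eu n} {z : Eu n × Eu n}
    (hu : DifferentiableAt ℝ u z.1) :
    HasFDerivAt (fun z : Eu n × Eu n => inner ℝ z.2 (u z.1))
      (momentumCovector z.2 (u z.1) (fderiv ℝ u z.1)) z := by
  have h := (hasFDerivAt_snd (𝕜 := ℝ) (p := z)).inner ℝ (hu.hasFDerivAt.comp z hasFDerivAt_fst)
  refine h.congr_fderiv ?_
  ext v <;> simp [momentumCovector, real_inner_comm]

theorem pb_momentum_base (p ux : Eu n) (u' : Eu n →L[ℝ] Eu n) (β : Eu n →L[ℝ] ℝ) :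
    pb (momentumCovector p ux u') (baseCovector β) = -β ux := by
  rw [← sum_inner_single_mul ux β, ← Finset.sum_neg_distrib]
  simp [pb, momentumCovector, EuclideanSpace.inner_single_right]

/-- The map from a vector field to its momentum function is an antihomomorphism for this sign of the
bracket; this is the source of the minus sign in the fluid bracket. -/
theorem pb_momentum_momentum (p ux vx : Eu n) (u' v' : Eu n →L[ℝ] Eu n) :
    pb (momentumCovector p ux u') (momentumCovector p vx v') = -inner ℝ p (v' ux - u' vx) := by
  have h1 := sum_inner_single_mul vx ((innerSL ℝ p).comp u')
  have h2 := sum_inner_single_mul ux ((innerSL ℝ p).comp v')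
  simp only [ContinuousLinearMap.comp_apply, innerSL_apply_apply] at h1 h2
  rw [inner_sub_right, ← h1, ← h2]
  simp [pb, momentumCovector, EuclideanSpace.inner_single_right]

variable {U : Set (Eu n)} {L : Eu n × Eu n → ℝ}

/-- Hamiltonian vector fields are divergence free, so the bracket is the divergence of `B` times the
Hamiltonian field of `A`, up to sign. The weight `exp L` of `B` and the factor `1 + |p|` from the
derivatives of `A` make up exactly the moment weight, and only `B` has to vanish off `K`. -/
theorem LogDecay.integral_pb_eq_zero (h : LogDecay U L) {A B : Eu n × Eu n → ℝ}
    (hA : TameOn U L (fun z => 1 + ‖z.2‖) A) (hB : TameOn U L (fun z => Real.exp (L z)) B)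
    {K : Set (Eu n)} (hKU : K ⊆ U) (hK : IsCompact K)
    (h0 : ∀ z : Eu n × Eu n, z.1 ∈ U → z.1 ∉ K → B z = 0) :
    IntegrableOn (fun z => pb (fderiv ℝ A z) (fderiv ℝ B z)) (U ×ˢ univ) ∧
      ∫ z in U ×ˢ univ, pb (fderiv ℝ A z) (fderiv ℝ B z) = 0 := by
  have hO := h.isOpen_prod
  have hw : ∀ z : Eu n × Eu n, 0 ≤ 1 + ‖z.2‖ := fun z => by positivity
  have hprod : ∀ v : Eu n × Eu n,
      TameOn U L (momentWeight L) (fun z => B z * fderiv ℝ A z v) := fun v =>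
    hB.mul h.isOpen (fun _ => Real.exp_nonneg _) hw (hA.fderiv h.isOpen hw v)
  have hv0 : ∀ v : Eu n × Eu n, ∀ z : Eu n × Eu n, z.1 ∈ U → z.1 ∉ K →
      B z * fderiv ℝ A z v = 0 := fun v z hz hzK => by rw [h0 z hz hzK, zero_mul]
  have key := fun v v' => h.integral_fderiv_eq_zero (hprod v) hKU hK (hv0 v) v'
  -- `{A, B} = ∑ ∂_{pᵢ}(B ∂_{qⁱ}A) - ∂_{qⁱ}(B ∂_{pᵢ}A)`: the second derivatives of `A` cancel by
  -- symmetry.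
  have hpt : ∀ z ∈ U ×ˢ (univ : Set (Eu n)), pb (fderiv ℝ A z) (fderiv ℝ B z) =
      ∑ i : Fin n, (fderiv ℝ (fun z => B z * fderiv ℝ A z (qVec i)) z (pVec i)
        - fderiv ℝ (fun z => B z * fderiv ℝ A z (pVec i)) z (qVec i)) := by
    intro z hz
    have hAs := hA.smooth.contDiffAt (hO.mem_nhds hz)
    have hBd : DifferentiableAt ℝ B z :=
      (hB.smooth.contDiffAt (hO.mem_nhds hz)).differentiableAt (by simp)
    have hAd : DifferentiableAt ℝ (fderiv ℝ A) z :=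
      (hAs.fderiv_right (m := 1) (by norm_cast)).differentiableAt (by simp)
    have hsymm : IsSymmSndFDerivAt ℝ A z := hAs.isSymmSndFDerivAt (by simp; norm_cast)
    have hmul : ∀ v v' : Eu n × Eu n, fderiv ℝ (fun z => B z * fderiv ℝ A z v) z v'
        = B z * fderiv ℝ (fderiv ℝ A) z v' v + fderiv ℝ A z v * fderiv ℝ B z v' := by
      intro v v'
      have h1 := hBd.hasFDerivAt.mul (hAd.hasFDerivAt.clm_apply (hasFDerivAt_const v z))
      have h2 : (B * fun z => fderiv ℝ A z v) = fun z => B z * fderiv ℝ A z v := rfl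
      rw [← h2, h1.fderiv]
      simp
    refine Finset.sum_congr rfl fun i _ => ?_
    rw [hmul, hmul, hsymm.eq (pVec i) (qVec i)]
    ring
  have hint : ∀ i : Fin n, IntegrableOn (fun z =>
      fderiv ℝ (fun z => B z * fderiv ℝ A z (qVec i)) z (pVec i)
        - fderiv ℝ (fun z => B z * fderiv ℝ A z (pVec i)) z (qVec i)) (U ×ˢ univ) := fun i =>
    (key (qVec i) (pVec i)).1.sub (key (pVec i) (qVec i)).1
  constructor
  · refine IntegrableOn.congr_fun ?_ (fun z hz => (hpt z hz).symm) hO.measurableSet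
    exact integrable_finsetSum _ fun i _ => hint i
  · rw [setIntegral_congr_fun hO.measurableSet hpt, integral_finsetSum _ fun i _ => hint i]
    refine Finset.sum_eq_zero fun i _ => ?_
    rw [integral_sub (key (qVec i) (pVec i)).1 (key (pVec i) (qVec i)).1,
      (key (qVec i) (pVec i)).2, (key (pVec i) (qVec i)).2, sub_zero]

end CanonicalBracket

/-! ### Polynomials in the logarithm and the bracket identity in a chart. -/

section Polynomials

open Polynomial

/-- The operator `1 + D` on polynomials is invertible because `D` is locally nilpotent. The point is
that `exp(L) Q(L) dL` is then the exact form `d(exp(L) Z(L))`. -/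
theorem exists_add_derivative_eq (Q : ℝ[X]) : ∃ Z : ℝ[X], Z + derivative Z = Q := by
  suffices h : ∀ N : ℕ, ∀ Q : ℝ[X], derivative^[N] Q = 0 → ∃ Z : ℝ[X], Z + derivative Z = Q from
    h (Q.natDegree + 1) Q (iterate_derivative_eq_zero (Nat.lt_succ_self _))
  intro N
  induction N with
  | zero => intro Q hQ; exact ⟨0, by simpa using hQ.symm⟩
  | succ N ih =>
    intro Q hQ
    obtain ⟨Z, hZ⟩ := ih (derivative Q) hQ
    -- If `Z` solves the equation for `Q'`, then `(Q - Z) + (Q - Z)' = Q + Q' - (Z + Z') = Q`.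
    refine ⟨Q - Z, ?_⟩
    rw [derivative_sub, ← hZ]
    ring

variable {n : ℕ} {U : Set (Eu n)} {L : Eu n × Eu n → ℝ}

theorem hasFDerivAt_eval {z : Eu n × Eu n} (hL : DifferentiableAt ℝ L z) (P : ℝ[X]) :
    HasFDerivAt (fun z => P.eval (L z)) ((derivative P).eval (L z) • fderiv ℝ L z) z :=
  (P.hasDerivAt (L z)).comp_hasFDerivAt z hL.hasFDerivAt

/-- The function `G(x) exp(L) P(L)`. -/
noncomputable def expPoly (L : Eu n × Eu n → ℝ) (G : Eu n → ℝ) (P : ℝ[X]) (z : Eu n × Eu n) : ℝ :=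
  G z.1 * (Real.exp (L z) * P.eval (L z))

theorem tameOn_expPoly (h : LogDecay U L) {G : Eu n → ℝ} (hG : ContDiffOn ℝ ∞ G U) (P : ℝ[X]) :
    TameOn U L (fun z => Real.exp (L z)) (expPoly L G P) := by
  have h1 := (tameOn_polynomial h P).of_weight_one_mul h.isOpen (fun _ => Real.exp_nonneg _)
    (tameOn_exp h)
  have h2 := (tameOn_comp_fst (L := L) h.isOpen hG).of_weight_one_mul h.isOpen
    (fun _ => Real.exp_nonneg _) h1
  have h3 : expPoly L G P = fun z => G z.1 * (P.eval (L z) * Real.exp (L z)) := by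
    ext z; simp [expPoly, mul_comm]
  rwa [h3]

theorem hasFDerivAt_base {G : Eu n → ℝ} {z : Eu n × Eu n} (hG : DifferentiableAt ℝ G z.1) :
    HasFDerivAt (fun z : Eu n × Eu n => G z.1) (baseCovector (fderiv ℝ G z.1)) z :=
  hG.hasFDerivAt.comp z hasFDerivAt_fst

theorem fderiv_expPoly {z : Eu n × Eu n} (hL : DifferentiableAt ℝ L z) {G : Eu n → ℝ}
    (hG : DifferentiableAt ℝ G z.1) (P : ℝ[X]) :
    fderiv ℝ (expPoly L G P) z =
      (G z.1 * (Real.exp (L z) * (P + derivative P).eval (L z))) • fderiv ℝ L z +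
        (Real.exp (L z) * P.eval (L z)) • baseCovector (fderiv ℝ G z.1) := by
  have h := (hasFDerivAt_base hG).mul (hL.hasFDerivAt.exp.mul (hasFDerivAt_eval hL P))
  refine h.fderiv.trans ?_
  ext v <;> simp <;> ring

theorem pb_fderiv_expPoly {z : Eu n × Eu n} (hL : DifferentiableAt ℝ L z) {G : Eu n → ℝ}
    (hG : DifferentiableAt ℝ G z.1) (P : ℝ[X]) (α : Eu n × Eu n →L[ℝ] ℝ) :
    pb α (fderiv ℝ (expPoly L G P) z) =
      G z.1 * (Real.exp (L z) * (P + derivative P).eval (L z)) * pb α (fderiv ℝ L z) +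
        Real.exp (L z) * P.eval (L z) * pb α (baseCovector (fderiv ℝ G z.1)) := by
  rw [fderiv_expPoly hL hG, pb_add_right, pb_smul_right, pb_smul_right]

variable {ι : Type*} [Fintype ι]

/-- The function `⟨p, u(x)⟩ + ∑ (Y_a + Y_a')(L) g_a(x)`. -/
noncomputable def liftCoord (L : Eu n × Eu n → ℝ) (Y : ι → ℝ[X]) (u : Eu n → Eu n)
    (g : ι → Eu n → ℝ) (z : Eu n × Eu n) : ℝ :=
  inner ℝ z.2 (u z.1) + ∑ a, (Y a + derivative (Y a)).eval (L z) * g a z.1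

theorem fderiv_liftCoord {z : Eu n × Eu n} (hL : DifferentiableAt ℝ L z) (Y : ι → ℝ[X])
    {u : Eu n → Eu n} (hu : DifferentiableAt ℝ u z.1) {g : ι → Eu n → ℝ}
    (hg : ∀ a, DifferentiableAt ℝ (g a) z.1) :
    fderiv ℝ (liftCoord L Y u g) z = momentumCovector z.2 (u z.1) (fderiv ℝ u z.1) +
      ∑ a, (Y a + derivative (Y a)).eval (L z) • baseCovector (fderiv ℝ (g a) z.1) +
      (∑ a, g a z.1 * (derivative (Y a + derivative (Y a))).eval (L z)) • fderiv ℝ L z := by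
  have h := (hasFDerivAt_momentum hu).add (HasFDerivAt.fun_sum (u := Finset.univ) fun a _ =>
    (hasFDerivAt_eval hL (Y a + derivative (Y a))).mul (hasFDerivAt_base (hg a)))
  refine h.fderiv.trans ?_
  rw [Finset.sum_add_distrib, add_assoc, Finset.sum_smul]
  simp only [smul_smul]

/-- Each differential splits into a momentum part, a base part and a multiple of `dL`. In the
bilinear expansion, base against base and `dL` against `dL` give zero; the first three terms are
free of `dL` and the last four are linear in it. -/
theorem pb_liftCoord {z : Eu n × Eu n} (hL : DifferentiableAt ℝ L z) (Y : ι → ℝ[X])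
    {u v : Eu n → Eu n} (hu : DifferentiableAt ℝ u z.1) (hv : DifferentiableAt ℝ v z.1)
    {g h : ι → Eu n → ℝ}
    (hg : ∀ a, DifferentiableAt ℝ (g a) z.1) (hh : ∀ a, DifferentiableAt ℝ (h a) z.1) :
    pb (fderiv ℝ (liftCoord L Y u g) z) (fderiv ℝ (liftCoord L Y v h) z) =
      -inner ℝ z.2 (VectorField.lieBracket ℝ u v z.1)
      - ∑ a, (Y a + derivative (Y a)).eval (L z) * fderiv ℝ (h a) z.1 (u z.1)
      + ∑ a, (Y a + derivative (Y a)).eval (L z) * fderiv ℝ (g a) z.1 (v z.1)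
      + (∑ a, h a z.1 * (derivative (Y a + derivative (Y a))).eval (L z)) *
        pb (momentumCovector z.2 (u z.1) (fderiv ℝ u z.1)) (fderiv ℝ L z)
      - (∑ a, g a z.1 * (derivative (Y a + derivative (Y a))).eval (L z)) *
        pb (momentumCovector z.2 (v z.1) (fderiv ℝ v z.1)) (fderiv ℝ L z)
      - (∑ a, g a z.1 * (derivative (Y a + derivative (Y a))).eval (L z)) *
        ∑ b, (Y b + derivative (Y b)).eval (L z) *
          pb (baseCovector (fderiv ℝ (h b) z.1)) (fderiv ℝ L z)
      + (∑ b, h b z.1 * (derivative (Y b + derivative (Y b))).eval (L z)) *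
        ∑ a, (Y a + derivative (Y a)).eval (L z) *
          pb (baseCovector (fderiv ℝ (g a) z.1)) (fderiv ℝ L z) := by
  rw [fderiv_liftCoord hL Y hu hg, fderiv_liftCoord hL Y hv hh]
  set lam := fderiv ℝ L z
  set mu := momentumCovector z.2 (u z.1) (fderiv ℝ u z.1)
  set mv := momentumCovector z.2 (v z.1) (fderiv ℝ v z.1)
  have e1 : pb mu mv = -inner ℝ z.2 (VectorField.lieBracket ℝ u v z.1) :=
    pb_momentum_momentum _ _ _ _ _
  have e2 : ∀ β, pb mu (baseCovector β) = -β (u z.1) := fun β => pb_momentum_base _ _ _ β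
  have e3 : ∀ β, pb (baseCovector β) mv = β (v z.1) := fun β => by
    rw [pb_swap, pb_momentum_base, neg_neg]
  simp only [pb_add_left, pb_add_right, pb_smul_left, pb_smul_right, pb_sum_left, pb_sum_right,
    pb_self, pb_baseCovector, e1, e2, e3, pb_swap lam]
  have e4 : ∀ c : ℝ, ∑ b, (Y b + derivative (Y b)).eval (L z) *
      (c * pb (baseCovector (fderiv ℝ (h b) z.1)) lam) = c * ∑ b,
        (Y b + derivative (Y b)).eval (L z) * pb (baseCovector (fderiv ℝ (h b) z.1)) lam := by
    intro c
    rw [Finset.mul_sum]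
    exact Finset.sum_congr rfl fun b _ => by ring
  simp only [mul_zero, Finset.sum_const_zero, add_zero, mul_neg, mul_add, Finset.sum_neg_distrib,
    Finset.sum_add_distrib, e4]
  ring

/-- The algebra of the cancellation. Here `E = exp L`; `P = ⟨p,[u,v]⟩`; `y`, `y'`, `d` are the
values at `L` of `Y_a`, `Y_a'`, `(Y_a + Y_a')'`; `Ul`, `Vl`, `Hl`, `Gl` are brackets with `L` of the
momentum functions of `u`, `v` and of `h`, `g`; `Ur`, `Vr`, `Uh`, `Vg` are derivatives along `u` or
`v`. The first four sums on the right are the exact brackets, the last two terms the fluid integrand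
and the boundary term. -/
theorem bracket_sum_identity (r E P Ul Vl Ur Vr : ℝ) (y y' d g h Uh Vg Hl Gl : ι → ℝ) :
    r * (E * (-P - ∑ a, (y a + y' a) * Uh a + ∑ a, (y a + y' a) * Vg a + (∑ a, h a * d a) * Ul
      - (∑ a, g a * d a) * Vl - (∑ a, g a * d a) * ∑ b, (y b + y' b) * Hl b
      + (∑ b, h b * d b) * ∑ a, (y a + y' a) * Gl a)) =
    (∑ a, (r * h a * (E * d a) * Ul + E * y' a * -(r * Uh a + h a * Ur)))
    - (∑ a, (r * g a * (E * d a) * Vl + E * y' a * -(r * Vg a + g a * Vr)))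
    - (∑ a, ∑ b, r * g a * (E * (d a * (y b + y' b))) * Hl b)
    + (∑ a, ∑ b, r * h b * (E * (d b * (y a + y' a))) * Gl a)
    - r * (E * (P + ∑ a, y a * (Uh a - Vg a)))
    + E * ∑ a, y' a * (h a * Ur - g a * Vr) := by
  have s3 : ∑ a, ∑ b, r * g a * (E * (d a * (y b + y' b))) * Hl b
      = r * E * ((∑ a, g a * d a) * ∑ b, (y b + y' b) * Hl b) := by
    rw [Finset.sum_mul_sum, Finset.mul_sum]
    refine Finset.sum_congr rfl fun a _ => ?_
    rw [Finset.mul_sum]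
    exact Finset.sum_congr rfl fun b _ => by ring
  have s4 : ∑ a, ∑ b, r * h b * (E * (d b * (y a + y' a))) * Gl a
      = r * E * ((∑ b, h b * d b) * ∑ a, (y a + y' a) * Gl a) := by
    rw [mul_comm (∑ b, h b * d b), Finset.sum_mul_sum, Finset.mul_sum]
    refine Finset.sum_congr rfl fun a _ => ?_
    rw [Finset.mul_sum]
    exact Finset.sum_congr rfl fun b _ => by ring
  have s1 : ∑ a, (r * h a * (E * d a) * Ul + E * y' a * -(r * Uh a + h a * Ur))
      = r * E * ((∑ a, h a * d a) * Ul) - r * E * ∑ a, y' a * Uh a - E * ∑ a, y' a * (h a * Ur) := by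
    rw [Finset.sum_mul, Finset.mul_sum, Finset.mul_sum, Finset.mul_sum, ← Finset.sum_sub_distrib,
      ← Finset.sum_sub_distrib]
    exact Finset.sum_congr rfl fun a _ => by ring
  have s2 : ∑ a, (r * g a * (E * d a) * Vl + E * y' a * -(r * Vg a + g a * Vr))
      = r * E * ((∑ a, g a * d a) * Vl) - r * E * ∑ a, y' a * Vg a - E * ∑ a, y' a * (g a * Vr) := by
    rw [Finset.sum_mul, Finset.mul_sum, Finset.mul_sum, Finset.mul_sum, ← Finset.sum_sub_distrib,
      ← Finset.sum_sub_distrib]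
    exact Finset.sum_congr rfl fun a _ => by ring
  rw [s1, s2, s3, s4]
  simp only [add_mul (y _), mul_sub (y _), mul_sub (y' _), Finset.sum_add_distrib,
    Finset.sum_sub_distrib]
  ring

/-- The local form of the Poisson property: in a chart, the bracket of two lifted functions,
multiplied by a cutoff `r`, is minus the lifted bracket up to derivatives of `r` and
divergences. -/
theorem LogDecay.integral_bracket (hL : LogDecay U L) (Y : ι → ℝ[X]) {u v : Eu n → Eu n}
    (hu : ContDiffOn ℝ ∞ u U) (hv : ContDiffOn ℝ ∞ v U) {g h : ι → Eu n → ℝ}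
    (hg : ∀ a, ContDiffOn ℝ ∞ (g a) U) (hh : ∀ a, ContDiffOn ℝ ∞ (h a) U) {r : Eu n → ℝ}
    (hr : ContDiffOn ℝ ∞ r U) {K : Set (Eu n)} (hKU : K ⊆ U) (hK : IsCompact K)
    (hr0 : ∀ x ∈ U, x ∉ K → r x = 0) :
    IntegrableOn (fun z => r z.1 * (Real.exp (L z) *
      pb (fderiv ℝ (liftCoord L Y u g) z) (fderiv ℝ (liftCoord L Y v h) z))) (U ×ˢ univ) ∧
    IntegrableOn (fun z => r z.1 * (Real.exp (L z) *
      (inner ℝ z.2 (VectorField.lieBracket ℝ u v z.1) + ∑ a, (Y a).eval (L z) *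
        (fderiv ℝ (h a) z.1 (u z.1) - fderiv ℝ (g a) z.1 (v z.1))))) (U ×ˢ univ) ∧
    IntegrableOn (fun z => Real.exp (L z) * ∑ a, (derivative (Y a)).eval (L z) *
      (h a z.1 * fderiv ℝ r z.1 (u z.1) - g a z.1 * fderiv ℝ r z.1 (v z.1))) (U ×ˢ univ) ∧
    (∫ z in U ×ˢ univ, r z.1 * (Real.exp (L z) *
      pb (fderiv ℝ (liftCoord L Y u g) z) (fderiv ℝ (liftCoord L Y v h) z))) +
    (∫ z in U ×ˢ univ, r z.1 * (Real.exp (L z) *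
      (inner ℝ z.2 (VectorField.lieBracket ℝ u v z.1) + ∑ a, (Y a).eval (L z) *
        (fderiv ℝ (h a) z.1 (u z.1) - fderiv ℝ (g a) z.1 (v z.1))))) =
    ∫ z in U ×ˢ univ, Real.exp (L z) * ∑ a, (derivative (Y a)).eval (L z) *
      (h a z.1 * fderiv ℝ r z.1 (u z.1) - g a z.1 * fderiv ℝ r z.1 (v z.1)) := by
  have hU := hL.isOpen
  have hO := hL.isOpen_prod
  have hm := hO.measurableSet
  have hw : ∀ z : Eu n × Eu n, 0 ≤ 1 + ‖z.2‖ := fun z => by positivity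
  -- The primitives for the mixed terms, in which a `dL` coefficient of one lift meets a base
  -- coefficient of the other.
  choose Z hZ using fun ab : ι × ι =>
    exists_add_derivative_eq (derivative (Y ab.1 + derivative (Y ab.1)) *
      (Y ab.2 + derivative (Y ab.2)))
  -- smoothness of the coefficients
  have hDer : ∀ {f : Eu n → ℝ} {w : Eu n → Eu n}, ContDiffOn ℝ ∞ f U → ContDiffOn ℝ ∞ w U →
      ContDiffOn ℝ ∞ (fun x => fderiv ℝ f x (w x)) U := fun hf hw =>
    (hf.fderiv_of_isOpen hU (by simp)).clm_apply hw
  have hDer' : ∀ {f w : Eu n → Eu n}, ContDiffOn ℝ ∞ f U → ContDiffOn ℝ ∞ w U →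
      ContDiffOn ℝ ∞ (fun x => fderiv ℝ f x (w x)) U := fun hf hw =>
    (hf.fderiv_of_isOpen hU (by simp)).clm_apply hw
  have hlie : ContDiffOn ℝ ∞ (VectorField.lieBracket ℝ u v) U :=
    (hDer' hv hu).sub (hDer' hu hv)
  have hrd0 : ∀ x ∈ U, x ∉ K → fderiv ℝ r x = 0 := by
    intro x hx hxK
    have : r =ᶠ[nhds x] fun _ => 0 := by
      filter_upwards [(hU.sdiff hK.isClosed).mem_nhds ⟨hx, hxK⟩] with y hy using hr0 y hy.1 hy.2
    rw [this.fderiv_eq]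
    simp
  -- the integrands of the moments
  have t1 : TameOn U L (momentWeight L) (fun z => Real.exp (L z) * (r z.1 *
      (inner ℝ z.2 (VectorField.lieBracket ℝ u v z.1) + ∑ a, (Y a).eval (L z) *
        (fderiv ℝ (h a) z.1 (u z.1) - fderiv ℝ (g a) z.1 (v z.1))))) := by
    refine TameOn.exp_mul hL ((tameOn_comp_fst hU hr).of_weight_one_mul hU hw
      ((tameOn_inner hU hlie).add hU hw (TameOn.sum hU hw _ fun a => ?_)))
    exact ((tameOn_polynomial hL (Y a)).of_weight_one_mul hU (by simp) (tameOn_comp_fst hU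
      ((hDer (hh a) hu).sub (hDer (hg a) hv)))).weight_one_le
  have t2 : TameOn U L (momentWeight L) (fun z => Real.exp (L z) * ∑ a,
      (derivative (Y a)).eval (L z) *
      (h a z.1 * fderiv ℝ r z.1 (u z.1) - g a z.1 * fderiv ℝ r z.1 (v z.1))) := by
    refine TameOn.exp_mul hL (TameOn.sum hU hw _ fun a => ?_)
    exact ((tameOn_polynomial hL (derivative (Y a))).of_weight_one_mul hU (by simp)
      (tameOn_comp_fst hU
      (((hh a).mul (hDer hr hu)).sub ((hg a).mul (hDer hr hv))))).weight_one_le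
  have i1 : IntegrableOn (fun z => r z.1 * (Real.exp (L z) *
      (inner ℝ z.2 (VectorField.lieBracket ℝ u v z.1) + ∑ a, (Y a).eval (L z) *
        (fderiv ℝ (h a) z.1 (u z.1) - fderiv ℝ (g a) z.1 (v z.1))))) (U ×ˢ univ) := by
    obtain ⟨C, -, hC⟩ := hL.norm_le t1 hKU hK
    refine (integrableOn_of_bound hU hKU hK t1.smooth.continuousOn (fun z hz hzK => ?_) hC
      ).congr_fun (fun z _ => by ring) hm
    rw [hr0 z.1 hz hzK]; ring
  have i2 : IntegrableOn (fun z => Real.exp (L z) * ∑ a, (derivative (Y a)).eval (L z) *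
      (h a z.1 * fderiv ℝ r z.1 (u z.1) - g a z.1 * fderiv ℝ r z.1 (v z.1))) (U ×ˢ univ) := by
    obtain ⟨C, -, hC⟩ := hL.norm_le t2 hKU hK
    refine integrableOn_of_bound hU hKU hK t2.smooth.continuousOn (fun z hz hzK => ?_) hC
    simp [hrd0 z.1 hz hzK]
  -- the divergences
  have hB : ∀ {A : Eu n × Eu n → ℝ} (_ : TameOn U L (fun z => 1 + ‖z.2‖) A) {G : Eu n → ℝ}
      (_ : ContDiffOn ℝ ∞ G U) (P : ℝ[X]),
      IntegrableOn (fun z => pb (fderiv ℝ A z)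
        (fderiv ℝ (expPoly L (fun x => r x * G x) P) z)) (U ×ˢ univ) ∧
      ∫ z in U ×ˢ univ, pb (fderiv ℝ A z)
        (fderiv ℝ (expPoly L (fun x => r x * G x) P) z) = 0 := by
    intro A hA G hG P
    refine hL.integral_pb_eq_zero hA (tameOn_expPoly hL (hr.mul hG) P) hKU hK fun z hz hzK => ?_
    simp [expPoly, hr0 z.1 hz hzK]
  -- The cutoff sits in the second slot only. For `d1` and `d2` it contributes its derivative along
  -- `u` or `v`, which is the boundary term; for `d3` and `d4` it contributes nothing, because
  -- functions on the base commute.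
  have d1 := fun a => hB (tameOn_inner hU hu) (hh a) (derivative (Y a))
  have d2 := fun a => hB (tameOn_inner hU hv) (hg a) (derivative (Y a))
  have d3 := fun a b => hB (tameOn_comp_fst hU (hh b)).weight_one_le (hg a) (Z (a, b))
  have d4 := fun a b => hB (tameOn_comp_fst hU (hg a)).weight_one_le (hh b) (Z (b, a))
  set X1 := fun (a : ι) (z : Eu n × Eu n) => pb (fderiv ℝ (fun z : Eu n × Eu n =>
    inner ℝ z.2 (u z.1)) z) (fderiv ℝ (expPoly L (fun x => r x * h a x) (derivative (Y a))) z)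
    with hX1
  set X2 := fun (a : ι) (z : Eu n × Eu n) => pb (fderiv ℝ (fun z : Eu n × Eu n =>
    inner ℝ z.2 (v z.1)) z) (fderiv ℝ (expPoly L (fun x => r x * g a x) (derivative (Y a))) z)
    with hX2
  set X3 := fun (a b : ι) (z : Eu n × Eu n) => pb (fderiv ℝ (fun z : Eu n × Eu n => h b z.1) z)
    (fderiv ℝ (expPoly L (fun x => r x * g a x) (Z (a, b))) z) with hX3
  set X4 := fun (a b : ι) (z : Eu n × Eu n) => pb (fderiv ℝ (fun z : Eu n × Eu n => g a z.1) z)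
    (fderiv ℝ (expPoly L (fun x => r x * h b x) (Z (b, a))) z) with hX4
  have hI1 : IntegrableOn (fun z => ∑ a, X1 a z) (U ×ˢ univ) :=
    integrable_finsetSum _ fun a _ => (d1 a).1
  have hI2 : IntegrableOn (fun z => ∑ a, X2 a z) (U ×ˢ univ) :=
    integrable_finsetSum _ fun a _ => (d2 a).1
  have hI3 : IntegrableOn (fun z => ∑ a, ∑ b, X3 a b z) (U ×ˢ univ) :=
    integrable_finsetSum _ fun a _ => integrable_finsetSum _ fun b _ => (d3 a b).1
  have hI4 : IntegrableOn (fun z => ∑ a, ∑ b, X4 a b z) (U ×ˢ univ) :=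
    integrable_finsetSum _ fun a _ => integrable_finsetSum _ fun b _ => (d4 a b).1
  have z1 : ∫ z in U ×ˢ univ, ∑ a, X1 a z = 0 := by
    rw [integral_finsetSum _ fun a _ => (d1 a).1]
    exact Finset.sum_eq_zero fun a _ => (d1 a).2
  have z2 : ∫ z in U ×ˢ univ, ∑ a, X2 a z = 0 := by
    rw [integral_finsetSum _ fun a _ => (d2 a).1]
    exact Finset.sum_eq_zero fun a _ => (d2 a).2
  have z3 : ∫ z in U ×ˢ univ, ∑ a, ∑ b, X3 a b z = 0 := by
    rw [integral_finsetSum _ fun a _ => integrable_finsetSum _ fun b _ => (d3 a b).1]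
    refine Finset.sum_eq_zero fun a _ => ?_
    rw [integral_finsetSum _ fun b _ => (d3 a b).1]
    exact Finset.sum_eq_zero fun b _ => (d3 a b).2
  have z4 : ∫ z in U ×ˢ univ, ∑ a, ∑ b, X4 a b z = 0 := by
    rw [integral_finsetSum _ fun a _ => integrable_finsetSum _ fun b _ => (d4 a b).1]
    refine Finset.sum_eq_zero fun a _ => ?_
    rw [integral_finsetSum _ fun b _ => (d4 a b).1]
    exact Finset.sum_eq_zero fun b _ => (d4 a b).2
  -- Pointwise, the kinetic integrand is a sum of exact brackets, minus the fluid integrand, plus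
  -- the boundary term.
  have hpt : ∀ z ∈ U ×ˢ (univ : Set (Eu n)), r z.1 * (Real.exp (L z) *
      pb (fderiv ℝ (liftCoord L Y u g) z) (fderiv ℝ (liftCoord L Y v h) z)) =
      (∑ a, X1 a z) - (∑ a, X2 a z) - (∑ a, ∑ b, X3 a b z) + (∑ a, ∑ b, X4 a b z)
      - r z.1 * (Real.exp (L z) *
        (inner ℝ z.2 (VectorField.lieBracket ℝ u v z.1) + ∑ a, (Y a).eval (L z) *
        (fderiv ℝ (h a) z.1 (u z.1) - fderiv ℝ (g a) z.1 (v z.1))))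
      + Real.exp (L z) * ∑ a, (derivative (Y a)).eval (L z) *
      (h a z.1 * fderiv ℝ r z.1 (u z.1) - g a z.1 * fderiv ℝ r z.1 (v z.1)) := by
    intro z hz
    have hd : ∀ {F : Type} [NormedAddCommGroup F] [NormedSpace ℝ F] {f : Eu n → F},
        ContDiffOn ℝ ∞ f U → DifferentiableAt ℝ f z.1 := fun hf =>
      (hf.contDiffAt (hU.mem_nhds hz.1)).differentiableAt (by simp)
    have hLd : DifferentiableAt ℝ L z :=
      (hL.smooth.contDiffAt (hO.mem_nhds hz)).differentiableAt (by simp)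
    have hrd := hd hr
    have hrg : ∀ a, DifferentiableAt ℝ (fun x => r x * g a x) z.1 := fun a => hrd.mul (hd (hg a))
    have hrh : ∀ a, DifferentiableAt ℝ (fun x => r x * h a x) z.1 := fun a => hrd.mul (hd (hh a))
    -- Differentiating `exp(L) Y_a'(L)` produces `Y_a' + Y_a''`, which is the coefficient of `dL` in
    -- the lifts.
    have hder : ∀ a, derivative (Y a) + derivative (derivative (Y a))
        = derivative (Y a + derivative (Y a)) := fun a => derivative_add.symm
    have fg : ∀ a, fderiv ℝ (fun x => r x * g a x) z.1
        = r z.1 • fderiv ℝ (g a) z.1 + g a z.1 • fderiv ℝ r z.1 := fun a =>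
      fderiv_fun_mul hrd (hd (hg a))
    have fh : ∀ a, fderiv ℝ (fun x => r x * h a x) z.1
        = r z.1 • fderiv ℝ (h a) z.1 + h a z.1 • fderiv ℝ r z.1 := fun a =>
      fderiv_fun_mul hrd (hd (hh a))
    have fmu := (hasFDerivAt_momentum (z := z) (hd hu)).fderiv
    have fmv := (hasFDerivAt_momentum (z := z) (hd hv)).fderiv
    have fbg := fun a => (hasFDerivAt_base (z := z) (hd (hg a))).fderiv
    have fbh := fun a => (hasFDerivAt_base (z := z) (hd (hh a))).fderiv
    have eg := fun a P α => pb_fderiv_expPoly hLd (hrg a) P α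
    have eh := fun a P α => pb_fderiv_expPoly hLd (hrh a) P α
    rw [pb_liftCoord hLd Y (hd hu) (hd hv) (fun a => hd (hg a)) (fun a => hd (hh a))]
    simp only [hX1, hX2, hX3, hX4, fmu, fmv, fbg, fbh]
    simp only [eg, eh, hZ, hder, pb_momentum_base, pb_baseCovector, fg, fh, _root_.add_apply,
      _root_.smul_apply, smul_eq_mul, mul_zero, add_zero, eval_mul]
    simp only [eval_add]
    exact bracket_sum_identity _ _ _ _ _ _ _ _ _ _ _ _ _ _ _ _
  have i0 : IntegrableOn (fun z => r z.1 * (Real.exp (L z) *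
      pb (fderiv ℝ (liftCoord L Y u g) z) (fderiv ℝ (liftCoord L Y v h) z))) (U ×ˢ univ) :=
    IntegrableOn.congr_fun (((((hI1.sub hI2).sub hI3).add hI4).sub i1).add i2)
      (fun z hz => (hpt z hz).symm) hm
  refine ⟨i0, i1, i2, ?_⟩
  have hI := (((hI1.sub hI2).sub hI3).add hI4)
  rw [setIntegral_congr_fun hm hpt]
  have q1 := integral_add (hI.sub i1) i2
  have q2 := integral_sub hI i1
  have q3 := integral_add ((hI1.sub hI2).sub hI3) hI4
  have q4 := integral_sub (hI1.sub hI2) hI3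
  have q5 := integral_sub hI1 hI2
  simp only [Pi.sub_apply, Pi.add_apply] at q1 q2 q3 q4 q5
  rw [q1, q2, q3, q4, q5, z1, z2, z3, z4]
  ring

end Polynomials

/-! ### Canonical coordinates on the cotangent bundle. -/

section Charts

variable {n : ℕ} {M : Type*} [TopologicalSpace M] [ChartedSpace (Eu n) M] [IsManifold (𝓡 n) ∞ M]
  {e : OpenPartialHomeomorph M (Eu n)}

theorem charts_contMDiffOn (he : e ∈ charts n M) : ContMDiffOn (𝓡 n) (𝓡 n) ∞ e e.source :=
  contMDiffOn_of_mem_maximalAtlas he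

theorem charts_contMDiffOn_symm (he : e ∈ charts n M) :
    ContMDiffOn (𝓡 n) (𝓡 n) ∞ e.symm e.target :=
  contMDiffOn_symm_of_mem_maximalAtlas he

theorem charts_mdifferentiable (he : e ∈ charts n M) : e.MDifferentiable (𝓡 n) (𝓡 n) :=
  ⟨(charts_contMDiffOn he).mdifferentiableOn (by simp),
    (charts_contMDiffOn_symm he).mdifferentiableOn (by simp)⟩

theorem chartAt_mem_charts (q : M) : chartAt (Eu n) q ∈ charts n M :=
  IsManifold.chart_mem_maximalAtlas q

/-- The differential of a chart, in the standard frame. -/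
noncomputable def dChart (e : OpenPartialHomeomorph M (Eu n)) (q : M) : Eu n →L[ℝ] Eu n :=
  mfderiv (𝓡 n) (𝓡 n) e q

/-- The differential of the inverse of a chart, in the standard frame. -/
noncomputable def dChartSymm (e : OpenPartialHomeomorph M (Eu n)) (x : Eu n) :
    Eu n →L[ℝ] Eu n :=
  mfderiv (𝓡 n) (𝓡 n) e.symm x

theorem dChartSymm_comp_dChart (he : e ∈ charts n M) {q : M} (hq : q ∈ e.source) :
    (dChartSymm e (e q)).comp (dChart e q) = ContinuousLinearMap.id ℝ (Eu n) :=
  (charts_mdifferentiable he).symm_comp_deriv hq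

theorem dChart_comp_dChartSymm (he : e ∈ charts n M) {x : Eu n} (hx : x ∈ e.target) :
    (dChart e (e.symm x)).comp (dChartSymm e x) = ContinuousLinearMap.id ℝ (Eu n) := by
  have h := (charts_mdifferentiable he).symm.symm_comp_deriv hx
  rw [OpenPartialHomeomorph.symm_symm] at h
  exact h

/-- The covector of a point of the cotangent bundle, in the standard frame. -/
noncomputable def covec (z : Cot n M) : Eu n →L[ℝ] ℝ := z.snd

/-- The inverse of the trivialization of the tangent bundle at `q₀`, in standard frames. -/
noncomputable def trivSymm (q₀ q : M) : Eu n →L[ℝ] Eu n :=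
  (trivializationAt (Eu n) (TangentSpace (𝓡 n)) q₀).symmL ℝ q

theorem contMDiffWithinAt_cot {N : Type*} {EN HN : Type*} [NormedAddCommGroup EN]
    [NormedSpace ℝ EN] [TopologicalSpace HN] {IN : ModelWithCorners ℝ EN HN} [TopologicalSpace N]
    [ChartedSpace HN N] {f : N → Cot n M} {s : Set N} {y : N} :
    ContMDiffWithinAt IN ((𝓡 n).prod 𝓘(ℝ, Eu n →L[ℝ] ℝ)) ∞ f s y ↔
      ContMDiffWithinAt IN (𝓡 n) ∞ (fun y => (f y).proj) s y ∧
      ContMDiffWithinAt IN 𝓘(ℝ, Eu n →L[ℝ] ℝ) ∞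
        (fun y' => (covec (f y')).comp (trivSymm (f y).proj (f y').proj)) s y := by
  rw [contMDiffWithinAt_hom_bundle]
  refine and_congr Iff.rfl (Eq.to_iff ?_)
  congr 1
  funext x
  simp only [ContinuousLinearMap.inCoordinates]
  ext v
  simp
  rfl

/-- The standard frame follows the preferred chart at each point and may jump, so `dChart e` alone
need not be continuous. Composed with the trivialization around a fixed point, it is the coordinate
expression of a smooth differential. -/
theorem contMDiffAt_dChart_comp_trivSymm (he : e ∈ charts n M) {q : M} (hq : q ∈ e.source) :
    ContMDiffAt (𝓡 n) 𝓘(ℝ, Eu n →L[ℝ] Eu n) ∞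
      (fun q' => (dChart e q').comp (trivSymm q q')) q := by
  have h := ((charts_contMDiffOn he).contMDiffAt (e.open_source.mem_nhds hq)).mfderiv_const
    (m := ∞) (by simp)
  refine h.congr_of_eventuallyEq (Filter.Eventually.of_forall fun x => ?_)
  simp only [inTangentCoordinates, ContinuousLinearMap.inCoordinates]
  rw [TangentBundle.continuousLinearMapAt_model_space]
  rfl

theorem contMDiffOn_canonSymm (he : e ∈ charts n M) :
    ContMDiffOn 𝓘(ℝ, Eu n × Eu n) ((𝓡 n).prod 𝓘(ℝ, Eu n →L[ℝ] ℝ)) ∞ (canonSymm e)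
      (e.target ×ˢ univ) := by
  intro y hy
  rw [contMDiffWithinAt_cot]
  have h1 : ContMDiffWithinAt 𝓘(ℝ, Eu n × Eu n) (𝓡 n) ∞ (fun y : Eu n × Eu n => e.symm y.1)
      (e.target ×ˢ univ) y :=
    ((charts_contMDiffOn_symm he) y.1 hy.1).comp y
      (contDiff_fst.contMDiff.contMDiffAt.contMDiffWithinAt) fun z hz => hz.1
  refine ⟨h1, ?_⟩
  have h2 := (contMDiffAt_dChart_comp_trivSymm he (e.map_target hy.1)).comp_contMDiffWithinAt y h1
  have h3 : ContMDiffWithinAt 𝓘(ℝ, Eu n × Eu n) 𝓘(ℝ, Eu n →L[ℝ] ℝ) ∞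
      (fun y : Eu n × Eu n => (innerSL ℝ y.2 : Eu n →L[ℝ] ℝ)) (e.target ×ˢ univ) y :=
    ((innerSL ℝ (E := Eu n)).contDiff.comp contDiff_snd).contMDiff.contMDiffAt.contMDiffWithinAt
  exact h3.clm_comp h2

theorem canonSymm_proj (e : OpenPartialHomeomorph M (Eu n)) (y : Eu n × Eu n) :
    (canonSymm e y).proj = e.symm y.1 := rfl

theorem covec_canonSymm (e : OpenPartialHomeomorph M (Eu n)) (y : Eu n × Eu n) :
    covec (canonSymm e y) = (innerSL ℝ y.2).comp (dChart e (e.symm y.1)) := rfl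

theorem canon_eq (e : OpenPartialHomeomorph M (Eu n)) (z : Cot n M) :
    canon e z = (e z.proj, WithLp.toLp 2 fun i =>
      covec z (dChartSymm e (e z.proj) (EuclideanSpace.single i (1 : ℝ)))) := rfl

theorem canon_canonSymm (he : e ∈ charts n M) {y : Eu n × Eu n} (hy : y.1 ∈ e.target) :
    canon e (canonSymm e y) = y := by
  rw [canon_eq, covec_canonSymm, canonSymm_proj, e.right_inv hy]
  refine Prod.ext rfl ?_
  ext i
  have h := DFunLike.congr_fun (dChart_comp_dChartSymm he hy) (EuclideanSpace.single i (1 : ℝ))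
  simp only [ContinuousLinearMap.comp_apply, ContinuousLinearMap.id_apply] at h ⊢
  rw [h]
  simp [EuclideanSpace.inner_single_right]

theorem cot_ext {z z' : Cot n M} (h : z.proj = z'.proj) (h' : covec z = covec z') : z = z' := by
  obtain ⟨q, α⟩ := z
  obtain ⟨q', α'⟩ := z'
  obtain rfl : q = q' := h
  exact congrArg _ h'

theorem canonSymm_canon (he : e ∈ charts n M) {z : Cot n M} (hz : z.proj ∈ e.source) :
    canonSymm e (canon e z) = z := by
  have h0 : (canonSymm e (canon e z)).proj = z.proj := e.left_inv hz
  refine cot_ext h0 ?_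
  rw [covec_canonSymm]
  have h1 : (canon e z).1 = e z.proj := rfl
  rw [h1, e.left_inv hz]
  ext v
  set w := dChart e z.proj v with hw
  have h2 : dChartSymm e (e z.proj) w = v :=
    DFunLike.congr_fun (dChartSymm_comp_dChart he hz) v
  rw [ContinuousLinearMap.comp_apply, ← hw, innerSL_apply_apply]
  have h3 := sum_inner_single_mul w ((covec z).comp (dChartSymm e (e z.proj)))
  simp only [ContinuousLinearMap.comp_apply, h2] at h3
  rw [← h3, canon_eq, PiLp.inner_apply]
  simp [mul_comm]

theorem continuousOn_canonSymm (he : e ∈ charts n M) :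
    ContinuousOn (canonSymm e) (e.target ×ˢ univ) := (contMDiffOn_canonSymm he).continuousOn

theorem continuous_cot_proj : Continuous (fun z : Cot n M => z.proj) :=
  FiberBundle.continuous_proj _ _

theorem contMDiff_cot_proj :
    ContMDiff ((𝓡 n).prod 𝓘(ℝ, Eu n →L[ℝ] ℝ)) (𝓡 n) ∞ (fun z : Cot n M => z.proj) :=
  contMDiff_proj _

/-- Pairing of covectors with a vector field. -/
theorem contMDiffOn_covec_apply {W : Set M} {u : ∀ q : M, TangentSpace (𝓡 n) q}
    (hu : ContMDiffOn (𝓡 n) (𝓡 n).tangent ∞ (fun q => (⟨q, u q⟩ : TangentBundle (𝓡 n) M)) W) :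
    ContMDiffOn ((𝓡 n).prod 𝓘(ℝ, Eu n →L[ℝ] ℝ)) 𝓘(ℝ, ℝ) ∞
      (fun z : Cot n M => covec z (u z.proj)) {z | z.proj ∈ W} := by
  intro z hz
  have h1 : ContMDiffWithinAt ((𝓡 n).prod 𝓘(ℝ, Eu n →L[ℝ] ℝ)) ((𝓡 n).prod 𝓘(ℝ, Eu n →L[ℝ] ℝ)) ∞
      (fun z : Cot n M => TotalSpace.mk' (Eu n →L[ℝ] ℝ)
        (E := fun q : M => TangentSpace (𝓡 n) q →L[ℝ] Bundle.Trivial M ℝ q) z.proj z.snd)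
      {z | z.proj ∈ W} z := contMDiffWithinAt_id
  have h2 : ContMDiffWithinAt ((𝓡 n).prod 𝓘(ℝ, Eu n →L[ℝ] ℝ)) (𝓡 n).tangent ∞
      (fun z : Cot n M => TotalSpace.mk' (Eu n) z.proj (u z.proj)) {z | z.proj ∈ W} z :=
    (hu z.proj hz).comp z contMDiff_cot_proj.contMDiffAt.contMDiffWithinAt fun y hy => hy
  have h3 := h1.clm_bundle_apply h2
  rw [contMDiffWithinAt_totalSpace] at h3
  exact h3.2

theorem tangent_ext {q q' : M} {v v' : Eu n} (h : q = q') (h' : v = v') :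
    (⟨q, v⟩ : TangentBundle (𝓡 n) M) = ⟨q', v'⟩ := by
  subst h h'
  rfl

/-- Coordinate fields are images of constant fields under the tangent map of the inverse chart. -/
theorem contMDiffOn_coordField (he : e ∈ charts n M) (w : Eu n) :
    ContMDiffOn (𝓡 n) (𝓡 n).tangent ∞
      (fun q => (⟨q, dChartSymm e (e q) w⟩ : TangentBundle (𝓡 n) M)) e.source := by
  have h1 : ContMDiffOn (𝓡 n).tangent (𝓡 n).tangent ∞
      (tangentMapWithin (𝓡 n) (𝓡 n) e.symm e.target)
      (TotalSpace.proj ⁻¹' e.target) :=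
    (charts_contMDiffOn_symm he).contMDiffOn_tangentMapWithin (by simp)
      e.open_target.uniqueMDiffOn
  have h2 : ContMDiffOn (𝓡 n) (𝓡 n).tangent ∞
      (fun q => (⟨e q, w⟩ : TangentBundle (𝓡 n) (Eu n))) e.source := by
    intro q hq
    rw [contMDiffWithinAt_totalSpace]
    refine ⟨charts_contMDiffOn he q hq, ?_⟩
    simpa using contMDiffWithinAt_const
  refine (h1.comp h2 fun q hq => e.map_source hq).congr fun q hq => ?_
  refine tangent_ext (e.left_inv hq).symm ?_
  change dChartSymm e (e q) w = (mfderivWithin (𝓡 n) (𝓡 n) e.symm e.target (e q) : _) w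
  rw [mfderivWithin_of_isOpen e.open_target (e.map_source hq)]
  rfl

/-- The momentum coordinates are pairings of the covector with the smooth coordinate fields. -/
theorem continuousOn_canon (he : e ∈ charts n M) :
    ContinuousOn (canon e) {z : Cot n M | z.proj ∈ e.source} := by
  have h : ∀ i, ContinuousOn (fun z : Cot n M => covec z (dChartSymm e (e z.proj)
      (EuclideanSpace.single i (1 : ℝ)))) {z : Cot n M | z.proj ∈ e.source} := fun i =>
    (contMDiffOn_covec_apply (u := fun q => dChartSymm e (e q) (EuclideanSpace.single i (1 : ℝ)))
      (contMDiffOn_coordField he _)).continuousOn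
  refine ContinuousOn.prodMk (e.continuousOn.comp continuous_cot_proj.continuousOn fun z hz => hz) ?_
  exact (PiLp.continuous_toLp 2 _).comp_continuousOn (continuousOn_pi.2 h)

theorem isOpen_over {W : Set M} (hW : IsOpen W) : IsOpen {z : Cot n M | z.proj ∈ W} :=
  hW.preimage continuous_cot_proj

theorem SmoothCot.contDiffOn {f : Cot n M → ℝ} (hf : SmoothCot f) (he : e ∈ charts n M) :
    ContDiffOn ℝ ∞ (fun y => f (canonSymm e y)) (e.target ×ˢ univ) :=
  contMDiffOn_iff_contDiffOn.1 (hf.comp_contMDiffOn (contMDiffOn_canonSymm he))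

theorem SmoothCotFamily.contDiffOn {f : ℝ → Cot n M → ℝ} (hf : SmoothCotFamily f)
    (he : e ∈ charts n M) :
    ContDiffOn ℝ ∞ (fun y : ℝ × (Eu n × Eu n) => f y.1 (canonSymm e y.2))
      (univ ×ˢ (e.target ×ˢ univ)) := by
  rw [← contMDiffOn_iff_contDiffOn]
  refine ContMDiff.comp_contMDiffOn hf (f := fun y : ℝ × (Eu n × Eu n) =>
    (y.1, canonSymm e y.2)) ?_
  refine ContMDiffOn.prodMk contDiff_fst.contMDiff.contMDiffOn ?_
  exact (contMDiffOn_canonSymm he).comp contDiff_snd.contMDiff.contMDiffOn fun y hy => hy.2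

end Charts

/-! ### Change of momentum coordinates in a fibre. -/

section FibreIntegration

variable {n : ℕ} {M : Type*} [TopologicalSpace M] [ChartedSpace (Eu n) M] [IsManifold (𝓡 n) ∞ M]
  {e : OpenPartialHomeomorph M (Eu n)}

/-- The covector at `q` with components `p` in the standard frame. -/
noncomputable def fibrePoint (q : M) (p : Eu n) : Cot n M := ⟨q, (innerSL ℝ p : Eu n →L[ℝ] ℝ)⟩

theorem det_dChart_mul (he : e ∈ charts n M) {x : Eu n} (hx : x ∈ e.target) :
    (dChart e (e.symm x)).det * (dChartSymm e x).det = 1 := by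
  have h := congrArg ContinuousLinearMap.det (dChart_comp_dChartSymm he hx)
  simpa [ContinuousLinearMap.det, LinearMap.det_comp] using h

theorem abs_det_dChartSymm_pos (he : e ∈ charts n M) {x : Eu n} (hx : x ∈ e.target) :
    0 < |(dChartSymm e x).det| :=
  abs_pos.2 (right_ne_zero_of_mul_eq_one (det_dChart_mul he hx))

/-- The change of momentum coordinates between the standard frame and the chart `e`. -/
theorem exists_fibre_equiv (he : e ∈ charts n M) {x : Eu n} (hx : x ∈ e.target) :
    ∃ T : Eu n ≃L[ℝ] Eu n, (∀ p, canonSymm e (x, p) = fibrePoint (e.symm x) (T p)) ∧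
      Measure.map T volume = ENNReal.ofReal |(dChartSymm e x).det| • volume := by
  -- Under the identification of covectors with vectors by the inner product, composition with the
  -- differential of the chart becomes its adjoint.
  set A := ContinuousLinearMap.adjoint (dChart e (e.symm x)) with hA
  -- In an orthonormal basis the adjoint has the transposed matrix, hence the same determinant.
  have hdet : A.det = (dChart e (e.symm x)).det := by
    have h1 : A.toLinearMap = LinearMap.adjoint (dChart e (e.symm x)).toLinearMap :=
      (LinearMap.eq_adjoint_iff _ _).2 fun v w =>
        ContinuousLinearMap.adjoint_inner_left (dChart e (e.symm x)) w v
    have h2 := LinearMap.toMatrix_adjoint (EuclideanSpace.basisFun (Fin n) ℝ)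
      (EuclideanSpace.basisFun (Fin n) ℝ) (dChart e (e.symm x)).toLinearMap
    rw [← h1] at h2
    have h3 := congrArg Matrix.det h2
    rw [Matrix.det_conjTranspose, LinearMap.det_toMatrix, LinearMap.det_toMatrix] at h3
    exact h3
  have hne : A.det ≠ 0 := by
    rw [hdet]; exact left_ne_zero_of_mul_eq_one (det_dChart_mul he hx)
  refine ⟨A.toContinuousLinearEquivOfDetNeZero hne, fun p => ?_, ?_⟩
  · refine cot_ext rfl ?_
    rw [covec_canonSymm]
    ext v
    have : covec (fibrePoint (e.symm x) (A.toContinuousLinearEquivOfDetNeZero hne p) : Cot n M)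
      = innerSL ℝ (A p) := rfl
    rw [this]
    simp [hA, ContinuousLinearMap.adjoint_inner_left]
  · have h := Measure.map_linearMap_addHaar_eq_smul_addHaar (volume : Measure (Eu n))
      (f := A.toLinearMap) hne
    have h1 : (LinearMap.det A.toLinearMap)⁻¹ = (dChartSymm e x).det := by
      have : LinearMap.det A.toLinearMap = A.det := rfl
      rw [this, hdet]
      exact inv_eq_of_mul_eq_one_right (det_dChart_mul he hx)
    rw [h1] at h
    exact h

/-- Momenta transform contragrediently, so the Jacobian is the one in `densCoord`. This is why
integrating a function over the fibres gives a density on the base. -/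
theorem fibre_integral {G : Type*} [NormedAddCommGroup G] [NormedSpace ℝ G] (he : e ∈ charts n M)
    {x : Eu n} (hx : x ∈ e.target) (h : Cot n M → G) :
    ∫ p, h (canonSymm e (x, p)) =
      |(dChartSymm e x).det| • ∫ p, h (fibrePoint (e.symm x) p) := by
  obtain ⟨T, hT, hm⟩ := exists_fibre_equiv he hx
  simp only [hT]
  have h1 := T.toHomeomorph.measurableEmbedding.integral_map (μ := volume)
    (fun p => h (fibrePoint (e.symm x) p))
  have : Measure.map T.toHomeomorph volume = Measure.map T volume := rfl
  rw [this, hm, integral_smul_measure, ENNReal.toReal_ofReal (abs_nonneg _)] at h1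
  exact h1.symm

theorem fibre_integrable {G : Type*} [NormedAddCommGroup G] (he : e ∈ charts n M)
    {x : Eu n} (hx : x ∈ e.target) (h : Cot n M → G) :
    Integrable (fun p => h (canonSymm e (x, p))) ↔
      Integrable (fun p => h (fibrePoint (e.symm x) p)) := by
  obtain ⟨T, hT, hm⟩ := exists_fibre_equiv he hx
  simp only [hT]
  have h1 := integrable_map_equiv (μ := volume) T.toHomeomorph.toMeasurableEquiv
    fun p => h (fibrePoint (e.symm x) p)
  have : Measure.map T.toHomeomorph.toMeasurableEquiv volume = Measure.map T volume := rfl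
  rw [this, hm, integrable_smul_measure (by simpa using
    (right_ne_zero_of_mul_eq_one (det_dChart_mul he hx))) ENNReal.ofReal_ne_top] at h1
  exact h1.symm

theorem fibre_volume (he : e ∈ charts n M) {x : Eu n} (hx : x ∈ e.target) (A : Set (Cot n M)) :
    volume {p : Eu n | canonSymm e (x, p) ∈ A} =
      ENNReal.ofReal |(dChartSymm e x).det| *
        volume {p : Eu n | fibrePoint (e.symm x) p ∈ A} := by
  obtain ⟨T, hT, hm⟩ := exists_fibre_equiv he hx
  simp only [hT]
  have h1 := T.toHomeomorph.measurableEmbedding.map_apply (μ := volume)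
    {p : Eu n | fibrePoint (e.symm x) p ∈ A}
  have : Measure.map T.toHomeomorph volume = Measure.map T volume := rfl
  rw [this, hm] at h1
  exact h1.symm

end FibreIntegration

/-! ### Chart independence of integrals on the base. -/

section BaseIntegration

variable {n : ℕ} {M : Type*} [TopologicalSpace M] [ChartedSpace (Eu n) M] [IsManifold (𝓡 n) ∞ M]
  {e e' : OpenPartialHomeomorph M (Eu n)}

open scoped ENNReal

/-- The integral over the domain of the chart `e` of the density whose value on standard frames
is `d`. -/
noncomputable def chartLIntegral (e : OpenPartialHomeomorph M (Eu n)) (d : M → ℝ≥0∞) : ℝ≥0∞ :=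
  ∫⁻ x in e.target, ENNReal.ofReal |(dChartSymm e x).det| * d (e.symm x)

theorem hasFDerivAt_transition (he : e ∈ charts n M) (he' : e' ∈ charts n M) {x : Eu n}
    (hx : x ∈ e.target) (hx' : e.symm x ∈ e'.source) :
    HasFDerivAt (fun x => e' (e.symm x)) ((dChart e' (e.symm x)).comp (dChartSymm e x)) x := by
  have h1 := ((charts_mdifferentiable he).symm.mdifferentiableAt hx).hasMFDerivAt
  have h2 := ((charts_mdifferentiable he').mdifferentiableAt hx').hasMFDerivAt
  exact (h2.comp x h1).hasFDerivAt

theorem contDiffOn_transition (he : e ∈ charts n M) (he' : e' ∈ charts n M) :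
    ContDiffOn ℝ ∞ (fun x => e' (e.symm x)) (e.target ∩ e.symm ⁻¹' e'.source) := by
  rw [← contMDiffOn_iff_contDiffOn]
  exact (charts_contMDiffOn he').comp ((charts_contMDiffOn_symm he).mono inter_subset_left)
    fun x hx => hx.2

theorem dChartSymm_transition (he : e ∈ charts n M) (he' : e' ∈ charts n M) {x : Eu n}
    (hx : x ∈ e.target) (hx' : e.symm x ∈ e'.source) :
    (dChartSymm e' (e' (e.symm x))).comp ((dChart e' (e.symm x)).comp (dChartSymm e x))
      = dChartSymm e x := by
  rw [← ContinuousLinearMap.comp_assoc, dChartSymm_comp_dChart he' hx',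
    ContinuousLinearMap.id_comp]

theorem isOpen_overlap (e e' : OpenPartialHomeomorph M (Eu n)) :
    IsOpen (e.target ∩ e.symm ⁻¹' e'.source) :=
  e.isOpen_inter_preimage_symm e'.open_source

/-- Change of variables along the transition map: by the chain rule the Jacobians of the two charts
differ exactly by its determinant. -/
theorem chartLIntegral_eq (he : e ∈ charts n M) (he' : e' ∈ charts n M) {d : M → ℝ≥0∞}
    (hd : ∀ q, q ∉ e.source ∩ e'.source → d q = 0) : chartLIntegral e d = chartLIntegral e' d := by
  -- As `d` vanishes off both domains, each integral may be restricted to the overlap.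
  have hres : ∀ {a b : OpenPartialHomeomorph M (Eu n)},
      (∀ q, q ∉ a.source ∩ b.source → d q = 0) → chartLIntegral a d =
      ∫⁻ x in a.target ∩ a.symm ⁻¹' b.source,
        ENNReal.ofReal |(dChartSymm a x).det| * d (a.symm x) := by
    intro a b hab
    have hm := (isOpen_overlap a b).measurableSet
    unfold chartLIntegral
    rw [← lintegral_indicator a.open_target.measurableSet, ← lintegral_indicator hm]
    congr 1
    funext x
    by_cases hx : x ∈ a.target
    · by_cases hx' : a.symm x ∈ b.source
      · rw [indicator_of_mem hx, indicator_of_mem (show x ∈ a.target ∩ _ from ⟨hx, hx'⟩)]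
      · rw [indicator_of_mem hx, indicator_of_notMem fun h => hx' h.2,
          hab _ fun h => hx' h.2, mul_zero]
    · rw [indicator_of_notMem hx, indicator_of_notMem fun h => hx h.1]
  rw [hres hd, hres (a := e') (b := e) fun q hq => hd q fun h => hq ⟨h.2, h.1⟩]
  have hm := (isOpen_overlap e e').measurableSet
  have himg : (fun x => e' (e.symm x)) '' (e.target ∩ e.symm ⁻¹' e'.source)
      = e'.target ∩ e'.symm ⁻¹' e.source := by
    ext y
    constructor
    · rintro ⟨x, hx, rfl⟩
      refine ⟨e'.map_source hx.2, ?_⟩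
      simp only [mem_preimage, e'.left_inv hx.2]
      exact e.map_target hx.1
    · rintro ⟨hy, hy'⟩
      refine ⟨e (e'.symm y), ⟨e.map_source hy', ?_⟩, ?_⟩
      · simp only [mem_preimage, e.left_inv hy']
        exact e'.map_target hy
      · simp only [e.left_inv hy', e'.right_inv hy]
  have hinj : InjOn (fun x => e' (e.symm x)) (e.target ∩ e.symm ⁻¹' e'.source) := by
    intro x hx y hy hxy
    have h1 := e'.injOn hx.2 hy.2 hxy
    exact e.symm.injOn hx.1 hy.1 h1
  rw [← himg, lintegral_image_eq_lintegral_abs_det_fderiv_mul volume hm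
    (fun x hx => (hasFDerivAt_transition he he' hx.1 hx.2).hasFDerivWithinAt) hinj]
  refine setLIntegral_congr_fun hm fun x hx => ?_
  have h1 := congrArg ContinuousLinearMap.det (dChartSymm_transition he he' hx.1 hx.2)
  have h2 : (dChartSymm e' (e' (e.symm x))).det *
      ((dChart e' (e.symm x)).comp (dChartSymm e x)).det = (dChartSymm e x).det := by
    rw [← h1]
    simp [ContinuousLinearMap.det, LinearMap.det_comp]
  simp only [e'.left_inv hx.2]
  rw [← mul_assoc, ← ENNReal.ofReal_mul (abs_nonneg _), ← abs_mul, mul_comm _ (dChartSymm e' _).det,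
    h2]

end BaseIntegration

/-! ### Gluing local measures. -/

section Gluing

variable {α ι : Type*} [MeasurableSpace α] {μ : ι → Measure α} {S : ι → Set α}

/-- Measures that agree on overlaps glue to their supremum. -/
theorem iSup_restrict_eq (hS : ∀ i, MeasurableSet (S i)) (h0 : ∀ i, μ i (S i)ᶜ = 0)
    (h : ∀ i j A, MeasurableSet A → A ⊆ S i ∩ S j → μ i A = μ j A) (i : ι) :
    (⨆ j, μ j).restrict (S i) = μ i := by
  have hres : ∀ j, (μ j).restrict (S i) ≤ μ i := by
    intro j
    refine Measure.le_iff.2 fun A hA => ?_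
    rw [Measure.restrict_apply hA]
    calc μ j (A ∩ S i) ≤ μ j (A ∩ S i ∩ S j) + μ j (S j)ᶜ := by
          refine (measure_mono fun x hx => ?_).trans (measure_union_le _ _)
          by_cases hxj : x ∈ S j
          · exact Or.inl ⟨hx, hxj⟩
          · exact Or.inr hxj
      _ = μ i (A ∩ S i ∩ S j) := by
          rw [h0, add_zero]
          exact (h i j _ ((hA.inter (hS i)).inter (hS j)) fun x hx => ⟨hx.1.2, hx.2⟩).symm
      _ ≤ μ i A := measure_mono fun x hx => hx.1.1
  refine le_antisymm ?_ ?_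
  -- An upper bound of a supremum of measures is found by exhibiting one dominating measure: `μ i`,
  -- completed off `S i` by the supremum itself.
  · have hub : (⨆ j, μ j) ≤ μ i + (⨆ j, μ j).restrict (S i)ᶜ := by
      refine iSup_le fun j => ?_
      rw [← Measure.restrict_add_restrict_compl (μ := μ j) (hS i)]
      exact add_le_add (hres j) (Measure.restrict_mono le_rfl (le_iSup μ j))
    refine (Measure.restrict_mono le_rfl hub).trans ?_
    rw [Measure.restrict_add, Measure.restrict_restrict (hS i), inter_compl_self,
      Measure.restrict_empty, add_zero]
    exact Measure.restrict_le_self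
  · have : μ i = (μ i).restrict (S i) := by
      rw [← Measure.restrict_add_restrict_compl (μ := μ i) (hS i),
        Measure.restrict_eq_zero.2 (h0 i), add_zero, Measure.restrict_restrict (hS i), inter_self]
    rw [this]
    exact Measure.restrict_mono le_rfl (le_iSup μ i)

end Gluing

/-! ### Integrals against image measures. -/

section MapInverse

variable {X α G : Type*} [MeasurableSpace X] [MeasurableSpace α] [NormedAddCommGroup G]
  [NormedSpace ℝ G]

/-- No measurability of `k` is assumed: almost everywhere `k` is `k ∘ φ` composed with the inverse
`ψ`, and so inherits measurability from `k ∘ φ`. -/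
theorem integrable_map_of_inverse {μ : Measure X} {φ : X → α} {ψ : α → X} (hφ : AEMeasurable φ μ)
    {S : Set α} (hS : MeasurableSet S) (hSμ : Measure.map φ μ Sᶜ = 0)
    (hψ : AEMeasurable ψ (Measure.map φ μ)) (h1 : ∀ a ∈ S, φ (ψ a) = a)
    (h2 : ∀ᵐ x ∂μ, ψ (φ x) = x) {k : α → G} (hk : Integrable (fun x => k (φ x)) μ) :
    Integrable k (Measure.map φ μ) ∧ ∫ a, k a ∂(Measure.map φ μ) = ∫ x, k (φ x) ∂μ := by
  have hmm : Measure.map ψ (Measure.map φ μ) = μ := by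
    rw [AEMeasurable.map_map_of_aemeasurable hψ hφ]
    have : ψ ∘ φ =ᵐ[μ] id := h2
    rw [Measure.map_congr this, Measure.map_id]
  have hae : (fun a => k (φ (ψ a))) =ᵐ[Measure.map φ μ] k := by
    have : S ∈ ae (Measure.map φ μ) := hSμ
    filter_upwards [this] with a ha
    rw [h1 a ha]
  have hk' : AEStronglyMeasurable (fun x => k (φ x)) (Measure.map ψ (Measure.map φ μ)) := by
    rw [hmm]; exact hk.aestronglyMeasurable
  have hkm : AEStronglyMeasurable k (Measure.map φ μ) :=
    (hk'.comp_aemeasurable hψ).congr hae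
  exact ⟨(integrable_map_measure hkm hφ).2 hk, integral_map hφ hkm⟩

end MapInverse

/-! ### The Liouville measure, integrals of densities, and Fubini over a chart. -/

section LocalMeasures

open scoped ENNReal

variable {n : ℕ} {M : Type*} [TopologicalSpace M] [ChartedSpace (Eu n) M] [IsManifold (𝓡 n) ∞ M]
  {e e' : OpenPartialHomeomorph M (Eu n)}

/-- The Liouville measure over the domain of a chart. -/
noncomputable def liouvilleChart (e : OpenPartialHomeomorph M (Eu n)) : Measure (Cot n M) :=
  ((volume : Measure (Eu n × Eu n)).restrict (e.target ×ˢ univ)).map (canonSymm e)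

theorem measurableSet_chart_prod (e : OpenPartialHomeomorph M (Eu n)) :
    MeasurableSet (e.target ×ˢ (univ : Set (Eu n))) :=
  (e.open_target.prod isOpen_univ).measurableSet

theorem aemeasurable_canonSymm (he : e ∈ charts n M) :
    AEMeasurable (canonSymm e) ((volume : Measure (Eu n × Eu n)).restrict (e.target ×ˢ univ)) :=
  (continuousOn_canonSymm he).aemeasurable (measurableSet_chart_prod e)

theorem measurableSet_over (e : OpenPartialHomeomorph M (Eu n)) :
    MeasurableSet {z : Cot n M | z.proj ∈ e.source} :=
  (isOpen_over e.open_source).measurableSet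

/-- Tonelli's theorem, followed by the passage to the standard frame in each fibre. The right side
integrates a density on the base, so agreement of the Liouville measures on overlaps reduces to
`chartLIntegral_eq`. -/
theorem liouvilleChart_apply (he : e ∈ charts n M) {A : Set (Cot n M)} (hA : MeasurableSet A) :
    liouvilleChart e A = chartLIntegral e fun q => volume {p : Eu n | fibrePoint q p ∈ A} := by
  -- Regularity of `canonSymm e` is only available over the chart, hence the detour through the
  -- subtype.
  have hB : MeasurableSet (canonSymm e ⁻¹' A ∩ e.target ×ˢ univ) := by
    have h1 : Measurable ((e.target ×ˢ univ).domRestrict (canonSymm e)) :=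
      (continuousOn_iff_continuous_domRestrict.1 (continuousOn_canonSymm he)).measurable
    have h2 := (measurableSet_chart_prod e).subtype_image (h1 hA)
    convert h2 using 1
    ext y
    simp only [mem_inter_iff, mem_preimage, mem_image, Subtype.exists, exists_and_right, exists_eq_right]
    tauto
  rw [liouvilleChart, Measure.map_apply_of_aemeasurable (aemeasurable_canonSymm he) hA,
    Measure.restrict_apply' (measurableSet_chart_prod e), Measure.volume_eq_prod,
    Measure.prod_apply hB, chartLIntegral, ← lintegral_indicator e.open_target.measurableSet]
  congr 1
  funext x
  by_cases hx : x ∈ e.target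
  · rw [indicator_of_mem hx, ← fibre_volume he hx]
    congr 1
    ext p
    simp [hx]
  · rw [indicator_of_notMem hx]
    convert measure_empty (μ := (volume : Measure (Eu n)))
    ext p
    simp [hx]

theorem liouvilleChart_compl (he : e ∈ charts n M) :
    liouvilleChart e {z : Cot n M | z.proj ∈ e.source}ᶜ = 0 := by
  rw [liouvilleChart_apply he (measurableSet_over e).compl, chartLIntegral,
    setLIntegral_congr_fun (g := fun _ => 0) e.open_target.measurableSet]
  · simp
  · intro x hx
    have : {p : Eu n | (fibrePoint (e.symm x) p : Cot n M) ∈ {z : Cot n M | z.proj ∈ e.source}ᶜ}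
        = ∅ := by
      ext p
      simp only [mem_compl_iff, mem_ofPred_eq, mem_empty_iff_false, iff_false, not_not]
      exact e.map_target hx
    change _ * volume _ = 0
    rw [this, measure_empty, mul_zero]

theorem liouville_restrict (he : e ∈ charts n M) :
    (liouville n M).restrict {z : Cot n M | z.proj ∈ e.source} = liouvilleChart e := by
  refine iSup_restrict_eq (ι := charts n M) (μ := fun e => liouvilleChart e.1)
    (S := fun e => {z : Cot n M | z.proj ∈ e.1.source}) (fun e => measurableSet_over e.1)
    (fun e => liouvilleChart_compl e.2) (fun i j A hA hAs => ?_) ⟨e, he⟩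
  rw [liouvilleChart_apply i.2 hA, liouvilleChart_apply j.2 hA]
  refine chartLIntegral_eq i.2 j.2 fun q hq => ?_
  convert measure_empty (μ := (volume : Measure (Eu n)))
  ext p
  simp only [mem_ofPred_eq, mem_empty_iff_false, iff_false]
  exact fun h => hq (hAs h)

/-- Integrals over the cotangent bundle of functions supported over a chart. -/
theorem integrable_liouville_of_chart (he : e ∈ charts n M) {H : Cot n M → ℝ}
    (h0 : ∀ z, z.proj ∉ e.source → H z = 0)
    (hH : IntegrableOn (fun y => H (canonSymm e y)) (e.target ×ˢ univ)) :
    Integrable H (liouville n M) ∧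
      ∫ z, H z ∂(liouville n M) = ∫ y in e.target ×ˢ univ, H (canonSymm e y) := by
  have hm := measurableSet_over e
  have key := integrable_map_of_inverse (aemeasurable_canonSymm he) hm (liouvilleChart_compl he)
    (ψ := canon e) ?_ (fun z hz => canonSymm_canon he hz) ?_ hH
  · have hr : Measure.map (canonSymm e) ((volume : Measure (Eu n × Eu n)).restrict
      (e.target ×ˢ univ)) = (liouville n M).restrict {z : Cot n M | z.proj ∈ e.source} :=
      (liouville_restrict he).symm
    rw [hr] at key
    refine ⟨(integrableOn_iff_integrable_of_support_subset fun z hz => ?_).1 key.1, ?_⟩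
    · by_contra hne
      exact hz (h0 z hne)
    · rw [← key.2, setIntegral_eq_integral_of_forall_compl_eq_zero (s := {z : Cot n M | z.proj ∈ e.source})
        fun z hz => h0 z hz]
  · have hr : Measure.map (canonSymm e) ((volume : Measure (Eu n × Eu n)).restrict
      (e.target ×ˢ univ)) = (liouville n M).restrict {z : Cot n M | z.proj ∈ e.source} :=
      (liouville_restrict he).symm
    rw [hr]
    exact (continuousOn_canon he).aemeasurable hm
  · rw [ae_restrict_iff' (measurableSet_chart_prod e)]
    exact Filter.Eventually.of_forall fun y hy => canon_canonSymm he hy.1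

theorem densCoord_eq (e : OpenPartialHomeomorph M (Eu n)) (d : M → ℝ) (x : Eu n) :
    densCoord e d x = d (e.symm x) * |(dChartSymm e x).det| := rfl

/-- A positive smooth density, used as a reference. -/
structure ReferenceDensity (ρ : M → ℝ) : Prop where
  pos : ∀ q, 0 < ρ q
  smooth : SmoothDensity (n := n) ρ

theorem densCoord_pos {ρ : M → ℝ} (hρ : ∀ q, 0 < ρ q) (he : e ∈ charts n M) {x : Eu n}
    (hx : x ∈ e.target) : 0 < densCoord e ρ x := by
  rw [densCoord_eq]
  exact mul_pos (hρ _) (abs_det_dChartSymm_pos he hx)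

section Base

variable [MeasurableSpace M] [BorelSpace M]

/-- The measure of the positive part of a density, in a chart. -/
noncomputable def densChart (e : OpenPartialHomeomorph M (Eu n)) (d : M → ℝ) : Measure M :=
  (((volume : Measure (Eu n)).restrict e.target).withDensity
    (fun x => ENNReal.ofReal (densCoord e d x))).map e.symm

theorem ofReal_densCoord (e : OpenPartialHomeomorph M (Eu n)) (d : M → ℝ) (x : Eu n) :
    ENNReal.ofReal (densCoord e d x) =
      ENNReal.ofReal |(dChartSymm e x).det| * ENNReal.ofReal (d (e.symm x)) := by
  rw [densCoord_eq, mul_comm, ENNReal.ofReal_mul (abs_nonneg _)]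

theorem aemeasurable_symm (e : OpenPartialHomeomorph M (Eu n)) (w : Eu n → ℝ≥0∞) :
    AEMeasurable e.symm (((volume : Measure (Eu n)).restrict e.target).withDensity w) :=
  (e.continuousOn_symm.aemeasurable e.open_target.measurableSet).mono_ac
    (withDensity_absolutelyContinuous _ _)

theorem densChart_apply (e : OpenPartialHomeomorph M (Eu n)) (d : M → ℝ) {A : Set M}
    (hA : MeasurableSet A) :
    densChart e d A = chartLIntegral e (A.indicator fun q => ENNReal.ofReal (d q)) := by
  have hB : MeasurableSet (e.symm ⁻¹' A ∩ e.target) := by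
    have h1 : Measurable (e.target.domRestrict e.symm) :=
      (continuousOn_iff_continuous_domRestrict.1 e.continuousOn_symm).measurable
    have h2 := e.open_target.measurableSet.subtype_image (h1 hA)
    convert h2 using 1
    ext y
    simp only [mem_inter_iff, mem_preimage, mem_image, Subtype.exists, exists_and_right, exists_eq_right]
    tauto
  have h0 : (((volume : Measure (Eu n)).restrict e.target).withDensity
      (fun x => ENNReal.ofReal (densCoord e d x))) e.targetᶜ = 0 :=
    withDensity_absolutelyContinuous _ _ (by
      rw [Measure.restrict_apply e.open_target.measurableSet.compl, compl_inter_self,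
        measure_empty])
  have h1 : (((volume : Measure (Eu n)).restrict e.target).withDensity
      (fun x => ENNReal.ofReal (densCoord e d x))) (e.symm ⁻¹' A) =
      (((volume : Measure (Eu n)).restrict e.target).withDensity
      (fun x => ENNReal.ofReal (densCoord e d x))) (e.symm ⁻¹' A ∩ e.target) := by
    refine le_antisymm ?_ (measure_mono inter_subset_left)
    refine (measure_mono (t := (e.symm ⁻¹' A ∩ e.target) ∪ e.targetᶜ) fun x hx => ?_).trans
      ((measure_union_le _ _).trans (by rw [h0, add_zero]))
    by_cases hxe : x ∈ e.target
    · exact Or.inl ⟨hx, hxe⟩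
    · exact Or.inr hxe
  rw [densChart, Measure.map_apply_of_aemeasurable (aemeasurable_symm e _) hA, h1,
    withDensity_apply _ hB, Measure.restrict_restrict hB, inter_assoc, inter_self, chartLIntegral,
    ← lintegral_indicator hB, ← lintegral_indicator e.open_target.measurableSet]
  congr 1
  funext x
  by_cases hx : x ∈ e.target
  · by_cases hxA : e.symm x ∈ A
    · rw [indicator_of_mem hx, indicator_of_mem hxA,
        indicator_of_mem (show x ∈ e.symm ⁻¹' A ∩ e.target from ⟨hxA, hx⟩), ofReal_densCoord]
    · rw [indicator_of_mem hx, indicator_of_notMem hxA, indicator_of_notMem fun h => hxA h.1,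
        mul_zero]
  · rw [indicator_of_notMem hx, indicator_of_notMem fun h => hx h.2]

theorem densChart_compl (e : OpenPartialHomeomorph M (Eu n)) (d : M → ℝ) :
    densChart e d e.sourceᶜ = 0 := by
  rw [densChart_apply e d e.open_source.measurableSet.compl, chartLIntegral,
    setLIntegral_congr_fun (g := fun _ => 0) e.open_target.measurableSet]
  · simp
  · intro x hx
    have : e.symm x ∉ e.sourceᶜ := fun h => h (e.map_target hx)
    simp [indicator_of_notMem this]

theorem densMeasure_restrict (he : e ∈ charts n M) (d : M → ℝ) :
    (densMeasure n d).restrict e.source = densChart e d := by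
  refine iSup_restrict_eq (ι := charts n M) (μ := fun e => densChart e.1 d)
    (S := fun e => e.1.source) (fun e => e.1.open_source.measurableSet)
    (fun e => densChart_compl e.1 d) (fun i j A hA hAs => ?_) ⟨e, he⟩
  rw [densChart_apply _ _ hA, densChart_apply _ _ hA]
  refine chartLIntegral_eq i.2 j.2 fun q hq => ?_
  exact indicator_of_notMem (fun h => hq (hAs h)) _

variable {ρ : M → ℝ}

theorem ReferenceDensity.aemeasurable (hρ : ReferenceDensity (n := n) ρ) (he : e ∈ charts n M) :
    AEMeasurable (fun x => ENNReal.ofReal (densCoord e ρ x))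
      ((volume : Measure (Eu n)).restrict e.target) :=
  ((hρ.smooth e he).continuousOn.aemeasurable e.open_target.measurableSet).ennreal_ofReal

theorem lintegral_densChart (hρ : ReferenceDensity (n := n) ρ) (he : e ∈ charts n M)
    {g : M → ℝ≥0∞} (hg : Measurable g) :
    ∫⁻ q, g q ∂(densChart e ρ) = chartLIntegral e fun q => ENNReal.ofReal (ρ q) * g q := by
  rw [densChart, lintegral_map' hg.aemeasurable (aemeasurable_symm e _)]
  change ∫⁻ a, (g ∘ e.symm) a ∂_ = _
  rw [lintegral_withDensity_eq_lintegral_mul₀ (hρ.aemeasurable he)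
      (hg.comp_aemeasurable (e.continuousOn_symm.aemeasurable e.open_target.measurableSet)),
    chartLIntegral]
  refine setLIntegral_congr_fun e.open_target.measurableSet fun x hx => ?_
  simp only [Pi.mul_apply, ofReal_densCoord, mul_assoc, Function.comp_apply]

/-- Dividing by a reference density turns densities into functions independent of the frame, and
integrals of densities into ordinary integrals against one measure. -/
theorem densChart_eq_withDensity (hρ : ReferenceDensity (n := n) ρ) (he : e ∈ charts n M)
    {d : M → ℝ} (hd : Measurable fun q => d q / ρ q) :
    densChart e d = (densChart e ρ).withDensity fun q => ENNReal.ofReal (d q / ρ q) := by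
  ext A hA
  rw [withDensity_apply _ hA, ← lintegral_indicator hA, densChart_apply e d hA,
    lintegral_densChart hρ he (hd.ennreal_ofReal.indicator hA)]
  congr 1
  funext q
  by_cases hq : q ∈ A
  · rw [indicator_of_mem hq, indicator_of_mem hq, ← ENNReal.ofReal_mul (hρ.pos q).le,
      mul_div_cancel₀ _ (hρ.pos q).ne']
  · rw [indicator_of_notMem hq, indicator_of_notMem hq, mul_zero]

variable [SecondCountableTopology M]

theorem densMeasure_eq_withDensity (hρ : ReferenceDensity (n := n) ρ) {d : M → ℝ}
    (hd : Measurable fun q => d q / ρ q) :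
    densMeasure n d = (densMeasure n ρ).withDensity fun q => ENNReal.ofReal (d q / ρ q) := by
  obtain ⟨s, hs, hsU⟩ := TopologicalSpace.countable_cover_nhds
    (f := fun q : M => (chartAt (Eu n) q).source)
    fun q => (chartAt (Eu n) q).open_source.mem_nhds (mem_chart_source (Eu n) q)
  refine Measure.ext_of_biUnion_eq_univ hs hsU fun q _ => ?_
  have he := chartAt_mem_charts (n := n) q
  rw [restrict_withDensity (chartAt (Eu n) q).open_source.measurableSet,
    densMeasure_restrict he, densMeasure_restrict he, densChart_eq_withDensity hρ he hd]

theorem lintegral_enorm_eq (μ : Measure M) {k : M → ℝ} (hk : Measurable k) :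
    ∫⁻ q, ‖k q‖ₑ ∂μ = ∫⁻ q, ENNReal.ofReal (k q) ∂μ + ∫⁻ q, ENNReal.ofReal (-k q) ∂μ := by
  rw [← lintegral_add_left hk.ennreal_ofReal]
  congr 1
  funext q
  rcases le_total 0 (k q) with h | h
  · rw [ENNReal.ofReal_of_nonpos (neg_nonpos.2 h), add_zero, Real.enorm_eq_ofReal h]
  · rw [ENNReal.ofReal_of_nonpos h, zero_add, Real.enorm_eq_ofReal_abs, abs_of_nonpos h]

/-- The masses of the positive and of the negative part add up to the `L¹` norm of the quotient by
`ρ`. -/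
theorem densIntegrable_iff (hρ : ReferenceDensity (n := n) ρ) {d : M → ℝ}
    (hd : Measurable fun q => d q / ρ q) :
    DensIntegrable n d ↔ Integrable (fun q => d q / ρ q) (densMeasure n ρ) := by
  have hd' : Measurable fun q => -d q / ρ q := by
    simp only [neg_div]
    exact hd.neg
  rw [DensIntegrable, densMeasure_eq_withDensity hρ hd, densMeasure_eq_withDensity hρ hd',
    withDensity_apply _ MeasurableSet.univ, withDensity_apply _ MeasurableSet.univ,
    Measure.restrict_univ, ← ENNReal.add_lt_top]
  simp only [neg_div]
  rw [← lintegral_enorm_eq _ hd]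
  exact ⟨fun h => ⟨hd.aestronglyMeasurable, h⟩, fun h => h.2⟩

theorem densIntegral_eq (hρ : ReferenceDensity (n := n) ρ) {d : M → ℝ}
    (hd : Measurable fun q => d q / ρ q)
    (hi : Integrable (fun q => d q / ρ q) (densMeasure n ρ)) :
    densIntegral n d = ∫ q, d q / ρ q ∂(densMeasure n ρ) := by
  have hd' : Measurable fun q => -d q / ρ q := by
    simp only [neg_div]
    exact hd.neg
  rw [densIntegral, densMeasure_eq_withDensity hρ hd, densMeasure_eq_withDensity hρ hd',
    withDensity_apply _ MeasurableSet.univ, withDensity_apply _ MeasurableSet.univ,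
    Measure.restrict_univ, integral_eq_lintegral_pos_part_sub_lintegral_neg_part hi]
  simp only [neg_div]

theorem integrable_densMeasure_of_chart (hρ : ReferenceDensity (n := n) ρ) (he : e ∈ charts n M)
    {d : M → ℝ} (h0 : ∀ q, q ∉ e.source → d q = 0) (hd : IntegrableOn (densCoord e d) e.target) :
    Integrable (fun q => d q / ρ q) (densMeasure n ρ) ∧
      ∫ q, d q / ρ q ∂(densMeasure n ρ) = ∫ x in e.target, densCoord e d x := by
  have hm := e.open_source.measurableSet
  have hmt := e.open_target.measurableSet
  have hmul : ∀ x ∈ e.target, (ENNReal.ofReal (densCoord e ρ x)).toReal •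
      (d (e.symm x) / ρ (e.symm x)) = densCoord e d x := fun x hx => by
    rw [ENNReal.toReal_ofReal (densCoord_pos hρ.pos he hx).le, densCoord_eq, densCoord_eq,
      smul_eq_mul]
    have := (hρ.pos (e.symm x)).ne'
    field_simp
  have hi : Integrable (fun x => d (e.symm x) / ρ (e.symm x))
      (((volume : Measure (Eu n)).restrict e.target).withDensity
        (fun x => ENNReal.ofReal (densCoord e ρ x))) := by
    rw [integrable_withDensity_iff_integrable_smul₀' (hρ.aemeasurable he)
      (Filter.Eventually.of_forall fun x => ENNReal.ofReal_lt_top)]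
    exact IntegrableOn.congr_fun hd (fun x hx => (hmul x hx).symm) hmt
  have hr : Measure.map e.symm (((volume : Measure (Eu n)).restrict e.target).withDensity
      (fun x => ENNReal.ofReal (densCoord e ρ x))) = (densMeasure n ρ).restrict e.source :=
    (densMeasure_restrict he ρ).symm
  have key := integrable_map_of_inverse (aemeasurable_symm e _) hm (densChart_compl e ρ)
    (ψ := e) ?_ (fun q hq => e.left_inv hq) ?_ (k := fun q => d q / ρ q) hi
  · rw [hr] at key
    have hz : ∀ q, q ∉ e.source → d q / ρ q = 0 := fun q hq => by rw [h0 q hq, zero_div]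
    refine ⟨(integrableOn_iff_integrable_of_support_subset fun q hq => ?_).1 key.1, ?_⟩
    · by_contra hne
      exact hq (hz q hne)
    · rw [← setIntegral_eq_integral_of_forall_compl_eq_zero fun q hq => hz q hq, key.2,
        integral_withDensity_eq_integral_toReal_smul₀ (hρ.aemeasurable he)
          (Filter.Eventually.of_forall fun x => ENNReal.ofReal_lt_top)]
      exact setIntegral_congr_fun hmt hmul
  · rw [hr]
    exact e.continuousOn.aemeasurable hm
  · have h1 : ∀ᵐ x ∂((volume : Measure (Eu n)).restrict e.target), e (e.symm x) = x :=
      (ae_restrict_iff' hmt).2 (Filter.Eventually.of_forall fun x hx => e.right_inv hx)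
    exact (withDensity_absolutelyContinuous _ _).ae_le h1

/-- Fubini's theorem over a chart. -/
theorem fubini_of_chart (hρ : ReferenceDensity (n := n) ρ) (he : e ∈ charts n M)
    {H : Cot n M → ℝ} (h0 : ∀ z, z.proj ∉ e.source → H z = 0)
    (hH : IntegrableOn (fun y => H (canonSymm e y)) (e.target ×ˢ univ)) :
    Integrable H (liouville n M) ∧
    Integrable (fun q => fibreIntegral H q / ρ q) (densMeasure n ρ) ∧
    ∫ z, H z ∂(liouville n M) = ∫ y in e.target ×ˢ univ, H (canonSymm e y) ∧
    ∫ q, fibreIntegral H q / ρ q ∂(densMeasure n ρ) =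
      ∫ y in e.target ×ˢ univ, H (canonSymm e y) := by
  have h1 := integrable_liouville_of_chart he h0 hH
  have hz : ∀ q, q ∉ e.source → fibreIntegral H q = 0 := fun q hq => by
    have : ∀ p, H (fibrePoint q p) = 0 := fun p => h0 _ hq
    change ∫ p, H (fibrePoint q p) = 0
    rw [integral_congr_ae (Filter.Eventually.of_forall this), integral_zero]
  have hprod : ((volume : Measure (Eu n)).restrict e.target).prod (volume : Measure (Eu n)) =
      (volume : Measure (Eu n × Eu n)).restrict (e.target ×ˢ univ) := by
    rw [Measure.volume_eq_prod, ← Measure.prod_restrict, Measure.restrict_univ]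
  have hH' : Integrable (fun y => H (canonSymm e y))
      (((volume : Measure (Eu n)).restrict e.target).prod (volume : Measure (Eu n))) := by
    rw [hprod]
    exact hH
  have hd : ∀ x ∈ e.target, ∫ p, H (canonSymm e (x, p)) = densCoord e (fibreIntegral H) x :=
    fun x hx => by
      rw [fibre_integral he hx, densCoord_eq, smul_eq_mul, mul_comm]
      rfl
  have h2 : IntegrableOn (densCoord e (fibreIntegral H)) e.target :=
    IntegrableOn.congr_fun hH'.integral_prod_left hd e.open_target.measurableSet
  have h3 := integrable_densMeasure_of_chart hρ he hz h2
  refine ⟨h1.1, h3.1, h1.2, h3.2.trans ?_⟩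
  rw [← setIntegral_congr_fun e.open_target.measurableSet hd, ← hprod, integral_prod _ hH']

end Base
end LocalMeasures

/-! ### Convergence and smoothness of the moments of `f`. -/

section Moments

variable {n : ℕ} {U : Set (Eu n)} {L : Eu n × Eu n → ℝ}

theorem LogDecay.momentWeight_le (h : LogDecay U L) {K : Set (Eu n)} (hKU : K ⊆ U)
    (hK : IsCompact K) : ∃ C : ℝ, 0 ≤ C ∧ ∀ x ∈ K, ∀ p : Eu n,
      momentWeight L (x, p) ≤ C * tailBound n p := by
  obtain ⟨C, hC, hb⟩ := h.exp_mul_jetSize_pow_le hKU hK 0 0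
  refine ⟨C, hC, fun x hx p => ?_⟩
  have hp : 0 < 1 + ‖p‖ := by positivity
  have h1 : tailBound n p = ((1 + ‖p‖) ^ (n + 1))⁻¹ := by
    unfold tailBound
    rw [Real.rpow_neg hp.le]
    congr 1
    exact_mod_cast Real.rpow_natCast (1 + ‖p‖) (n + 1)
  rw [h1, ← div_eq_mul_inv, le_div_iff₀ (by positivity)]
  refine le_trans (le_of_eq ?_) (hb x hx p)
  simp only [momentWeight, pow_zero, mul_one]
  ring

theorem tameOn_exp_mul_pow (h : LogDecay U L) (a : ℕ) :
    TameOn U L (momentWeight L) (fun z => Real.exp (L z) * L z ^ a) := by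
  have := TameOn.exp_mul h (tameOn_polynomial h (Polynomial.X ^ a)).weight_one_le
  simpa using this

theorem tameOn_exp_mul_coord (h : LogDecay U L) (i : Fin n) :
    TameOn U L (momentWeight L) (fun z => Real.exp (L z) * z.2 i) :=
  TameOn.exp_mul h (tameOn_coord i)

variable {M : Type*} [TopologicalSpace M] [ChartedSpace (Eu n) M] [IsManifold (𝓡 n) ∞ M]
  {e : OpenPartialHomeomorph M (Eu n)} {f : Cot n M → ℝ} {A : ℕ}

/-- The logarithm of `f` in canonical coordinates. -/
noncomputable def logCoord (f : Cot n M → ℝ) (e : OpenPartialHomeomorph M (Eu n))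
    (y : Eu n × Eu n) : ℝ := Real.log (f (canonSymm e y))

theorem PosDist.exp_logCoord (hf : PosDist f) (e : OpenPartialHomeomorph M (Eu n))
    (y : Eu n × Eu n) : Real.exp (logCoord f e y) = f (canonSymm e y) :=
  Real.exp_log (hf.pos _)

theorem PosDist.logDecay (hf : PosDist f) (he : e ∈ charts n M) :
    LogDecay e.target (logCoord f e) where
  isOpen := e.open_target
  smooth := (hf.smooth.contDiffOn he).log fun y _ => (hf.pos _).ne'
  decay := fun K hKU hK k j => by
    simp only [hf.exp_logCoord]
    exact hf.decay e he K hKU hK k j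

theorem densCoord_fibreIntegral (he : e ∈ charts n M) (h : Cot n M → ℝ) {x : Eu n}
    (hx : x ∈ e.target) : densCoord e (fibreIntegral h) x = ∫ p, h (canonSymm e (x, p)) := by
  rw [fibre_integral he hx, densCoord_eq, smul_eq_mul, mul_comm]
  rfl

theorem PosDist.smoothDensity (hf : PosDist f) {h : Cot n M → ℝ}
    (hh : ∀ e ∈ charts n M, TameOn e.target (logCoord f e) (momentWeight (logCoord f e))
      (fun y => h (canonSymm e y))) : SmoothDensity (n := n) (fibreIntegral h) := fun e he =>
  (((hf.logDecay he).locallyDominated (hh e he)).contDiffOn e.open_target (hh e he).smooth).congr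
    fun x hx => densCoord_fibreIntegral he h hx

theorem PosDist.fibre_integrable_of_tame (hf : PosDist f) {h : Cot n M → ℝ} (he : e ∈ charts n M)
    (hh : TameOn e.target (logCoord f e) (momentWeight (logCoord f e))
      (fun y => h (canonSymm e y))) {q : M} (hq : q ∈ e.source) :
    Integrable fun p => h (fibrePoint q p) := by
  have h1 := ((hf.logDecay he).locallyDominated hh).integrable e.open_target hh.smooth
    (e.map_source hq)
  rwa [fibre_integrable he (e.map_source hq) h, e.left_inv hq] at h1

theorem PosDist.tameOn_entropy (hf : PosDist f) (he : e ∈ charts n M) (a : ℕ) :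
    TameOn e.target (logCoord f e) (momentWeight (logCoord f e))
      (fun y => f (canonSymm e y) * Real.log (f (canonSymm e y)) ^ a) := by
  have := tameOn_exp_mul_pow (hf.logDecay he) a
  simp only [hf.exp_logCoord] at this
  exact this

theorem PosDist.integrable_momentum (hf : PosDist f) (q : M) :
    Integrable (fun p : Eu n => f (fibrePoint q p) • (innerSL ℝ p : Eu n →L[ℝ] ℝ)) := by
  set e := chartAt (Eu n) q with he'
  have he : e ∈ charts n M := chartAt_mem_charts q
  have hq : q ∈ e.source := mem_chart_source _ q
  have hx := e.map_source hq
  have hL := hf.logDecay he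
  -- The tame estimates concern real functions; the covector-valued integrand is bounded directly by
  -- the moment weight times `‖dChart e q‖`.
  have h1 : Integrable fun p => (fun z : Cot n M => f z • covec z) (canonSymm e (e q, p)) := by
    obtain ⟨C, hC, hb⟩ := hL.momentWeight_le (singleton_subset_iff.2 hx) isCompact_singleton
    refine (integrable_tailBound.const_mul (C * ‖dChart e q‖)).mono' ?_
      (Filter.Eventually.of_forall fun p => ?_)
    · have hc : Continuous fun p : Eu n => f (canonSymm e (e q, p)) :=
        slice_continuous (hf.smooth.contDiffOn he).continuousOn hx
      have hc' : Continuous fun p : Eu n =>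
          ((innerSL ℝ p : Eu n →L[ℝ] ℝ).comp (dChart e (e.symm (e q)))) := by fun_prop
      exact (hc.smul hc').aestronglyMeasurable
    · have h2 := hb (e q) rfl p
      have h3 : covec (canonSymm e (e q, p)) = (innerSL ℝ p).comp (dChart e q) := by
        rw [covec_canonSymm, e.left_inv hq]
      have h4 : ‖(innerSL ℝ p : Eu n →L[ℝ] ℝ).comp (dChart e q)‖ ≤ ‖p‖ * ‖dChart e q‖ := by
        refine (ContinuousLinearMap.opNorm_comp_le _ _).trans ?_
        rw [innerSL_apply_norm]
      simp only [norm_smul, h3, Real.norm_eq_abs, abs_of_pos (hf.pos _)]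
      have h5 : f (canonSymm e (e q, p)) * ‖p‖ ≤ C * tailBound n p := by
        refine le_trans ?_ h2
        rw [momentWeight, hf.exp_logCoord]
        exact mul_le_mul_of_nonneg_left (le_add_of_nonneg_left zero_le_one) (hf.pos _).le
      calc _ ≤ f (canonSymm e (e q, p)) * (‖p‖ * ‖dChart e q‖) :=
            mul_le_mul_of_nonneg_left h4 (hf.pos _).le
        _ = (f (canonSymm e (e q, p)) * ‖p‖) * ‖dChart e q‖ := by ring
        _ ≤ (C * tailBound n p) * ‖dChart e q‖ := by gcongr
        _ = _ := by ring
  have h2 := (fibre_integrable he hx fun z : Cot n M => f z • covec z).1 h1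
  rw [e.left_inv hq] at h2
  exact h2

theorem PosDist.momentsConverge (hf : PosDist f) (A : ℕ) : MomentsConverge A f := fun q =>
  ⟨hf.integrable_momentum q, fun a =>
    hf.fibre_integrable_of_tame (h := fun z => f z * Real.log (f z) ^ (a : ℕ))
      (chartAt_mem_charts q) (hf.tameOn_entropy (chartAt_mem_charts q) a)
      (mem_chart_source _ q)⟩

theorem PosDist.integrable_momentum_apply (hf : PosDist f) (q : M) (w : Eu n) :
    Integrable fun p : Eu n => f (fibrePoint q p) * inner ℝ p w := by
  simpa using (hf.integrable_momentum q).apply_continuousLinearMap w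

theorem PosDist.JMap_m_apply (hf : PosDist f) (q : M) (w : Eu n) :
    (JMap A f).m q w = ∫ p : Eu n, f (fibrePoint q p) * inner ℝ p w := by
  have h := ContinuousLinearMap.integral_apply (hf.integrable_momentum q) w
  refine Eq.trans h ?_
  simp

theorem PosDist.mCoord_JMap (hf : PosDist f) (he : e ∈ charts n M) (i : Fin n) {x : Eu n}
    (hx : x ∈ e.target) :
    (JMap A f).mCoord e i x = ∫ p : Eu n, f (canonSymm e (x, p)) * p i := by
  have h1 := fibre_integral he hx fun z => f z * covec z (dChartSymm e x
    (EuclideanSpace.single i (1 : ℝ)))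
  have h2 : ∀ p : Eu n, covec (canonSymm e (x, p)) (dChartSymm e x
      (EuclideanSpace.single i (1 : ℝ))) = p i := fun p => by
    have h := DFunLike.congr_fun (dChart_comp_dChartSymm he hx) (EuclideanSpace.single i (1 : ℝ))
    rw [ContinuousLinearMap.comp_apply, ContinuousLinearMap.id_apply] at h
    rw [covec_canonSymm, ContinuousLinearMap.comp_apply, h]
    simp [EuclideanSpace.inner_single_right]
  simp only [h2] at h1
  rw [h1, smul_eq_mul, mul_comm]
  exact congrArg (· * _) (hf.JMap_m_apply (e.symm x) _)

theorem PosDist.smooth_JMap (hf : PosDist f) : (JMap A f).Smooth := by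
  refine ⟨fun e he i => ?_, fun a => hf.smoothDensity
    (h := fun z => f z * Real.log (f z) ^ (a : ℕ)) fun e he => hf.tameOn_entropy he a⟩
  have ht := tameOn_exp_mul_coord (hf.logDecay he) i
  refine (((hf.logDecay he).locallyDominated ht).contDiffOn e.open_target ht.smooth).congr
    fun x hx => ?_
  rw [hf.mCoord_JMap he i hx]
  simp only [hf.exp_logCoord]

/-- The density `s₀` is positive because `f` is. It supplies the reference density, so no auxiliary
volume on `M` has to be chosen. -/
theorem PosDist.referenceDensity (hf : PosDist f) :
    ReferenceDensity (n := n) (fibreIntegral f) := by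
  have h1 : ∀ e ∈ charts n M, TameOn e.target (logCoord f e) (momentWeight (logCoord f e))
      (fun y => f (canonSymm e y)) := fun e he => by simpa using hf.tameOn_entropy he 0
  refine ⟨fun q => ?_, hf.smoothDensity h1⟩
  have hi := hf.fibre_integrable_of_tame (chartAt_mem_charts q) (h1 _ (chartAt_mem_charts q))
    (mem_chart_source _ q)
  have : 0 < ∫ p, f (fibrePoint q p) := by
    rw [integral_pos_iff_support_of_nonneg (fun p => (hf.pos _).le) hi]
    have : Function.support (fun p => f (fibrePoint q p)) = univ := by
      ext p; simpa using (hf.pos _).ne'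
    rw [this]
    exact isOpen_univ.measure_pos _ ⟨0, trivial⟩
  exact this

/-- Values on the standard frames may jump, but the determinant factors cancel in the quotient,
which is a quotient of smooth components in any chart. -/
theorem continuous_div_reference [MeasurableSpace M] [BorelSpace M] {ρ d : M → ℝ}
    (hρ : ReferenceDensity (n := n) ρ) (hd : SmoothDensity (n := n) d) :
    Continuous fun q => d q / ρ q := by
  refine continuous_iff_continuousAt.2 fun q => ?_
  set e := chartAt (Eu n) q with he'
  have he : e ∈ charts n M := chartAt_mem_charts q
  have hq : q ∈ e.source := mem_chart_source _ q
  have hx := e.map_source hq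
  have h1 : ContinuousAt (fun x => densCoord e d x / densCoord e ρ x) (e q) :=
    (((hd e he).continuousOn.continuousAt (e.open_target.mem_nhds hx))).div
      (((hρ.smooth e he).continuousOn.continuousAt (e.open_target.mem_nhds hx)))
      (densCoord_pos hρ.pos he hx).ne'
  refine (ContinuousAt.comp (f := e) h1 (e.continuousAt hq)).congr ?_
  filter_upwards [e.open_source.mem_nhds hq] with q' hq'
  have hd0 := (abs_det_dChartSymm_pos he (e.map_source hq')).ne'
  simp only [Function.comp_apply, densCoord_eq, e.left_inv hq']
  exact mul_div_mul_right _ _ hd0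

end Moments

/-! ### Reduction to charts by partitions of unity. -/

section Localization

variable {n : ℕ} {M : Type*} [TopologicalSpace M] [ChartedSpace (Eu n) M] [IsManifold (𝓡 n) ∞ M]
  [T2Space M] [SecondCountableTopology M]

/-- An additive property of smooth compactly supported functions holds for all of them if it holds
for those supported in a chart. -/
theorem localization {P : (M → ℝ) → Prop} (h0 : P fun _ => 0)
    (hadd : ∀ r s, P r → P s → P fun q => r q + s q)
    (hloc : ∀ e ∈ charts n M, ∀ r : M → ℝ, ContMDiff (𝓡 n) 𝓘(ℝ, ℝ) ∞ r → HasCompactSupport r →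
      tsupport r ⊆ e.source → P r)
    {r : M → ℝ} (hr : ContMDiff (𝓡 n) 𝓘(ℝ, ℝ) ∞ r) (hc : HasCompactSupport r) : P r := by
  have : LocallyCompactSpace M := ChartedSpace.locallyCompactSpace (Eu n) M
  obtain ⟨g, hg⟩ := SmoothPartitionOfUnity.exists_isSubordinate_chartAt_source (𝓡 n) M
  -- Local finiteness and compactness of the support leave only finitely many summands.
  have hfin : {i | (Function.support (g i) ∩ tsupport r).Nonempty}.Finite :=
    g.locallyFinite.finite_nonempty_inter_compact hc
  have hsum : r = fun q => ∑ i ∈ hfin.toFinset, g i q * r q := by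
    funext q
    rw [← Finset.sum_mul]
    by_cases hq : r q = 0
    · rw [hq, mul_zero]
    · have h1 : ∑ i ∈ hfin.toFinset, g i q = 1 := by
        refine g.sum_finsupport' q (mem_univ q) fun i hi => ?_
        rw [SmoothPartitionOfUnity.mem_finsupport] at hi
        exact hfin.mem_toFinset.2 ⟨q, hi, subset_tsupport r hq⟩
      rw [h1, one_mul]
  have key : ∀ s : Finset M, P fun q => ∑ i ∈ s, g i q * r q := by
    classical
    intro s
    induction s using Finset.induction_on with
    | empty => simpa using h0
    | insert i s hi ih =>
      simp only [Finset.sum_insert hi]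
      refine hadd _ _ (hloc _ (chartAt_mem_charts i) _ ((g i).contMDiff.mul hr) ?_ ?_) ih
      · exact hc.mul_left
      · exact (tsupport_mul_subset_left).trans (hg i)
  rw [hsum]
  exact key _

/-- A smooth compactly supported function that is `1` on a given compact set. -/
theorem exists_cutoff {K : Set M} (hK : IsCompact K) : ∃ r : M → ℝ,
    ContMDiff (𝓡 n) 𝓘(ℝ, ℝ) ∞ r ∧ HasCompactSupport r ∧ ∀ q ∈ K, r q = 1 := by
  have : LocallyCompactSpace M := ChartedSpace.locallyCompactSpace (Eu n) M
  obtain ⟨K', hK', hKK'⟩ := exists_compact_superset hK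
  obtain ⟨r, h1, h0, -⟩ := exists_contMDiffMap_one_nhds_of_subset_interior (𝓡 n) (n := ⊤)
    hK.isClosed hKK'
  exact ⟨r, r.contMDiff, HasCompactSupport.intro hK' h0, fun q hq => h1.self_of_nhdsSet q hq⟩

end Localization

/-! ### Families that are constant in the parameter off a compact set. -/

section OffCompact

open Filter Topology

variable {n : ℕ}

/-- A smooth family of integrands that differs from a tame function only for bounded momenta. -/
theorem LogDecay.locallyDominated_family {U : Set (Eu n)} {L : Eu n × Eu n → ℝ} (hL : LogDecay U L)
    {Φ₀ : Eu n × Eu n → ℝ} (h0 : TameOn U L (momentWeight L) Φ₀) {Φ : (ℝ × Eu n) × Eu n → ℝ}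
    (hΦ : ContDiffOn ℝ ∞ Φ ((univ ×ˢ U) ×ˢ univ))
    (hR : ∀ C ⊆ U, IsCompact C → ∃ R : ℝ, ∀ t, ∀ x ∈ C, ∀ p : Eu n, R < ‖p‖ →
      Φ ((t, x), p) = Φ₀ (x, p)) :
    LocallyDominated volume (univ ×ˢ U) Φ := by
  rintro k ⟨t₀, x₀⟩ ⟨-, hx₀⟩
  obtain ⟨C, hC, hx, hCU⟩ := exists_compact_subset hL.isOpen hx₀
  obtain ⟨R, hR⟩ := hR C hCU hC
  obtain ⟨B, hB, hb⟩ := hL.norm_iteratedFDeriv_le h0 hCU hC k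
  have hO : IsOpen (((univ : Set ℝ) ×ˢ U) ×ˢ (univ : Set (Eu n))) :=
    (isOpen_univ.prod hL.isOpen).prod isOpen_univ
  have hcont : ContinuousOn (iteratedFDeriv ℝ k Φ) ((univ ×ˢ U) ×ˢ univ) :=
    (hΦ.continuousOn_iteratedFDerivWithin (by exact_mod_cast le_top) hO.uniqueDiffOn).congr
      fun z hz => (iteratedFDerivWithin_of_isOpen k hO hz).symm
  -- Two regimes: for momenta of norm at most `R` the derivatives are bounded by continuity on a
  -- compact box, and beyond `R` the family is the fixed tame function.
  have hcpt : IsCompact ((Icc (t₀ - 1) (t₀ + 1) ×ˢ C) ×ˢ Metric.closedBall (0 : Eu n) R) :=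
    (isCompact_Icc.prod hC).prod (isCompact_closedBall 0 R)
  obtain ⟨D, hD⟩ := hcpt.exists_bound_of_continuousOn
    (hcont.mono (prod_mono (prod_mono (subset_univ _) hCU) (subset_univ _)))
  -- Forgetting `t`; the chain rule for the `k`th derivative produces the factor `‖prj‖ ^ k`.
  set prj : (ℝ × Eu n) × Eu n →L[ℝ] Eu n × Eu n :=
    ((ContinuousLinearMap.snd ℝ ℝ (Eu n)).prodMap (ContinuousLinearMap.id ℝ (Eu n))) with hprj
  refine ⟨Icc (t₀ - 1) (t₀ + 1) ×ˢ interior C, prod_mem_nhds (Icc_mem_nhds (by linarith)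
    (by linarith)) (isOpen_interior.mem_nhds hx), fun p => B * tailBound n p * ‖prj‖ ^ k +
      (Metric.closedBall (0 : Eu n) R).indicator (fun _ => |D|) p, ?_, ?_⟩
  · refine ((integrable_tailBound.const_mul B).mul_const _).add ?_
    rw [integrable_indicator_iff Metric.isClosed_closedBall.measurableSet]
    exact integrableOn_const (isCompact_closedBall 0 R).measure_lt_top.ne
  · rintro ⟨t, x⟩ ⟨ht, hxC⟩ p
    beta_reduce
    have hpos : 0 ≤ B * tailBound n p * ‖prj‖ ^ k := by
      have := (tailBound_pos p).le
      positivity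
    by_cases hp : ‖p‖ ≤ R
    · have hp' : p ∈ Metric.closedBall (0 : Eu n) R := by simpa using hp
      rw [indicator_of_mem hp']
      refine (hD ((t, x), p) ⟨⟨ht, interior_subset hxC⟩, hp'⟩).trans ((le_abs_self _).trans ?_)
      linarith
    · have hp' : p ∉ Metric.closedBall (0 : Eu n) R := by simpa using hp
      rw [indicator_of_notMem hp', add_zero]
      have heq : Φ =ᶠ[𝓝 ((t, x), p)] Φ₀ ∘ prj := by
        have : ((univ : Set ℝ) ×ˢ interior C) ×ˢ {p : Eu n | R < ‖p‖} ∈ 𝓝 ((t, x), p) :=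
          ((isOpen_univ.prod isOpen_interior).prod
            (isOpen_lt continuous_const continuous_norm)).mem_nhds
              ⟨⟨mem_univ _, hxC⟩, not_le.1 hp⟩
        filter_upwards [this] with y hy
        exact hR y.1.1 y.1.2 (interior_subset hy.1.2) y.2 hy.2
      have hxU : prj ((t, x), p) ∈ U ×ˢ (univ : Set (Eu n)) :=
        ⟨hCU (interior_subset hxC), mem_univ _⟩
      have hO' : IsOpen (prj ⁻¹' (U ×ˢ univ)) := hL.isOpen_prod.preimage prj.continuous
      rw [(heq.iteratedFDeriv ℝ k).self_of_nhds, ← iteratedFDerivWithin_of_isOpen k hO' hxU,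
        prj.iteratedFDerivWithin_comp_right h0.smooth hL.isOpen_prod.uniqueDiffOn hO'.uniqueDiffOn hxU
          (by exact_mod_cast le_top), iteratedFDerivWithin_of_isOpen k hL.isOpen_prod hxU]
      refine (ContinuousMultilinearMap.norm_compContinuousLinearMap_le _ _).trans ?_
      rw [Finset.prod_const, Finset.card_univ, Fintype.card_fin]
      gcongr
      exact hb x (interior_subset hxC) p

variable {M : Type*} [TopologicalSpace M] [ChartedSpace (Eu n) M] [IsManifold (𝓡 n) ∞ M]
  [T2Space M] {e : OpenPartialHomeomorph M (Eu n)}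

instance instT2SpaceCot : T2Space (Cot n M) := by
  refine ⟨fun z z' hne => ?_⟩
  by_cases h : z.proj = z'.proj
  · have he := chartAt_mem_charts (n := n) z.proj
    set e := chartAt (Eu n) z.proj
    have hz : z.proj ∈ e.source := mem_chart_source _ _
    have hz' : z'.proj ∈ e.source := h ▸ hz
    have hc : canon e z ≠ canon e z' := fun hc => hne <| by
      rw [← canonSymm_canon he hz, ← canonSymm_canon he hz', hc]
    obtain ⟨V, V', hV, hV', hzV, hzV', hd⟩ := t2_separation hc
    have ho := isOpen_over (n := n) e.open_source
    refine ⟨_, _, (continuousOn_canon he).isOpen_inter_preimage ho hV,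
      (continuousOn_canon he).isOpen_inter_preimage ho hV', ⟨hz, hzV⟩, ⟨hz', hzV'⟩, ?_⟩
    exact (hd.preimage (canon e)).mono inter_subset_right inter_subset_right
  · obtain ⟨V, V', hV, hV', hzV, hzV', hd⟩ := t2_separation h
    exact ⟨_, _, isOpen_over hV, isOpen_over hV', hzV, hzV', hd.preimage _⟩

/-- Momenta are bounded on compact subsets of the cotangent bundle. -/
theorem exists_momentum_bound (he : e ∈ charts n M) {K : Set (Cot n M)} (hK : IsCompact K)
    {C : Set (Eu n)} (hC : IsCompact C) (hCe : C ⊆ e.target) :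
    ∃ R : ℝ, ∀ x ∈ C, ∀ p : Eu n, R < ‖p‖ → canonSymm e (x, p) ∉ K := by
  have h1 : IsCompact (e.symm '' C) := hC.image_of_continuousOn (e.continuousOn_symm.mono hCe)
  have h2 : IsCompact (K ∩ {z : Cot n M | z.proj ∈ e.symm '' C}) :=
    hK.inter_right (h1.isClosed.preimage continuous_cot_proj)
  have h3 : IsCompact (canon e '' (K ∩ {z : Cot n M | z.proj ∈ e.symm '' C})) := by
    refine h2.image_of_continuousOn ((continuousOn_canon he).mono fun z hz => ?_)
    obtain ⟨x, hx, hxz⟩ := hz.2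
    change z.proj ∈ e.source
    exact hxz ▸ e.map_target (hCe hx)
  obtain ⟨R, hR⟩ := (h3.image continuous_snd).isBounded.exists_norm_le
  refine ⟨R, fun x hx p hp hmem => absurd (hR p ?_) (not_le.2 hp)⟩
  refine ⟨(x, p), ⟨canonSymm e (x, p), ⟨hmem, x, hx, rfl⟩, canon_canonSymm he (hCe hx)⟩, rfl⟩

end OffCompact

/-! ### Variations of `f` and of its moments. -/

section Variations

variable {n : ℕ} {M : Type*} [TopologicalSpace M] [ChartedSpace (Eu n) M] [IsManifold (𝓡 n) ∞ M]
  {e : OpenPartialHomeomorph M (Eu n)} {f : Cot n M → ℝ} {A : ℕ} {ξ : SemiAlg n M A}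

/-- A vector field in a chart. -/
noncomputable def coordField (e : OpenPartialHomeomorph M (Eu n))
    (u : ∀ q : M, TangentSpace (𝓡 n) q) (x : Eu n) : Eu n :=
  dChart e (e.symm x) (u (e.symm x))

theorem covec_canonSymm_apply (e : OpenPartialHomeomorph M (Eu n))
    (u : ∀ q : M, TangentSpace (𝓡 n) q) (y : Eu n × Eu n) :
    covec (canonSymm e y) (u (canonSymm e y).proj) = inner ℝ y.2 (coordField e u y.1) := rfl

theorem contDiffOn_covec_apply (he : e ∈ charts n M) {u : ∀ q : M, TangentSpace (𝓡 n) q}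
    (hu : ContMDiff (𝓡 n) (𝓡 n).tangent ∞ (fun q => (⟨q, u q⟩ : TangentBundle (𝓡 n) M))) :
    ContDiffOn ℝ ∞ (fun y => inner ℝ y.2 (coordField e u y.1)) (e.target ×ˢ univ) :=
  contMDiffOn_iff_contDiffOn.1
    ((contMDiffOn_covec_apply (W := univ) hu.contMDiffOn).comp (contMDiffOn_canonSymm he)
      fun y _ => mem_univ _)

theorem contDiffOn_coordField (he : e ∈ charts n M) {u : ∀ q : M, TangentSpace (𝓡 n) q}
    (hu : ContMDiff (𝓡 n) (𝓡 n).tangent ∞ (fun q => (⟨q, u q⟩ : TangentBundle (𝓡 n) M))) :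
    ContDiffOn ℝ ∞ (coordField e u) e.target := by
  rw [contDiffOn_euclidean]
  intro i
  -- The components of the field are read off by inserting constant unit momenta into the smooth
  -- momentum function.
  have h1 : ContDiffOn ℝ ∞ (fun x : Eu n => (x, (EuclideanSpace.single i (1 : ℝ) : Eu n)))
      e.target := (contDiff_id.prodMk contDiff_const).contDiffOn
  have h2 := (contDiffOn_covec_apply he hu).comp h1 fun x hx => ⟨hx, mem_univ _⟩
  refine h2.congr fun x hx => ?_
  simp [EuclideanSpace.inner_single_left]

theorem contDiffOn_comp_symm (he : e ∈ charts n M) {g : M → ℝ}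
    (hg : ContMDiff (𝓡 n) 𝓘(ℝ, ℝ) ∞ g) : ContDiffOn ℝ ∞ (fun x => g (e.symm x)) e.target :=
  contMDiffOn_iff_contDiffOn.1 (hg.comp_contMDiffOn (charts_contMDiffOn_symm he))

/-- For `a = 0` the truncated exponent `a - 1` is harmless, since its coefficient is zero. -/
theorem deriv_yFun (a : ℕ) {x : ℝ} (hx : 0 < x) :
    HasDerivAt (yFun a) (Real.log x ^ a + a * Real.log x ^ (a - 1)) x := by
  have h := (hasDerivAt_id x).mul ((Real.hasDerivAt_log hx.ne').pow a)
  refine h.congr_deriv ?_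
  simp only [id, Pi.pow_apply]
  field_simp

theorem liftDeriv_eq (hf : ∀ z, 0 < f z) (ξ : SemiAlg n M A) (z : Cot n M) :
    liftDeriv f ξ z = covec z (ξ.u z.proj) + ∑ a : Fin (A + 1),
      (Real.log (f z) ^ (a : ℕ) + (a : ℕ) * Real.log (f z) ^ ((a : ℕ) - 1)) * ξ.g a z.proj := by
  rw [liftDeriv]
  simp only [(deriv_yFun _ (hf z)).deriv]
  rfl

theorem PosDist.smoothCot_log (hf : PosDist f) : SmoothCot fun z => Real.log (f z) := fun z =>
  (Real.contDiffAt_log.2 (hf.pos z).ne').contMDiffAt.comp z (hf.smooth z)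

theorem PosDist.smoothCot_liftDeriv (hf : PosDist f) (hξ : ξ.Smooth) :
    SmoothCot (liftDeriv f ξ) := by
  have h1 : SmoothCot fun z : Cot n M => covec z (ξ.u z.proj) :=
    contMDiffOn_univ.1 (contMDiffOn_covec_apply (W := univ) hξ.1.contMDiffOn)
  have hl := hf.smoothCot_log
  have h2 : SmoothCot fun z : Cot n M => ∑ a : Fin (A + 1),
      (Real.log (f z) ^ (a : ℕ) + (a : ℕ) * Real.log (f z) ^ ((a : ℕ) - 1)) * ξ.g a z.proj := by
    refine contMDiff_finsetSum fun a _ => ContMDiff.mul (ContMDiff.add (hl.pow _)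
      (contMDiff_const.mul (hl.pow _))) ((hξ.2 a).comp contMDiff_cot_proj)
  refine (h1.add h2).congr fun z => ?_
  exact liftDeriv_eq hf.pos ξ z

/-- The function on the cotangent bundle with fibre integral `⟨J f, ξ⟩`. -/
noncomputable def momentPairing (ξ : SemiAlg n M A) (f : Cot n M → ℝ) (z : Cot n M) : ℝ :=
  f z * covec z (ξ.u z.proj) + ∑ a : Fin (A + 1), f z * Real.log (f z) ^ (a : ℕ) * ξ.g a z.proj

theorem PosDist.pairDensity_JMap (hf : PosDist f) (ξ : SemiAlg n M A) (q : M) :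
    pairDensity (JMap A f) ξ q = fibreIntegral (momentPairing ξ f) q := by
  have hs := fun a : Fin (A + 1) => ((hf.momentsConverge A q).2 a).mul_const (ξ.g a q)
  have h1 : ∀ w : Eu n, ∫ p : Eu n, (f (fibrePoint q p) * inner ℝ p w + ∑ a : Fin (A + 1),
        f (fibrePoint q p) * Real.log (f (fibrePoint q p)) ^ (a : ℕ) * ξ.g a q) =
      (JMap A f).m q w + ∑ a : Fin (A + 1), (JMap A f).s a q * ξ.g a q := fun w => by
    refine (integral_add (hf.integrable_momentum_apply q w)
      (integrable_finsetSum _ fun a _ => hs a)).trans ?_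
    rw [hf.JMap_m_apply]
    refine congrArg _ ((integral_finsetSum _ fun a _ => hs a).trans ?_)
    simp only [integral_mul_const]
    rfl
  exact (h1 (ξ.u q)).symm

theorem PosDist.tameOn_momentPairing (hf : PosDist f) (he : e ∈ charts n M) (hξ : ξ.Smooth) :
    TameOn e.target (logCoord f e) (momentWeight (logCoord f e))
      (fun y => momentPairing ξ f (canonSymm e y)) := by
  have hL := hf.logDecay he
  have h1 := (tameOn_inner (L := logCoord f e) e.open_target
    (contDiffOn_coordField he hξ.1)).exp_mul hL
  have h2 : ∀ a : Fin (A + 1), TameOn e.target (logCoord f e) (momentWeight (logCoord f e))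
      fun y => ξ.g a (e.symm y.1) * (Real.exp (logCoord f e y) * logCoord f e y ^ (a : ℕ)) :=
    fun a => (tameOn_comp_fst e.open_target (contDiffOn_comp_symm he (hξ.2 a))).of_weight_one_mul
      e.open_target (momentWeight_nonneg _) (tameOn_exp_mul_pow hL a)
  have h3 := h1.add e.open_target (momentWeight_nonneg _)
    (TameOn.sum e.open_target (momentWeight_nonneg _) Finset.univ h2)
  convert h3 using 2 with y
  simp only [hf.exp_logCoord, momentPairing]
  refine congrArg₂ _ rfl (Finset.sum_congr rfl fun a _ => ?_)
  rw [mul_comm]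
  rfl

variable [T2Space M]

/-- Families of functions on the cotangent bundle that do not depend on the parameter off a
compact set. -/
theorem PosDist.family_dominated (hf : PosDist f) (he : e ∈ charts n M) {K : Set (Cot n M)}
    (hK : IsCompact K) {k : ℝ → Eu n × Eu n → ℝ} {k₀ : Eu n × Eu n → ℝ}
    (hk : ContDiffOn ℝ ∞ (fun y : ℝ × (Eu n × Eu n) => k y.1 y.2)
      (univ ×ˢ (e.target ×ˢ univ)))
    (h0 : TameOn e.target (logCoord f e) (momentWeight (logCoord f e)) k₀)
    (heq : ∀ t y, canonSymm e y ∉ K → k t y = k₀ y) :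
    ContDiffOn ℝ ∞ (fun y : (ℝ × Eu n) × Eu n => k y.1.1 (y.1.2, y.2))
      ((univ ×ˢ e.target) ×ˢ univ) ∧
    LocallyDominated volume (univ ×ˢ e.target)
      (fun y : (ℝ × Eu n) × Eu n => k y.1.1 (y.1.2, y.2)) := by
  have h1 : ContDiffOn ℝ ∞ (fun y : (ℝ × Eu n) × Eu n => k y.1.1 (y.1.2, y.2))
      ((univ ×ˢ e.target) ×ˢ univ) := by
    have h2 : ContDiff ℝ ∞ (fun y : (ℝ × Eu n) × Eu n => (y.1.1, (y.1.2, y.2))) := by fun_prop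
    exact hk.comp h2.contDiffOn fun y hy => ⟨mem_univ _, hy.1.2, mem_univ _⟩
  refine ⟨h1, (hf.logDecay he).locallyDominated_family h0 h1 fun C hCU hC => ?_⟩
  obtain ⟨R, hR⟩ := exists_momentum_bound he hK hC hCU
  exact ⟨R, fun t x hx p hp => heq t _ (hR x hx p hp)⟩

variable {c : ℝ → Cot n M → ℝ}

theorem KineticVariation.contDiffOn_log (hc : KineticVariation f c) (he : e ∈ charts n M) :
    ContDiffOn ℝ ∞ (fun y : ℝ × (Eu n × Eu n) => Real.log (c y.1 (canonSymm e y.2)))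
      (univ ×ˢ (e.target ×ˢ univ)) :=
  (hc.smooth.contDiffOn he).log fun y _ => ((hc.mem y.1).pos _).ne'

theorem KineticVariation.contDiffOn_momentPairing (hc : KineticVariation f c)
    (he : e ∈ charts n M) (hξ : ξ.Smooth) :
    ContDiffOn ℝ ∞ (fun y : ℝ × (Eu n × Eu n) => momentPairing ξ (c y.1) (canonSymm e y.2))
      (univ ×ˢ (e.target ×ˢ univ)) := by
  have h1 := hc.smooth.contDiffOn he
  have h2 := hc.contDiffOn_log he
  have h3 : ContDiffOn ℝ ∞ (fun y : ℝ × (Eu n × Eu n) =>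
      inner ℝ y.2.2 (coordField e ξ.u y.2.1)) (univ ×ˢ (e.target ×ˢ univ)) :=
    (contDiffOn_covec_apply he hξ.1).comp contDiff_snd.contDiffOn fun y hy => hy.2
  have h4 : ∀ a, ContDiffOn ℝ ∞ (fun y : ℝ × (Eu n × Eu n) => ξ.g a (e.symm y.2.1))
      (univ ×ˢ (e.target ×ˢ univ)) := fun a =>
    (contDiffOn_comp_symm he (hξ.2 a)).comp
      ((contDiff_fst.comp contDiff_snd).contDiffOn) fun y hy => hy.2.1
  exact (h1.mul h3).add (ContDiffOn.sum fun a _ => (h1.mul (h2.pow a)).mul (h4 a))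

/-- Over a compact part of a chart, the variation changes the moment integrands only for bounded
momenta, so joint smoothness in the parameter survives integration. On the base nothing changes off
the projection of the compact support. -/
theorem KineticVariation.fluidVariation (hf : PosDist f) (hc : KineticVariation f c) (A : ℕ) :
    FluidVariation (JMap A f) fun t => JMap A (c t) := by
  obtain ⟨K, hK, hKc⟩ := hc.support
  refine ⟨by rw [hc.zero], fun e he i => ?_, fun e he a => ?_, ?_⟩
  · have hcoord : ContDiff ℝ ∞ (fun y : ℝ × (Eu n × Eu n) => y.2.2 i) :=
      (EuclideanSpace.proj i : Eu n →L[ℝ] ℝ).contDiff.comp (contDiff_snd.comp contDiff_snd)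
    have h0 := tameOn_exp_mul_coord (hf.logDecay he) i
    simp only [hf.exp_logCoord] at h0
    have h2 := hf.family_dominated he hK (k := fun t y => c t (canonSymm e y) * y.2 i)
      ((hc.smooth.contDiffOn he).mul hcoord.contDiffOn) h0 fun t y hy => by
        rw [hKc t _ hy]
    exact (h2.2.contDiffOn (isOpen_univ.prod e.open_target) h2.1).congr fun y hy =>
      (hc.mem y.1).mCoord_JMap he i hy.2
  · have h2 := hf.family_dominated he hK
      (k := fun t y => c t (canonSymm e y) * Real.log (c t (canonSymm e y)) ^ (a : ℕ))
      ((hc.smooth.contDiffOn he).mul ((hc.contDiffOn_log he).pow a)) (hf.tameOn_entropy he a)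
      fun t y hy => by
        rw [hKc t _ hy]
    exact (h2.2.contDiffOn (isOpen_univ.prod e.open_target) h2.1).congr fun y hy =>
      densCoord_fibreIntegral he (fun z => c y.1 z * Real.log (c y.1 z) ^ (a : ℕ)) hy.2
  · refine ⟨_, hK.image continuous_cot_proj, fun t q hq => ?_⟩
    have h : ∀ p : Eu n, c t (fibrePoint q p) = f (fibrePoint q p) := fun p =>
      hKc t _ fun hp => hq ⟨_, hp, rfl⟩
    exact ⟨congrArg (fun h : Eu n → (Eu n →L[ℝ] ℝ) => ∫ p, h p) (funext fun p => by
        change c t (fibrePoint q p) • _ = f (fibrePoint q p) • _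
        rw [h]), fun a => congrArg (integral volume) (funext fun p => by
        change c t (fibrePoint q p) * Real.log (c t (fibrePoint q p)) ^ (a : ℕ) =
          f (fibrePoint q p) * Real.log (f (fibrePoint q p)) ^ (a : ℕ)
        rw [h])⟩

end Variations

/-! ### The functional derivative of a pulled back functional. -/

section KineticDerivative

variable {n : ℕ} {M : Type*} [TopologicalSpace M] [ChartedSpace (Eu n) M] [IsManifold (𝓡 n) ∞ M]
  {e : OpenPartialHomeomorph M (Eu n)} {f : Cot n M → ℝ} {A : ℕ} {ξ : SemiAlg n M A}
  {c : ℝ → Cot n M → ℝ}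

theorem SmoothCotFamily.differentiable (hc : SmoothCotFamily c) (z : Cot n M) :
    Differentiable ℝ fun t => c t z := by
  have h : ContMDiff 𝓘(ℝ, ℝ) 𝓘(ℝ, ℝ) ∞ fun t => c t z :=
    ContMDiff.comp hc (f := fun t : ℝ => (t, z)) (contMDiff_id.prodMk contMDiff_const)
  exact (contMDiff_iff_contDiff.1 h).differentiable (by simp)

/-- The integrand of the first variation of `⟨J f, ξ⟩`. -/
noncomputable def variationIntegrand (ξ : SemiAlg n M A) (f : Cot n M → ℝ) (c : ℝ → Cot n M → ℝ)
    (z : Cot n M) : ℝ := liftDeriv f ξ z * deriv (fun t => c t z) 0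

theorem KineticVariation.hasDerivAt_momentPairing (hc : KineticVariation f c)
    (ξ : SemiAlg n M A) (z : Cot n M) :
    HasDerivAt (fun t => momentPairing ξ (c t) z) (variationIntegrand ξ f c z) 0 := by
  have h0 : c 0 z = f z := by rw [hc.zero]
  have hpos : 0 < c 0 z := (hc.mem 0).pos z
  have h1 := (hc.smooth.differentiable z 0).hasDerivAt
  have h2 : ∀ a : ℕ, HasDerivAt (fun t => c t z * Real.log (c t z) ^ a)
      ((Real.log (c 0 z) ^ a + a * Real.log (c 0 z) ^ (a - 1)) * deriv (fun t => c t z) 0) 0 :=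
    fun a => HasDerivAt.comp (h₂ := yFun a) (0 : ℝ) (deriv_yFun a hpos) h1
  refine ((h1.mul_const (covec z (ξ.u z.proj))).add (HasDerivAt.fun_sum fun (a : Fin (A + 1)) _ =>
    (h2 a).mul_const (ξ.g a z.proj))).congr_deriv ?_
  have hf : ∀ z, 0 < f z := fun z => by
    have := (hc.mem 0).pos z
    rwa [hc.zero] at this
  rw [variationIntegrand, liftDeriv_eq hf, h0, add_mul, Finset.sum_mul, mul_comm]
  congr 1
  exact Finset.sum_congr rfl fun a _ => by ring

theorem KineticVariation.contDiffOn_variationIntegrand (hf : PosDist f)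
    (hc : KineticVariation f c) (he : e ∈ charts n M) (hξ : ξ.Smooth) :
    ContDiffOn ℝ ∞ (fun y => variationIntegrand ξ f c (canonSymm e y)) (e.target ×ˢ univ) := by
  have hO : IsOpen ((univ : Set ℝ) ×ˢ (e.target ×ˢ (univ : Set (Eu n)))) :=
    isOpen_univ.prod (e.open_target.prod isOpen_univ)
  have h1 := hc.smooth.contDiffOn he
  have h2 : ContDiffOn ℝ ∞ (fun y : Eu n × Eu n =>
      fderiv ℝ (fun y : ℝ × (Eu n × Eu n) => c y.1 (canonSymm e y.2)) (0, y) (1, 0))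
      (e.target ×ˢ univ) := by
    have h3 := h1.fderiv_of_isOpen hO (m := ∞) (by simp)
    exact (h3.comp (contDiff_const.prodMk contDiff_id).contDiffOn
      fun y hy => ⟨mem_univ _, hy⟩).clm_apply contDiffOn_const
  refine ((hf.smoothCot_liftDeriv hξ).contDiffOn he).mul (h2.congr fun y hy => ?_)
  have hmem : ((0 : ℝ), y) ∈ (univ : Set ℝ) ×ˢ (e.target ×ˢ (univ : Set (Eu n))) :=
    ⟨mem_univ _, hy⟩
  have h4 := ((h1.differentiableOn (by simp)).differentiableAt (hO.mem_nhds hmem)).hasFDerivAt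
  have h5 : HasDerivAt (fun t : ℝ => (t, y)) ((1 : ℝ), (0 : Eu n × Eu n)) 0 :=
    (hasDerivAt_id _).prodMk (hasDerivAt_const _ _)
  exact (h4.comp_hasDerivAt (0 : ℝ) h5).deriv

theorem KineticVariation.variationIntegrand_eq_zero {K : Set (Cot n M)}
    (hK : ∀ t, ∀ z ∉ K, c t z = f z) {z : Cot n M} (hz : z ∉ K) :
    variationIntegrand ξ f c z = 0 := by
  have : (fun t => c t z) = fun _ => f z := funext fun t => hK t z hz
  rw [variationIntegrand, this, deriv_const, mul_zero]

variable [T2Space M]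

/-- Differentiation under the fibre integral, carried out at a fixed point in the momentum
coordinates of a chart; dividing by the constant Jacobian returns to the standard frame. -/
theorem KineticVariation.hasDerivAt_pairDensity (hf : PosDist f) (hc : KineticVariation f c)
    (hξ : ξ.Smooth) (q : M) :
    HasDerivAt (fun t => pairDensity (JMap A (c t)) ξ q)
      (fibreIntegral (variationIntegrand ξ f c) q) 0 := by
  obtain ⟨K, hK, hKc⟩ := hc.support
  have he := chartAt_mem_charts (n := n) q
  set e := chartAt (Eu n) q
  have hq : q ∈ e.source := mem_chart_source _ _
  have hx := e.map_source hq
  have hdet := (abs_det_dChartSymm_pos he hx).ne'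
  have hO : IsOpen ((univ : Set ℝ) ×ˢ e.target) := isOpen_univ.prod e.open_target
  obtain ⟨hΦ, hb⟩ := hf.family_dominated he hK
    (k := fun t y => momentPairing ξ (c t) (canonSymm e y))
    (hc.contDiffOn_momentPairing he hξ) (hf.tameOn_momentPairing he hξ) fun t y hy => by
      simp only [momentPairing, hKc t _ hy]
  set Φ : (ℝ × Eu n) × Eu n → ℝ := fun y =>
    momentPairing ξ (c y.1.1) (canonSymm e (y.1.2, y.2)) with hΦdef
  have hmem : ((0 : ℝ), e q) ∈ (univ : Set ℝ) ×ˢ e.target := ⟨mem_univ _, hx⟩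
  have h1 := hb.hasFDerivAt hO hΦ hmem
  have h2 : HasDerivAt (fun t : ℝ => (t, e q)) ((1 : ℝ), (0 : Eu n)) 0 :=
    (hasDerivAt_id _).prodMk (hasDerivAt_const _ _)
  have h3 := h1.comp_hasDerivAt (0 : ℝ) h2
  have h4 : ∀ p : Eu n, KineticFluid.fderivLeft Φ ((0, e q), p) (1, 0) =
      variationIntegrand ξ f c (canonSymm e (e q, p)) := fun p => by
    have hd : HasFDerivAt Φ (fderiv ℝ Φ ((0, e q), p)) ((0, e q), p) :=
      ((hΦ.differentiableOn (by simp)).differentiableAt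
        ((hO.prod isOpen_univ).mem_nhds ⟨hmem, mem_univ p⟩)).hasFDerivAt
    have h5 : HasDerivAt (fun t : ℝ => ((t, e q), p)) (((1 : ℝ), (0 : Eu n)), (0 : Eu n)) 0 :=
      h2.prodMk (hasDerivAt_const _ _)
    exact (hd.comp_hasDerivAt (0 : ℝ) h5).unique
      (hc.hasDerivAt_momentPairing ξ (canonSymm e (e q, p)))
  have h6 : (∫ p, KineticFluid.fderivLeft Φ ((0, e q), p)) (1, 0) =
      ∫ p, variationIntegrand ξ f c (canonSymm e (e q, p)) := by
    rw [ContinuousLinearMap.integral_apply ((hb.fderivLeft hO hΦ).integrable hO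
      (contDiffOn_fderivLeft hO hΦ) hmem)]
    exact integral_congr_ae (Filter.Eventually.of_forall h4)
  rw [h6, ← densCoord_fibreIntegral he _ hx, densCoord_eq, e.left_inv hq] at h3
  have h7 : (fun t => pairDensity (JMap A (c t)) ξ q) = fun t =>
      (∫ p, Φ ((t, e q), p)) / |(dChartSymm e (e q)).det| := by
    funext t
    rw [(hc.mem t).pairDensity_JMap ξ q, eq_div_iff hdet]
    have := densCoord_fibreIntegral he (momentPairing ξ (c t)) hx
    rw [densCoord_eq, e.left_inv hq] at this
    exact this
  rw [h7]
  exact (h3.div_const _).congr_deriv (mul_div_cancel_right₀ _ hdet)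

theorem KineticVariation.smoothDensity_variation (hf : PosDist f) (hc : KineticVariation f c)
    (hξ : ξ.Smooth) : SmoothDensity (n := n) (fibreIntegral (variationIntegrand ξ f c)) := by
  obtain ⟨K, hK, hKc⟩ := hc.support
  intro e he
  have h1 := hc.contDiffOn_variationIntegrand hf he hξ
  -- The integrand is treated as a family independent of the parameter that agrees with the tame
  -- function `0` off `K`.
  obtain ⟨hΦ, hb⟩ := hf.family_dominated he hK
    (k := fun _ y => variationIntegrand ξ f c (canonSymm e y)) (k₀ := fun _ => 0)
    (h1.comp contDiff_snd.contDiffOn fun y hy => hy.2)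
    (fun C _ _ => tame_zero fun z _ => momentWeight_nonneg _ z)
    fun t y hy => variationIntegrand_eq_zero hKc hy
  refine ((hb.contDiffOn (isOpen_univ.prod e.open_target) hΦ).comp
    (contDiff_const.prodMk contDiff_id : ContDiff ℝ ∞ fun x : Eu n => ((0 : ℝ), x)).contDiffOn
    fun x hx => ⟨mem_univ _, hx⟩).congr fun x hx => ?_
  exact densCoord_fibreIntegral he _ hx

theorem fibreIntegral_mul_base (r : M → ℝ) (h : Cot n M → ℝ) (q : M) :
    fibreIntegral (fun z => r z.proj * h z) q = r q * fibreIntegral h q :=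
  integral_const_mul (r q) fun p => h (fibrePoint q p)

variable [SecondCountableTopology M] [MeasurableSpace M] [BorelSpace M]

/-- Fubini's theorem is available over charts only; multiplied by a compactly supported function of
the base point, both sides are additive and can be localized. -/
theorem KineticVariation.densIntegral_variation (hf : PosDist f) (hc : KineticVariation f c)
    (hξ : ξ.Smooth) :
    densIntegral n (fibreIntegral (variationIntegrand ξ f c)) =
      ∫ z, variationIntegrand ξ f c z ∂(liouville n M) := by
  obtain ⟨K, hK, hKc⟩ := hc.support
  set H := variationIntegrand ξ f c with hH
  set ρ := fibreIntegral f with hρdef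
  have hρ : ReferenceDensity (n := n) ρ := hf.referenceDensity
  have hm : Measurable fun q => fibreIntegral H q / ρ q :=
    (continuous_div_reference hρ (hc.smoothDensity_variation hf hξ)).measurable
  have hzero : ∀ z ∉ K, H z = 0 := fun z hz => variationIntegrand_eq_zero hKc hz
  have hloc : ∀ r : M → ℝ, ContMDiff (𝓡 n) 𝓘(ℝ, ℝ) ∞ r → HasCompactSupport r →
      Integrable (fun z => r z.proj * H z) (liouville n M) ∧
      Integrable (fun q => r q * fibreIntegral H q / ρ q) (densMeasure n ρ) ∧
      ∫ z, r z.proj * H z ∂(liouville n M) =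
        ∫ q, r q * fibreIntegral H q / ρ q ∂(densMeasure n ρ) := by
    intro r hr hrc
    refine localization (n := n) (P := fun r : M → ℝ =>
      Integrable (fun z => r z.proj * H z) (liouville n M) ∧
      Integrable (fun q => r q * fibreIntegral H q / ρ q) (densMeasure n ρ) ∧
      ∫ z, r z.proj * H z ∂(liouville n M) =
        ∫ q, r q * fibreIntegral H q / ρ q ∂(densMeasure n ρ)) (by simp) ?_ ?_ hr hrc
    · rintro r s ⟨h1, h2, h3⟩ ⟨h1', h2', h3'⟩
      simp only [add_mul, add_div]
      exact ⟨h1.add h1', h2.add h2', by rw [integral_add h1 h1', integral_add h2 h2', h3, h3']⟩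
    · intro e he r hr hrc hre
      have hCc : IsCompact (e '' tsupport r) :=
        hrc.image_of_continuousOn (e.continuousOn.mono hre)
      have hCe : e '' tsupport r ⊆ e.target := by
        rintro _ ⟨q, hq, rfl⟩
        exact e.map_source (hre hq)
      obtain ⟨R, hR⟩ := exists_momentum_bound he hK hCc hCe
      have hcont : ContinuousOn (fun y : Eu n × Eu n => r (e.symm y.1) * H (canonSymm e y))
          (e.target ×ˢ univ) :=
        (hr.continuous.comp_continuousOn (e.continuousOn_symm.comp continuousOn_fst
          fun y hy => hy.1)).mul (hc.contDiffOn_variationIntegrand hf he hξ).continuousOn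
      -- Continuity suffices: the compact support of `r` bounds the positions and `K` bounds the
      -- momenta.
      have hint : IntegrableOn (fun y : Eu n × Eu n => r (e.symm y.1) * H (canonSymm e y))
          (e.target ×ˢ univ) := by
        refine IntegrableOn.of_forall_sdiff_eq_zero
          ((hcont.mono (prod_mono hCe (subset_univ _))).integrableOn_compact
            (hCc.prod (isCompact_closedBall 0 R))) (measurableSet_chart_prod e) ?_
        rintro ⟨x, p⟩ ⟨⟨hx, -⟩, hn⟩
        by_cases hxs : e.symm x ∈ tsupport r
        · have hxC : x ∈ e '' tsupport r := ⟨_, hxs, e.right_inv hx⟩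
          have hp : R < ‖p‖ := not_le.1 fun hp => hn ⟨hxC, by simpa using hp⟩
          rw [hzero _ (hR x hxC p hp), mul_zero]
        · rw [image_eq_zero_of_notMem_tsupport hxs, zero_mul]
      have key := fubini_of_chart hρ he (H := fun z => r z.proj * H z) (fun z hz => by
        rw [image_eq_zero_of_notMem_tsupport fun h => hz (hre h), zero_mul]) hint
      simp only [fibreIntegral_mul_base] at key
      exact ⟨key.1, key.2.1, key.2.2.1.trans key.2.2.2.symm⟩
  -- A cutoff equal to `1` on the projection of `K` leaves `H` unchanged.
  obtain ⟨r, hr, hrc, hr1⟩ := exists_cutoff (n := n) (hK.image (continuous_cot_proj (n := n)))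
  obtain ⟨h1, h2, h3⟩ := hloc r hr hrc
  have e1 : (fun z : Cot n M => r z.proj * H z) = H := by
    funext z
    by_cases hz : z ∈ K
    · rw [hr1 _ ⟨z, hz, rfl⟩, one_mul]
    · rw [hzero z hz, mul_zero]
  have e2 : (fun q => r q * fibreIntegral H q / ρ q) = fun q => fibreIntegral H q / ρ q := by
    funext q
    rw [← fibreIntegral_mul_base, e1]
  rw [e1] at h3
  rw [e2] at h2 h3
  rw [densIntegral_eq hρ hm h2, h3]

/-- Differentiable functionals of the fluid variables pull back along `J`. -/
theorem HasFluidDeriv.comp_JMap (hf : PosDist f) {F : SemiDual n M A → ℝ}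
    (hF : HasFluidDeriv F (JMap A f) ξ) :
    HasKineticDeriv (F ∘ JMap A) f (liftDeriv f ξ) := by
  refine ⟨hf.smoothCot_liftDeriv hF.1, fun c hc => ?_⟩
  have h1 := hF.2 _ (hc.fluidVariation hf A)
  have h2 : (fun q => deriv (fun t => pairDensity (JMap A (c t)) ξ q) 0) =
      fibreIntegral (variationIntegrand ξ f c) :=
    funext fun q => (hc.hasDerivAt_pairDensity hf hF.1 q).deriv
  rw [h2, hc.densIntegral_variation hf hF.1] at h1
  exact h1

end KineticDerivative

/-! ### Invariance of the Poisson bracket under change of chart. -/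

section PoissonInvariance

open Filter Topology

variable {n : ℕ}

/-- The canonical Poisson structure is invariant under the differentials of cotangent lifts. -/
theorem pb_comp_cotangentLift {A B : Eu n →L[ℝ] Eu n}
    (hAB : A.comp B = ContinuousLinearMap.id ℝ (Eu n)) {Q : Eu n →L[ℝ] Eu n →L[ℝ] Eu n}
    (hQ : ∀ v w, Q v w = Q w v) (p : Eu n) {T : Eu n × Eu n →L[ℝ] Eu n × Eu n}
    (hT1 : ∀ v w, (T (v, w)).1 = A v)
    (hT2 : ∀ v w i, (T (v, w)).2 i =
      inner ℝ p (Q (A v) (EuclideanSpace.single i (1 : ℝ))) +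
        inner ℝ (B (EuclideanSpace.single i (1 : ℝ))) w)
    (α β : Eu n × Eu n →L[ℝ] ℝ) : pb (α.comp T) (β.comp T) = pb α β := by
  -- The vector `v α` is the momentum gradient, that is, the base component of the Hamiltonian
  -- vector of `α`.
  set v : (Eu n × Eu n →L[ℝ] ℝ) → Eu n := fun α => WithLp.toLp 2 fun i => α (pVec i) with hv
  have hsnd : ∀ (α : Eu n × Eu n →L[ℝ] ℝ) (w : Eu n), α (0, w) = ∑ i, w i * v α i := fun α w => by
    have h := sum_inner_single_mul w (α.comp (ContinuousLinearMap.inr ℝ (Eu n) (Eu n)))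
    simp only [ContinuousLinearMap.comp_apply, ContinuousLinearMap.inr_apply] at h
    rw [← h]
    exact Finset.sum_congr rfl fun i _ => mul_comm _ _
  have hlin : ∀ (α : Eu n × Eu n →L[ℝ] ℝ) (ℓ : Eu n →L[ℝ] ℝ),
      ∑ i, ℓ (EuclideanSpace.single i (1 : ℝ)) * v α i = ℓ (v α) := fun α ℓ =>
    sum_inner_single_mul (v α) ℓ
  have hp : ∀ (β : Eu n × Eu n →L[ℝ] ℝ) i, β (T (pVec i)) = B (v β) i := fun β i => by
    have h1 : T (pVec i) = (0, (T (pVec i)).2) := Prod.ext (by rw [hT1, map_zero]) rfl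
    rw [h1, hsnd]
    refine Eq.trans ?_ (hlin β ((EuclideanSpace.proj i : Eu n →L[ℝ] ℝ).comp B))
    refine Finset.sum_congr rfl fun j _ => ?_
    rw [hT2]
    simp [EuclideanSpace.inner_single_right]
  -- The second derivative `Q` enters only through a term symmetric in `α` and `β`, which
  -- antisymmetrization removes.
  have hw : ∀ α β : Eu n × Eu n →L[ℝ] ℝ, ∑ i, α (T (qVec i)) * β (T (pVec i)) =
      α (v β, 0) + inner ℝ p (Q (v β) (v α)) := fun α β => by
    have h1 := sum_inner_single_mul (B (v β))
      ((α.comp T).comp (ContinuousLinearMap.inl ℝ (Eu n) (Eu n)))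
    simp only [ContinuousLinearMap.comp_apply, ContinuousLinearMap.inl_apply] at h1
    have h2 : A (B (v β)) = v β := DFunLike.congr_fun hAB (v β)
    have h3 : T (B (v β), 0) = (v β, 0) + (0, (T (B (v β), 0)).2) :=
      Prod.ext (by simp [hT1, h2]) (by simp)
    simp only [hp]
    rw [h1, h3, map_add, hsnd]
    congr 1
    rw [← innerSL_apply_apply ℝ p, ← ContinuousLinearMap.comp_apply, ← hlin]
    refine Finset.sum_congr rfl fun j _ => ?_
    rw [hT2, h2]
    simp
  have hq : ∀ α β : Eu n × Eu n →L[ℝ] ℝ, ∑ i, α (qVec i) * β (pVec i) = α (v β, 0) :=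
    fun α β => by
      have h1 := sum_inner_single_mul (v β) (α.comp (ContinuousLinearMap.inl ℝ (Eu n) (Eu n)))
      simp only [ContinuousLinearMap.comp_apply, ContinuousLinearMap.inl_apply] at h1
      exact h1
  simp only [pb, Finset.sum_sub_distrib, ContinuousLinearMap.comp_apply]
  rw [hw, hw, hq, hq, hQ (v β) (v α)]
  ring

variable {M : Type*} [TopologicalSpace M] [ChartedSpace (Eu n) M] [IsManifold (𝓡 n) ∞ M]
  {e e' : OpenPartialHomeomorph M (Eu n)}

/-- With `τ` the transition map and `σ` its inverse, the change of canonical coordinates is `(x, p)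
↦ (τ x, (Dσ(τ x))ᵀ p)`. Its differential has the form required by `pb_comp_cotangentLift`, with `A =
Dτ`, `B = Dσ` and the symmetric `Q = D²σ`. -/
theorem exists_hasFDerivAt_canon (he : e ∈ charts n M) (he' : e' ∈ charts n M) {y : Eu n × Eu n}
    (hy : y.1 ∈ e.target) (hy' : e.symm y.1 ∈ e'.source) :
    ∃ T : Eu n × Eu n →L[ℝ] Eu n × Eu n,
      HasFDerivAt (fun y => canon e' (canonSymm e y)) T y ∧
      ∀ α β, pb (α.comp T) (β.comp T) = pb α β := by
  set q := e.symm y.1 with hqdef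
  have hq : q ∈ e.source := e.map_target hy
  have heq : e q = y.1 := e.right_inv hy
  have ht' : e' q ∈ e'.target := e'.map_source hy'
  set τ : Eu n → Eu n := fun x => e' (e.symm x) with hτ
  set σ : Eu n → Eu n := fun x => e (e'.symm x) with hσ
  set O := e.target ∩ e.symm ⁻¹' e'.source with hO
  have hyO : y.1 ∈ O := ⟨hy, hy'⟩
  have hσd : ∀ x ∈ O, fderiv ℝ σ (τ x) = (dChart e (e.symm x)).comp (dChartSymm e' (τ x)) :=
    fun x hx => by
      have h := hasFDerivAt_transition he' he (x := τ x) (e'.map_source hx.2)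
        (by rw [hτ, e'.left_inv hx.2]; exact e.map_target hx.1)
      rw [h.fderiv, hτ, e'.left_inv hx.2]
  have hσs : ContDiffAt ℝ ∞ σ (τ y.1) :=
    (contDiffOn_transition he' he).contDiffAt ((isOpen_overlap e' e).mem_nhds
      ⟨ht', by
        change e'.symm (e' q) ∈ e.source
        rwa [e'.left_inv hy']⟩)
  have hτd := hasFDerivAt_transition he he' hy hy'
  have h2d : HasFDerivAt (fderiv ℝ σ) (fderiv ℝ (fderiv ℝ σ) (τ y.1)) (τ y.1) :=
    ((hσs.fderiv_right (m := 1) (by norm_cast)).differentiableAt (by simp)).hasFDerivAt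
  set b : Fin n → Eu n → Eu n := fun i x => fderiv ℝ σ (τ x) (EuclideanSpace.single i (1 : ℝ))
    with hb
  have hbd : ∀ i, HasFDerivAt (b i) (((ContinuousLinearMap.apply ℝ (Eu n)
      (EuclideanSpace.single i (1 : ℝ) : Eu n)).comp (fderiv ℝ (fderiv ℝ σ) (τ y.1))).comp
        ((dChart e' (e.symm y.1)).comp (dChartSymm e y.1))) y.1 := fun i =>
    ((ContinuousLinearMap.apply ℝ (Eu n)
      (EuclideanSpace.single i (1 : ℝ) : Eu n)).hasFDerivAt.comp _ h2d).comp _ hτd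
  set S : Eu n × Eu n → Eu n × Eu n := fun y =>
    (τ y.1, WithLp.toLp 2 fun i => inner ℝ y.2 (b i y.1)) with hS
  have hmom := fun i => hasFDerivAt_momentum (z := y) (hbd i).differentiableAt
  have hSd : DifferentiableAt ℝ S y := by
    refine (hτd.differentiableAt.comp y differentiableAt_fst).prodMk ?_
    exact differentiableAt_euclidean.2 fun i => (hmom i).differentiableAt
  have hev : (fun y => canon e' (canonSymm e y)) =ᶠ[𝓝 y] S := by
    have : O ×ˢ (univ : Set (Eu n)) ∈ 𝓝 y :=
      ((isOpen_overlap e e').prod isOpen_univ).mem_nhds ⟨hyO, mem_univ _⟩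
    filter_upwards [this] with z hz
    rw [canon_eq]
    refine Prod.ext rfl ?_
    simp only [hS, hb]
    rw [hσd z.1 hz.1]
    rfl
  refine ⟨fderiv ℝ S y, hSd.hasFDerivAt.congr_of_eventuallyEq hev, fun α β => ?_⟩
  have hd := hSd.hasFDerivAt
  refine pb_comp_cotangentLift (A := (dChart e' q).comp (dChartSymm e y.1))
    (B := fderiv ℝ σ (τ y.1)) (Q := fderiv ℝ (fderiv ℝ σ) (τ y.1)) ?_ ?_ y.2 ?_ ?_ α β
  · rw [hσd _ hyO]
    ext1 w
    have h1 := DFunLike.congr_fun (dChartSymm_comp_dChart he hq) (dChartSymm e' (τ y.1) w)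
    have h2 := DFunLike.congr_fun (dChart_comp_dChartSymm he' ht') w
    simp only [ContinuousLinearMap.comp_apply, ContinuousLinearMap.id_apply] at h1 h2 ⊢
    rw [e'.left_inv hy'] at h2
    rw [heq] at h1
    rw [h1]
    exact h2
  · have hsymm : IsSymmSndFDerivAt ℝ σ (τ y.1) := hσs.isSymmSndFDerivAt (by simp; norm_cast)
    exact fun v w => hsymm.eq v w
  · intro v w
    have h1 := (hasFDerivAt_fst (𝕜 := ℝ)).comp y hd
    have h2 := hτd.comp y (hasFDerivAt_fst (𝕜 := ℝ) (p := y))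
    exact DFunLike.congr_fun (h1.unique h2) (v, w)
  · intro v w i
    have h1 := ((EuclideanSpace.proj i : Eu n →L[ℝ] ℝ).hasFDerivAt.comp _
      (hasFDerivAt_snd (𝕜 := ℝ) (p := S y))).comp y hd
    have h2 := DFunLike.congr_fun (h1.unique (hmom i)) (v, w)
    rw [(hbd i).fderiv] at h2
    exact h2

/-- The Poisson bracket may be computed in any chart. -/
theorem poisson_eq_pb (he : e ∈ charts n M) {f g : Cot n M → ℝ} (hf : SmoothCot f)
    (hg : SmoothCot g) {y : Eu n × Eu n} (hy : y.1 ∈ e.target) :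
    poisson f g (canonSymm e y) = pb (fderiv ℝ (fun y => f (canonSymm e y)) y)
      (fderiv ℝ (fun y => g (canonSymm e y)) y) := by
  set z := canonSymm e y with hz
  have he' := chartAt_mem_charts (n := n) z.proj
  set e' := chartAt (Eu n) z.proj with he'def
  have hy' : e.symm y.1 ∈ e'.source := mem_chart_source (Eu n) z.proj
  obtain ⟨T, hT, hpb⟩ := exists_hasFDerivAt_canon he he' hy hy'
  have hkey : ∀ {f : Cot n M → ℝ}, SmoothCot f → fderiv ℝ (fun y => f (canonSymm e y)) y =
      (fderiv ℝ (f ∘ canonSymm e') (canon e' z)).comp T := by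
    intro f hf
    have hd : DifferentiableAt ℝ (f ∘ canonSymm e') (canon e' z) :=
      ((hf.contDiffOn he').differentiableOn (by simp)).differentiableAt
        ((e'.open_target.prod isOpen_univ).mem_nhds ⟨e'.map_source hy', mem_univ _⟩)
    have h1 := HasFDerivAt.comp (f := fun y => canon e' (canonSymm e y)) y hd.hasFDerivAt hT
    refine (h1.congr_of_eventuallyEq ?_).fderiv
    have : (e.target ∩ e.symm ⁻¹' e'.source) ×ˢ (univ : Set (Eu n)) ∈ 𝓝 y :=
      ((isOpen_overlap e e').prod isOpen_univ).mem_nhds ⟨⟨hy, hy'⟩, mem_univ _⟩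
    filter_upwards [this] with x hx
    exact congrArg f (canonSymm_canon he' (z := canonSymm e x) hx.1.2).symm
  rw [hkey hf, hkey hg, hpb]
  rfl

end PoissonInvariance

/-! ### Lie brackets, Lie derivatives and lifts in a chart. -/

section ChartExpressions

open Filter Topology

variable {n : ℕ} {M : Type*} [TopologicalSpace M] [ChartedSpace (Eu n) M] [IsManifold (𝓡 n) ∞ M]
  {e : OpenPartialHomeomorph M (Eu n)} {f : Cot n M → ℝ} {A : ℕ} {ξ η : SemiAlg n M A}
  {u v : ∀ q : M, TangentSpace (𝓡 n) q}

theorem inverse_dChartSymm (he : e ∈ charts n M) {x : Eu n} (hx : x ∈ e.target) :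
    (dChartSymm e x).inverse = dChart e (e.symm x) := by
  refine ContinuousLinearMap.inverse_eq ?_ (dChart_comp_dChartSymm he hx)
  have h := dChartSymm_comp_dChart he (e.map_target hx)
  rwa [e.right_inv hx] at h

theorem mlieBracket_eq_lieBracket (V W : Eu n → Eu n) (x : Eu n) :
    VectorField.mlieBracket (𝓡 n) (M := Eu n) V W x = VectorField.lieBracket ℝ V W x := by
  have h := congrFun (VectorField.mlieBracketWithin_eq_lieBracketWithin (𝕜 := ℝ) (E := Eu n)
    (V := V) (W := W) (s := univ)) x
  refine Eq.trans ?_ (h.trans ?_)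
  · exact (congrFun (VectorField.mlieBracketWithin_univ (I := 𝓡 n) (M := Eu n) (V := V)
      (W := W)) x).symm
  · exact (congrFun VectorField.lieBracketWithin_univ x)

/-- The coordinate expression of a field is its pullback by the inverse chart, and the Lie bracket
commutes with pullback. -/
theorem coordField_mlieBracket (he : e ∈ charts n M)
    (hu : ContMDiff (𝓡 n) (𝓡 n).tangent ∞ (fun q => (⟨q, u q⟩ : TangentBundle (𝓡 n) M)))
    (hv : ContMDiff (𝓡 n) (𝓡 n).tangent ∞ (fun q => (⟨q, v q⟩ : TangentBundle (𝓡 n) M)))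
    {x : Eu n} (hx : x ∈ e.target) :
    coordField e (VectorField.mlieBracket (𝓡 n) u v) x =
      VectorField.lieBracket ℝ (coordField e u) (coordField e v) x := by
  have hpull : ∀ w : ∀ q : M, TangentSpace (𝓡 n) q, ∀ x ∈ e.target,
      VectorField.mpullback (𝓡 n) (𝓡 n) e.symm w x = coordField e w x := fun w x hx => by
    rw [VectorField.mpullback_apply]
    exact DFunLike.congr_fun (inverse_dChartSymm he hx) (w (e.symm x))
  have : IsManifold (𝓡 n) (minSmoothness ℝ 2) M := by
    simp only [minSmoothness_of_isRCLikeNormedField]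
    exact IsManifold.of_le (n := ∞) (by norm_cast)
  have h1 := VectorField.mpullback_mlieBracket (I := 𝓡 n) (I' := 𝓡 n) (f := e.symm) (V := u)
    (W := v) (x₀ := x) (n := ∞) ((hu (e.symm x)).mdifferentiableAt (by simp))
    ((hv (e.symm x)).mdifferentiableAt (by simp))
    ((charts_contMDiffOn_symm he).contMDiffAt (e.open_target.mem_nhds hx))
    (by simp only [minSmoothness_of_isRCLikeNormedField]
        norm_cast)
  rw [hpull _ x hx] at h1
  rw [h1]
  have h2 : ∀ w : ∀ q : M, TangentSpace (𝓡 n) q,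
      VectorField.mpullback (𝓡 n) (𝓡 n) e.symm w =ᶠ[𝓝 x] coordField e w := fun w => by
    filter_upwards [e.open_target.mem_nhds hx] with y hy using hpull w y hy
  exact ((h2 u).mlieBracket_vectorField_eq (h2 v)).trans (mlieBracket_eq_lieBracket _ _ _)

/-- The differential of a function, in the standard frame. -/
noncomputable def baseDeriv (h : M → ℝ) (q : M) : Eu n →L[ℝ] ℝ := mfderiv (𝓡 n) 𝓘(ℝ, ℝ) h q

theorem lieDer_symm (he : e ∈ charts n M) {h : M → ℝ} (hh : ContMDiff (𝓡 n) 𝓘(ℝ, ℝ) ∞ h)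
    (u : ∀ q : M, TangentSpace (𝓡 n) q) {x : Eu n} (hx : x ∈ e.target) :
    lieDer u h (e.symm x) = fderiv ℝ (fun x => h (e.symm x)) x (coordField e u x) := by
  have h1 := ((charts_mdifferentiable he).symm.mdifferentiableAt hx).hasMFDerivAt
  have h2 := ((hh (e.symm x)).mdifferentiableAt (by simp)).hasMFDerivAt
  have h3 : HasFDerivAt (fun x => h (e.symm x)) ((baseDeriv h (e.symm x)).comp (dChartSymm e x))
      x := (h2.comp x h1).hasFDerivAt
  have h4 := DFunLike.congr_fun (dChartSymm_comp_dChart he (e.map_target hx)) (u (e.symm x))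
  rw [e.right_inv hx] at h4
  rw [h3.fderiv]
  exact congrArg (baseDeriv h (e.symm x)) h4.symm

theorem contMDiff_lieDer {h : M → ℝ} (hh : ContMDiff (𝓡 n) 𝓘(ℝ, ℝ) ∞ h)
    (hu : ContMDiff (𝓡 n) (𝓡 n).tangent ∞ (fun q => (⟨q, u q⟩ : TangentBundle (𝓡 n) M))) :
    ContMDiff (𝓡 n) 𝓘(ℝ, ℝ) ∞ (lieDer u h) := by
  intro q
  have he := chartAt_mem_charts (n := n) q
  set e := chartAt (Eu n) q
  have hq : q ∈ e.source := mem_chart_source _ _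
  have h1 : ContDiffOn ℝ ∞ (fun x => fderiv ℝ (fun x => h (e.symm x)) x (coordField e u x))
      e.target :=
    ((contDiffOn_comp_symm he hh).fderiv_of_isOpen e.open_target (by simp)).clm_apply
      (contDiffOn_coordField he hu)
  have h2 : ContMDiffOn (𝓡 n) 𝓘(ℝ, ℝ) ∞ (fun q => fderiv ℝ (fun x => h (e.symm x)) (e q)
      (coordField e u (e q))) e.source :=
    (contMDiffOn_iff_contDiffOn.2 h1).comp (charts_contMDiffOn he) fun y hy => e.map_source hy
  refine (h2.contMDiffAt (e.open_source.mem_nhds hq)).congr_of_eventuallyEq ?_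
  filter_upwards [e.open_source.mem_nhds hq] with y hy
  rw [← lieDer_symm he hh u (e.map_source hy), e.left_inv hy]

theorem SemiAlg.Smooth.bracket (hξ : ξ.Smooth) (hη : η.Smooth) : (ξ.bracket η).Smooth := by
  have : IsManifold (𝓡 n) (minSmoothness ℝ 2) M := by
    simp only [minSmoothness_of_isRCLikeNormedField]
    exact IsManifold.of_le (n := ∞) (by norm_cast)
  have : IsManifold (𝓡 n) (((⊤ : ℕ∞) : WithTop ℕ∞) + 1) M := ‹IsManifold (𝓡 n) ∞ M›
  refine ⟨fun q => ?_, fun a => (contMDiff_lieDer (hη.2 a) hξ.1).sub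
    (contMDiff_lieDer (hξ.2 a) hη.1)⟩
  exact ContMDiffAt.mlieBracket_vectorField (m := ⊤) (n := ⊤) (hξ.1 q) (hη.1 q)
    (by simp only [minSmoothness_of_isRCLikeNormedField]; exact_mod_cast le_top)

theorem lieDer_eq_zero {r : M → ℝ} {q : M} (hq : q ∉ tsupport r) : lieDer u r q = 0 := by
  have h : r =ᶠ[𝓝 q] fun _ => 0 := notMem_tsupport_iff_eventuallyEq.1 hq
  have h1 : mfderiv (𝓡 n) 𝓘(ℝ, ℝ) r q = mfderiv (𝓡 n) 𝓘(ℝ, ℝ) (fun _ : M => (0 : ℝ)) q :=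
    h.mfderiv_eq
  rw [lieDer, h1, mfderiv_const]
  rfl

/-- With `Y_a = X ^ a` one has `y_a(x) = x Y_a(log x)`, whose derivative is `(Y_a + Y_a')(log x)`.
-/
theorem PosDist.liftDeriv_canonSymm (hf : PosDist f) (ξ : SemiAlg n M A) (y : Eu n × Eu n) :
    liftDeriv f ξ (canonSymm e y) = liftCoord (logCoord f e)
      (fun a : Fin (A + 1) => (Polynomial.X : Polynomial ℝ) ^ (a : ℕ)) (coordField e ξ.u)
      (fun a x => ξ.g a (e.symm x)) y := by
  rw [liftDeriv_eq hf.pos, covec_canonSymm_apply]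
  simp [liftCoord, Polynomial.derivative_X_pow]
  rfl

end ChartExpressions

/-! ### The bracket identity with a cutoff on the base. -/

section LocalizedBracket

variable {n : ℕ} {M : Type*} [TopologicalSpace M] [ChartedSpace (Eu n) M] [IsManifold (𝓡 n) ∞ M]
  {e : OpenPartialHomeomorph M (Eu n)} {f : Cot n M → ℝ} {A : ℕ} {ξ η : SemiAlg n M A}
  {u : ∀ q : M, TangentSpace (𝓡 n) q}

/-- The terms of `boundaryIntegrand`. -/
noncomputable def boundaryTerm (f : Cot n M → ℝ) (ξ η : SemiAlg n M A) (r : M → ℝ)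
    (a : Fin (A + 1)) (z : Cot n M) : ℝ :=
  (f z * Real.log (f z) ^ ((a : ℕ) - 1)) * ((a : ℕ) *
    (η.g a z.proj * lieDer ξ.u r z.proj - ξ.g a z.proj * lieDer η.u r z.proj))

/-- The function on the cotangent bundle whose fibre integral is `boundaryDensity`. -/
noncomputable def boundaryIntegrand (f : Cot n M → ℝ) (ξ η : SemiAlg n M A) (r : M → ℝ)
    (z : Cot n M) : ℝ :=
  ∑ a, boundaryTerm f ξ η r a z

/-- The density `∑ a s_{a-1} (h_a ℒ_u r - g_a ℒ_v r)`. -/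
noncomputable def boundaryDensity (f : Cot n M → ℝ) (ξ η : SemiAlg n M A) (r : M → ℝ)
    (q : M) : ℝ :=
  ∑ a : Fin (A + 1), fibreIntegral (fun z => f z * Real.log (f z) ^ ((a : ℕ) - 1)) q *
    ((a : ℕ) * (η.g a q * lieDer ξ.u r q - ξ.g a q * lieDer η.u r q))

theorem PosDist.fibreIntegral_boundaryIntegrand (hf : PosDist f) (ξ η : SemiAlg n M A)
    (r : M → ℝ) (q : M) :
    fibreIntegral (boundaryIntegrand f ξ η r) q = boundaryDensity f ξ η r q := by
  have hi : ∀ k : ℕ, Integrable fun p : Eu n =>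
      f (fibrePoint q p) * Real.log (f (fibrePoint q p)) ^ k := fun k =>
    hf.fibre_integrable_of_tame (h := fun z => f z * Real.log (f z) ^ k)
      (chartAt_mem_charts q) (hf.tameOn_entropy (chartAt_mem_charts q) k) (mem_chart_source _ q)
  have hs : ∀ a : Fin (A + 1), Integrable fun p : Eu n => boundaryTerm f ξ η r a (fibrePoint q p) :=
    fun a => (hi ((a : ℕ) - 1)).mul_const
      ((a : ℕ) * (η.g a q * lieDer ξ.u r q - ξ.g a q * lieDer η.u r q))
  refine Eq.trans (integral_finsetSum Finset.univ fun a _ => hs a) ?_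
  exact Finset.sum_congr rfl fun a _ => integral_mul_const
    ((a : ℕ) * (η.g a q * lieDer ξ.u r q - ξ.g a q * lieDer η.u r q)) fun p : Eu n =>
      f (fibrePoint q p) * Real.log (f (fibrePoint q p)) ^ ((a : ℕ) - 1)

theorem lieDer_add {r s : M → ℝ} (hr : ContMDiff (𝓡 n) 𝓘(ℝ, ℝ) ∞ r)
    (hs : ContMDiff (𝓡 n) 𝓘(ℝ, ℝ) ∞ s) (q : M) :
    lieDer u (fun q => r q + s q) q = lieDer u r q + lieDer u s q := by
  have h1 := ((hr q).mdifferentiableAt (by simp)).hasMFDerivAt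
  have h2 := ((hs q).mdifferentiableAt (by simp)).hasMFDerivAt
  have h3 : mfderiv (𝓡 n) 𝓘(ℝ, ℝ) (fun q => r q + s q) q = _ := (h1.add h2).mfderiv
  rw [lieDer, h3]
  rfl

theorem boundaryDensity_add {r s : M → ℝ} (hr : ContMDiff (𝓡 n) 𝓘(ℝ, ℝ) ∞ r)
    (hs : ContMDiff (𝓡 n) 𝓘(ℝ, ℝ) ∞ s) (q : M) :
    boundaryDensity f ξ η (fun q => r q + s q) q =
      boundaryDensity f ξ η r q + boundaryDensity f ξ η s q := by
  simp only [boundaryDensity, lieDer_add hr hs, ← Finset.sum_add_distrib]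
  exact Finset.sum_congr rfl fun a _ => by ring

variable [MeasurableSpace M] [BorelSpace M] [T2Space M] [SecondCountableTopology M]

/-- The relation between the two brackets, multiplied by a cutoff `r`. -/
structure BracketIdentity (f : Cot n M → ℝ) (ξ η : SemiAlg n M A) (r : M → ℝ) : Prop where
  smooth : ContMDiff (𝓡 n) 𝓘(ℝ, ℝ) ∞ r
  kinetic : Integrable (fun z => r z.proj * (f z * poisson (liftDeriv f ξ) (liftDeriv f η) z))
    (liouville n M)
  fluid : Integrable (fun q => r q * pairDensity (JMap A f) (ξ.bracket η) q / fibreIntegral f q)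
    (densMeasure n (fibreIntegral f))
  boundary : Integrable (fun q => boundaryDensity f ξ η r q / fibreIntegral f q)
    (densMeasure n (fibreIntegral f))
  eq : ∫ z, r z.proj * (f z * poisson (liftDeriv f ξ) (liftDeriv f η) z) ∂(liouville n M) +
    ∫ q, r q * pairDensity (JMap A f) (ξ.bracket η) q / fibreIntegral f q
      ∂(densMeasure n (fibreIntegral f)) =
    ∫ q, boundaryDensity f ξ η r q / fibreIntegral f q ∂(densMeasure n (fibreIntegral f))

/-- Every term, including the one with derivatives of the cutoff, is linear in it; this is what a
partition of unity requires. -/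
theorem BracketIdentity.add {r s : M → ℝ} (h : BracketIdentity f ξ η r)
    (h' : BracketIdentity f ξ η s) : BracketIdentity f ξ η fun q => r q + s q := by
  have hb : (fun q => boundaryDensity f ξ η (fun q => r q + s q) q / fibreIntegral f q) =
      fun q => boundaryDensity f ξ η r q / fibreIntegral f q +
        boundaryDensity f ξ η s q / fibreIntegral f q := funext fun q => by
    rw [boundaryDensity_add h.smooth h'.smooth, add_div]
  refine ⟨h.smooth.add h'.smooth, ?_, ?_, ?_, ?_⟩
  · simp only [add_mul]
    exact h.kinetic.add h'.kinetic
  · simp only [add_mul, add_div]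
    exact h.fluid.add h'.fluid
  · rw [hb]
    exact h.boundary.add h'.boundary
  · rw [hb]
    simp only [add_mul, add_div]
    rw [integral_add h.kinetic h'.kinetic, integral_add h.fluid h'.fluid,
      integral_add h.boundary h'.boundary, ← h.eq, ← h'.eq]
    ring

theorem PosDist.bracketIdentity_of_chart (hf : PosDist f) (hξ : ξ.Smooth) (hη : η.Smooth)
    (he : e ∈ charts n M) {r : M → ℝ} (hr : ContMDiff (𝓡 n) 𝓘(ℝ, ℝ) ∞ r)
    (hrc : HasCompactSupport r) (hre : tsupport r ⊆ e.source) : BracketIdentity f ξ η r := by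
  have hρ : ReferenceDensity (n := n) (fibreIntegral f) := hf.referenceDensity
  have hO : MeasurableSet (e.target ×ˢ (univ : Set (Eu n))) := measurableSet_chart_prod e
  have hCc : IsCompact (e '' tsupport r) :=
    hrc.image_of_continuousOn (e.continuousOn.mono hre)
  have hCe : e '' tsupport r ⊆ e.target := by
    rintro _ ⟨q, hq, rfl⟩
    exact e.map_source (hre hq)
  have hr0 : ∀ q, q ∉ e.source → r q = 0 := fun q hq =>
    image_eq_zero_of_notMem_tsupport fun h => hq (hre h)
  -- Fubini transfers an identity of three integrals in canonical coordinates to `T*M` and `M`; only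
  -- the pointwise matching of integrands is left.
  have key : ∀ {k₁ k₂ k₃ : Eu n × Eu n → ℝ}, IntegrableOn k₁ (e.target ×ˢ univ) →
      IntegrableOn k₂ (e.target ×ˢ univ) → IntegrableOn k₃ (e.target ×ˢ univ) →
      (∫ y in e.target ×ˢ univ, k₁ y) + (∫ y in e.target ×ˢ univ, k₂ y) =
        ∫ y in e.target ×ˢ univ, k₃ y →
      EqOn k₁ (fun y => r (canonSymm e y).proj * (f (canonSymm e y) *
        poisson (liftDeriv f ξ) (liftDeriv f η) (canonSymm e y))) (e.target ×ˢ univ) →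
      EqOn k₂ (fun y => r (canonSymm e y).proj * momentPairing (ξ.bracket η) f (canonSymm e y))
        (e.target ×ˢ univ) →
      EqOn k₃ (fun y => boundaryIntegrand f ξ η r (canonSymm e y)) (e.target ×ˢ univ) →
      BracketIdentity f ξ η r := by
    intro k₁ k₂ k₃ i1 i2 i3 hsum e1 e2 e3
    have j1 := integrable_liouville_of_chart he (H := fun z => r z.proj * (f z *
      poisson (liftDeriv f ξ) (liftDeriv f η) z)) (fun z hz => by rw [hr0 _ hz, zero_mul])
      (i1.congr_fun e1 hO)
    have j2 := fubini_of_chart hρ he (H := fun z => r z.proj * momentPairing (ξ.bracket η) f z)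
      (fun z hz => by rw [hr0 _ hz, zero_mul]) (i2.congr_fun e2 hO)
    have j3 := fubini_of_chart hρ he (H := boundaryIntegrand f ξ η r) (fun z hz => by
        have h0 : z.proj ∉ tsupport r := fun h => hz (hre h)
        simp [boundaryIntegrand, boundaryTerm, lieDer_eq_zero h0])
      (i3.congr_fun e3 hO)
    simp only [fibreIntegral_mul_base, ← hf.pairDensity_JMap] at j2
    simp only [hf.fibreIntegral_boundaryIntegrand] at j3
    refine ⟨hr, j1.1, j2.2.1, j3.2.1, ?_⟩
    rw [j1.2, j2.2.2.2, j3.2.2.2, ← setIntegral_congr_fun hO e1, ← setIntegral_congr_fun hO e2,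
      ← setIntegral_congr_fun hO e3]
    exact hsum
  obtain ⟨i1, i2, i3, hsum⟩ := (hf.logDecay he).integral_bracket
    (fun a : Fin (A + 1) => (Polynomial.X : Polynomial ℝ) ^ (a : ℕ))
    (contDiffOn_coordField he hξ.1) (contDiffOn_coordField he hη.1)
    (g := fun a x => ξ.g a (e.symm x)) (h := fun a x => η.g a (e.symm x))
    (fun a => contDiffOn_comp_symm he (hξ.2 a)) (fun a => contDiffOn_comp_symm he (hη.2 a))
    (r := fun x => r (e.symm x)) (contDiffOn_comp_symm he hr) hCe hCc fun x hx hxC =>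
      image_eq_zero_of_notMem_tsupport fun h => hxC ⟨_, h, e.right_inv hx⟩
  refine key i1 i2 i3 hsum (fun y hy => ?_) (fun y hy => ?_) (fun y hy => ?_)
  · beta_reduce
    rw [poisson_eq_pb he (hf.smoothCot_liftDeriv hξ) (hf.smoothCot_liftDeriv hη) hy.1,
      funext (hf.liftDeriv_canonSymm (e := e) ξ), funext (hf.liftDeriv_canonSymm (e := e) η),
      ← hf.exp_logCoord e y]
    rfl
  · have h1 : covec (canonSymm e y) ((ξ.bracket η).u (canonSymm e y).proj) =
        inner ℝ y.2 (VectorField.lieBracket ℝ (coordField e ξ.u) (coordField e η.u) y.1) := by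
      rw [covec_canonSymm_apply, ← coordField_mlieBracket he hξ.1 hη.1 hy.1]
      rfl
    have h2 : ∀ a, (ξ.bracket η).g a (canonSymm e y).proj =
        fderiv ℝ (fun x => η.g a (e.symm x)) y.1 (coordField e ξ.u y.1) -
          fderiv ℝ (fun x => ξ.g a (e.symm x)) y.1 (coordField e η.u y.1) := fun a => by
      rw [← lieDer_symm he (hη.2 a) ξ.u hy.1, ← lieDer_symm he (hξ.2 a) η.u hy.1]
      rfl
    beta_reduce
    rw [momentPairing, h1, ← hf.exp_logCoord e y]
    simp only [h2]
    simp only [canonSymm_proj, mul_add, Finset.mul_sum, Real.log_exp,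
      Polynomial.eval_pow, Polynomial.eval_X]
    exact congrArg₂ _ rfl (Finset.sum_congr rfl fun a _ => by ring)
  · beta_reduce
    rw [boundaryIntegrand]
    simp only [boundaryTerm, hf.exp_logCoord, canonSymm_proj, lieDer_symm he hr _ hy.1,
      Finset.mul_sum, Polynomial.derivative_X_pow, Polynomial.eval_mul, Polynomial.eval_pow, Polynomial.eval_X,
      Polynomial.eval_C]
    exact Finset.sum_congr rfl fun a _ => by
      simp only [logCoord]
      ring

theorem PosDist.bracketIdentity (hf : PosDist f) (hξ : ξ.Smooth) (hη : η.Smooth) {r : M → ℝ}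
    (hr : ContMDiff (𝓡 n) 𝓘(ℝ, ℝ) ∞ r) (hrc : HasCompactSupport r) :
    BracketIdentity f ξ η r := by
  refine localization (n := n) ?_ (fun r s h h' => h.add h')
    (fun e he r hr hrc hre => hf.bracketIdentity_of_chart hξ hη he hr hrc hre) hr hrc
  have h0 : ∀ q, boundaryDensity f ξ η (fun _ : M => (0 : ℝ)) q = 0 := fun q => by
    have h : ∀ u : ∀ q : M, TangentSpace (𝓡 n) q, lieDer u (fun _ : M => (0 : ℝ)) q = 0 :=
      fun u => lieDer_eq_zero (by simp [tsupport])
    simp [boundaryDensity, h]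
  exact ⟨contMDiff_const, by simp, by simp, by simp [h0], by simp [h0]⟩

end LocalizedBracket

/-! ### Passage to the limit along an exhaustion of `M`. -/

section Exhaustion

open Filter Topology

theorem exists_deriv_smoothTransition_bound : ∃ C : ℝ, 0 ≤ C ∧
    ∀ s, |deriv Real.smoothTransition s| ≤ C := by
  have hc : Continuous (deriv Real.smoothTransition) :=
    (Real.smoothTransition.contDiff (n := 1)).continuous_deriv (by simp)
  obtain ⟨C, hC⟩ := (isCompact_Icc (a := (0 : ℝ)) (b := 1)).exists_bound_of_continuousOn
    hc.continuousOn
  refine ⟨|C|, abs_nonneg _, fun s => ?_⟩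
  by_cases hs : s ∈ Icc (0 : ℝ) 1
  · exact (hC s hs).trans (le_abs_self _)
  · have : deriv Real.smoothTransition s = 0 := by
      rcases not_and_or.1 hs with h | h
      · have h1 : Real.smoothTransition =ᶠ[𝓝 s] fun _ => 0 := by
          filter_upwards [Iio_mem_nhds (not_le.1 h)] with t ht
          exact Real.smoothTransition.zero_of_nonpos (le_of_lt ht)
        rw [h1.deriv_eq, deriv_const]
      · have h1 : Real.smoothTransition =ᶠ[𝓝 s] fun _ => 1 := by
          filter_upwards [Ioi_mem_nhds (not_le.1 h)] with t ht
          exact Real.smoothTransition.one_of_one_le (le_of_lt ht)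
        rw [h1.deriv_eq, deriv_const]
    rw [this, abs_zero]
    exact abs_nonneg _

theorem deriv_smoothTransition_of_one_lt {s : ℝ} (hs : 1 < s) :
    deriv Real.smoothTransition s = 0 := by
  have h1 : Real.smoothTransition =ᶠ[𝓝 s] fun _ => 1 := by
    filter_upwards [Ioi_mem_nhds hs] with t ht
    exact Real.smoothTransition.one_of_one_le (le_of_lt ht)
  rw [h1.deriv_eq, deriv_const]

/-- The cutoff functions of an exhaustion function `w`. -/
noncomputable def exhaustionCutoff {M : Type*} (w : M → ℝ) (k : ℕ) (q : M) : ℝ :=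
  Real.smoothTransition (2 - w q / (k + 1))

variable {n : ℕ} {M : Type*} [TopologicalSpace M] [ChartedSpace (Eu n) M] [IsManifold (𝓡 n) ∞ M]
  {w : M → ℝ}

theorem contMDiff_exhaustionCutoff (hw : ContMDiff (𝓡 n) 𝓘(ℝ, ℝ) ∞ w) (k : ℕ) :
    ContMDiff (𝓡 n) 𝓘(ℝ, ℝ) ∞ (exhaustionCutoff w k) := by
  have h : ContDiff ℝ ∞ fun t : ℝ => Real.smoothTransition (2 - t / (k + 1)) :=
    Real.smoothTransition.contDiff.comp (contDiff_const.sub (contDiff_id.div_const _))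
  exact h.contMDiff.comp hw

theorem hasCompactSupport_exhaustionCutoff [T2Space M] (hc : ∀ c : ℝ, IsCompact {q | w q ≤ c})
    (k : ℕ) : HasCompactSupport (exhaustionCutoff w k) := by
  refine HasCompactSupport.intro (hc (2 * (k + 1))) fun q hq => ?_
  have hk : (0 : ℝ) < k + 1 := by positivity
  refine Real.smoothTransition.zero_of_nonpos ?_
  have : 2 * ((k : ℝ) + 1) < w q := not_le.1 hq
  rw [sub_nonpos, le_div_iff₀ hk]
  exact this.le

theorem abs_exhaustionCutoff_le (w : M → ℝ) (k : ℕ) (q : M) : |exhaustionCutoff w k q| ≤ 1 := by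
  rw [exhaustionCutoff, abs_of_nonneg (Real.smoothTransition.nonneg _)]
  exact Real.smoothTransition.le_one _

theorem tendsto_exhaustionCutoff (w : M → ℝ) (q : M) :
    Tendsto (fun k => exhaustionCutoff w k q) atTop (𝓝 1) := by
  refine tendsto_const_nhds.congr' ?_
  obtain ⟨N, hN⟩ := exists_nat_ge (w q)
  filter_upwards [eventually_ge_atTop N] with k hk
  have hk' : (0 : ℝ) < k + 1 := by positivity
  have : (N : ℝ) ≤ k := by exact_mod_cast hk
  refine (Real.smoothTransition.one_of_one_le ?_).symm
  have h : w q / (k + 1) ≤ 1 := (div_le_one hk').2 (by linarith)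
  linarith

/-- The cutoff is `1` for `w ≤ k + 1` and `0` for `w ≥ 2(k + 1)`. Stretching the transition over a
range of length `k + 1` gains the factor `1 / (k + 1)` that removes the boundary term. -/
theorem lieDer_exhaustionCutoff (hw : ContMDiff (𝓡 n) 𝓘(ℝ, ℝ) ∞ w) (k : ℕ)
    (u : ∀ q : M, TangentSpace (𝓡 n) q) (q : M) :
    lieDer u (exhaustionCutoff w k) q =
      -(deriv Real.smoothTransition (2 - w q / (k + 1)) / (k + 1)) * lieDer u w q := by
  have h1 : HasDerivAt (fun t : ℝ => Real.smoothTransition (2 - t / (k + 1)))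
      (-(deriv Real.smoothTransition (2 - w q / (k + 1)) / (k + 1))) (w q) := by
    have h2 := ((Real.smoothTransition.contDiff (n := 1)).differentiable (by simp)
      (2 - w q / (k + 1))).hasDerivAt
    have h3 : HasDerivAt (fun t : ℝ => 2 - t / (k + 1)) (-(1 / ((k : ℝ) + 1))) (w q) :=
      ((hasDerivAt_id (w q)).div_const _).const_sub 2
    have h4 : HasDerivAt (fun t : ℝ => Real.smoothTransition (2 - t / (k + 1)))
      (deriv Real.smoothTransition (2 - w q / (k + 1)) * -(1 / ((k : ℝ) + 1))) (w q) :=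
      HasDerivAt.comp (h₂ := Real.smoothTransition) (w q) h2 h3
    exact h4.congr_deriv (by ring)
  have h4 := ((hw q).mdifferentiableAt (by simp)).hasMFDerivAt
  have h5 : mfderiv (𝓡 n) 𝓘(ℝ, ℝ) (exhaustionCutoff w k) q = _ :=
    (h1.hasFDerivAt.hasMFDerivAt.comp q h4).mfderiv
  rw [lieDer, h5]
  exact mul_comm _ _

variable {f : Cot n M → ℝ} {A : ℕ} {ξ η : SemiAlg n M A}

theorem boundaryDensity_exhaustionCutoff (hw : ContMDiff (𝓡 n) 𝓘(ℝ, ℝ) ∞ w) (k : ℕ) (q : M) :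
    boundaryDensity f ξ η (exhaustionCutoff w k) q =
      -(deriv Real.smoothTransition (2 - w q / (k + 1)) / (k + 1)) *
        boundaryDensity f ξ η w q := by
  simp only [boundaryDensity, lieDer_exhaustionCutoff hw, Finset.mul_sum]
  exact Finset.sum_congr rfl fun a _ => by ring

variable [T2Space M] [SecondCountableTopology M] [MeasurableSpace M] [BorelSpace M]

theorem PosDist.continuous_pairDensity_div (hf : PosDist f) (hξ : ξ.Smooth) :
    Continuous fun q => pairDensity (JMap A f) ξ q / fibreIntegral f q := by
  simp only [hf.pairDensity_JMap]
  exact continuous_div_reference hf.referenceDensity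
    (hf.smoothDensity fun e he => hf.tameOn_momentPairing he hξ)

theorem integrable_indicator_div (hf : PosDist f) {K : Set M} (hK : IsCompact K) {d : M → ℝ}
    (hd : Measurable fun q => d q / fibreIntegral f q)
    (hi : DensIntegrable n (Kᶜ.indicator d)) :
    IntegrableOn (fun q => d q / fibreIntegral f q) Kᶜ (densMeasure n (fibreIntegral f)) := by
  have h1 : (fun q => Kᶜ.indicator d q / fibreIntegral f q) =
      Kᶜ.indicator fun q => d q / fibreIntegral f q := by
    funext q
    by_cases hq : q ∈ Kᶜ
    · rw [indicator_of_mem hq, indicator_of_mem hq]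
    · rw [indicator_of_notMem hq, indicator_of_notMem hq, zero_div]
  have hm : MeasurableSet Kᶜ := hK.isClosed.measurableSet.compl
  rw [densIntegrable_iff hf.referenceDensity (by rw [h1]; exact hd.indicator hm), h1,
    integrable_indicator_iff hm] at hi
  exact hi

theorem PosDist.integrableOn_boundaryDensity (hf : PosDist f) (hξ : ξ.Smooth) (hη : η.Smooth)
    {K : Set M} (hK : IsCompact K) (hw : ContMDiff (𝓡 n) 𝓘(ℝ, ℝ) ∞ w)
    (hs : ∀ a b : Fin (A + 1), (b : ℕ) + 1 = a →
      DensIntegrable n (Kᶜ.indicator fun q => (JMap A f).s b q * ξ.g a q * lieDer η.u w q) ∧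
      DensIntegrable n (Kᶜ.indicator fun q => (JMap A f).s b q * η.g a q * lieDer ξ.u w q)) :
    IntegrableOn (fun q => boundaryDensity f ξ η w q / fibreIntegral f q) Kᶜ
      (densMeasure n (fibreIntegral f)) := by
  simp only [boundaryDensity, Finset.sum_div]
  refine integrable_finsetSum _ fun a _ => ?_
  -- The term `a = 0` carries the coefficient `a`; for the others `a - 1` is the index `b` of the
  -- decay hypothesis.
  by_cases ha : (a : ℕ) = 0
  · simp [ha]
  · set b : Fin (A + 1) := ⟨(a : ℕ) - 1, by omega⟩ with hb
    have hsm : Continuous fun q => (JMap A f).s b q / fibreIntegral f q :=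
      continuous_div_reference hf.referenceDensity (hf.smooth_JMap.2 b)
    have hmeas : ∀ {ξ η : SemiAlg n M A}, ξ.Smooth → η.Smooth →
        Measurable fun q => (JMap A f).s b q * ξ.g a q * lieDer η.u w q / fibreIntegral f q := by
      intro ξ η hξ hη
      have h : Continuous fun q => (JMap A f).s b q / fibreIntegral f q * ξ.g a q *
          lieDer η.u w q :=
        (hsm.mul (hξ.2 a).continuous).mul (contMDiff_lieDer hw hη.1).continuous
      convert h.measurable using 2 with q
      ring
    have h := hs a b (by simp only [hb]; omega)
    have h1 := integrable_indicator_div hf hK (hmeas hξ hη) h.1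
    have h2 := integrable_indicator_div hf hK (hmeas hη hξ) h.2
    refine ((h2.sub h1).const_mul (a : ℝ)).congr (Filter.Eventually.of_forall fun q => ?_)
    change (a : ℝ) * ((JMap A f).s b q * η.g a q * lieDer ξ.u w q / fibreIntegral f q -
      (JMap A f).s b q * ξ.g a q * lieDer η.u w q / fibreIntegral f q) =
      (JMap A f).s b q * ((a : ℕ) * (η.g a q * lieDer ξ.u w q - ξ.g a q * lieDer η.u w q)) /
        fibreIntegral f q
    ring

/-- Off the boundary terms at infinity, the two brackets agree up to sign. -/
theorem PosDist.brackets_of_decay (hf : PosDist f) (hξ : ξ.Smooth) (hη : η.Smooth)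
    (hdec : DecaysAtInfinity f ξ η) :
    Integrable (fun z => f z * poisson (liftDeriv f ξ) (liftDeriv f η) z) (liouville n M) ∧
    DensIntegrable n (pairDensity (JMap A f) (ξ.bracket η)) ∧
    -densIntegral n (pairDensity (JMap A f) (ξ.bracket η)) =
      ∫ z, f z * poisson (liftDeriv f ξ) (liftDeriv f η) z ∂(liouville n M) := by
  obtain ⟨K, hK, hkin, hflu, w, hw, hwc, hs⟩ := hdec
  set ρ := fibreIntegral f with hρdef
  have hρ : ReferenceDensity (n := n) ρ := hf.referenceDensity
  set ν := densMeasure n ρ with hν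
  set H : Cot n M → ℝ := fun z => f z * poisson (liftDeriv f ξ) (liftDeriv f η) z with hH
  set D : M → ℝ := pairDensity (JMap A f) (ξ.bracket η) with hD
  have hDm : Measurable fun q => D q / ρ q :=
    (hf.continuous_pairDensity_div (hξ.bracket hη)).measurable
  have hKm : MeasurableSet K := hK.isClosed.measurableSet
  -- Integrability over `K` comes from the identity for a cutoff equal to `1` on `K`; over the
  -- complement it is assumed.
  obtain ⟨r, hr, hrc, hr1⟩ := exists_cutoff (n := n) hK
  have hid := hf.bracketIdentity hξ hη hr hrc
  have hHi : Integrable H (liouville n M) := by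
    have hm : MeasurableSet {z : Cot n M | z.proj ∈ K} :=
      (hK.isClosed.preimage continuous_cot_proj).measurableSet
    have h1 : IntegrableOn H {z : Cot n M | z.proj ∈ K} (liouville n M) :=
      hid.kinetic.integrableOn.congr_fun (fun z hz => by
        beta_reduce
        rw [hr1 _ hz, one_mul]) hm
    have h2 := h1.union hkin
    rwa [show {z : Cot n M | z.proj ∈ K} ∪ {z : Cot n M | z.proj ∉ K} = univ from
      union_compl_self _, integrableOn_univ] at h2
  have hDi : Integrable (fun q => D q / ρ q) ν := by
    have h1 : IntegrableOn (fun q => D q / ρ q) K ν :=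
      hid.fluid.integrableOn.congr_fun (fun q hq => by
        beta_reduce
        rw [hr1 _ hq, one_mul]) hKm
    have h2 := h1.union (integrable_indicator_div hf hK hDm hflu)
    rwa [union_compl_self, integrableOn_univ] at h2
  refine ⟨hHi, (densIntegrable_iff hρ hDm).2 hDi, ?_⟩
  rw [densIntegral_eq hρ hDm hDi]
  have hBi := hf.integrableOn_boundaryDensity hξ hη hK hw hs
  set B : M → ℝ := fun q => boundaryDensity f ξ η w q / ρ q with hB
  have hidk := fun k => hf.bracketIdentity hξ hη (contMDiff_exhaustionCutoff hw k)
    (hasCompactSupport_exhaustionCutoff hwc k)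
  have l1 : Tendsto (fun k : ℕ => ∫ z, exhaustionCutoff w k z.proj * H z ∂(liouville n M)) atTop
      (𝓝 (∫ z, H z ∂(liouville n M))) := by
    refine tendsto_integral_of_dominated_convergence (fun z => ‖H z‖)
      (fun k => (hidk k).kinetic.aestronglyMeasurable) hHi.norm
      (fun k => Filter.Eventually.of_forall fun z => ?_) (Filter.Eventually.of_forall fun z => ?_)
    · rw [norm_mul]
      exact mul_le_of_le_one_left (norm_nonneg _) (abs_exhaustionCutoff_le w k z.proj)
    · simpa using (tendsto_exhaustionCutoff w z.proj).mul_const (H z)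
  have l2 : Tendsto (fun k : ℕ => ∫ q, exhaustionCutoff w k q * D q / ρ q ∂ν) atTop
      (𝓝 (∫ q, D q / ρ q ∂ν)) := by
    refine tendsto_integral_of_dominated_convergence (fun q => ‖D q / ρ q‖)
      (fun k => (hidk k).fluid.aestronglyMeasurable) hDi.norm
      (fun k => Filter.Eventually.of_forall fun q => ?_) (Filter.Eventually.of_forall fun q => ?_)
    · rw [mul_div_assoc, norm_mul]
      exact mul_le_of_le_one_left (norm_nonneg _) (abs_exhaustionCutoff_le w k q)
    · simpa [mul_div_assoc] using (tendsto_exhaustionCutoff w q).mul_const (D q / ρ q)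
  have l3 : Tendsto (fun k : ℕ => ∫ q, boundaryDensity f ξ η (exhaustionCutoff w k) q / ρ q ∂ν)
      atTop (𝓝 0) := by
    obtain ⟨C, hC, hCb⟩ := exists_deriv_smoothTransition_bound
    -- For `k ≥ N` the cutoff is `1` in a neighbourhood of `K`, so the boundary term lives off `K`,
    -- where its integrability is known.
    obtain ⟨N, hN⟩ : ∃ N : ℕ, ∀ q ∈ K, w q ≤ N := by
      obtain ⟨c, hc⟩ := (hK.image hw.continuous).bddAbove
      obtain ⟨N, hN⟩ := exists_nat_ge c
      exact ⟨N, fun q hq => (hc ⟨q, hq, rfl⟩).trans hN⟩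
    have hlim : Tendsto (fun k : ℕ => C * (1 / ((k : ℝ) + 1)) *
        ∫ q, ‖Kᶜ.indicator B q‖ ∂ν) atTop (𝓝 0) := by
      have := (tendsto_one_div_add_atTop_nhds_zero_nat (𝕜 := ℝ)).const_mul C
      simpa using this.mul_const (∫ q, ‖Kᶜ.indicator B q‖ ∂ν)
    refine squeeze_zero_norm' ?_ hlim
    filter_upwards [eventually_ge_atTop N] with k hk
    have hk' : (0 : ℝ) < k + 1 := by positivity
    have hi : Integrable (Kᶜ.indicator B) ν := (integrable_indicator_iff hKm.compl).2 hBi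
    rw [← integral_const_mul]
    refine norm_integral_le_of_norm_le (hi.norm.const_mul _)
      (Filter.Eventually.of_forall fun q => ?_)
    rw [boundaryDensity_exhaustionCutoff hw, mul_div_assoc, norm_mul]
    by_cases hq : q ∈ K
    · have h1 : 1 < 2 - w q / (k + 1) := by
        have h2 : (N : ℝ) ≤ k := by exact_mod_cast hk
        have h3 : w q / (k + 1) < 1 := (div_lt_one hk').2 (by linarith [hN q hq])
        linarith
      rw [deriv_smoothTransition_of_one_lt h1]
      simp only [zero_div, neg_zero, norm_zero, zero_mul]
      positivity
    · rw [indicator_of_mem (show q ∈ Kᶜ from hq)]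
      refine mul_le_mul_of_nonneg_right ?_ (norm_nonneg _)
      rw [norm_neg, norm_div, Real.norm_eq_abs, Real.norm_of_nonneg hk'.le, div_eq_mul_one_div]
      exact mul_le_mul_of_nonneg_right (hCb _) (by positivity)
  -- In the limit of the identities, the kinetic integral plus the fluid integral is zero.
  have hsum := tendsto_nhds_unique (l1.add l2) (l3.congr fun k => ((hidk k).eq).symm)
  linarith

end Exhaustion
end KineticFluid

/-! ### The theorem. -/

open KineticFluid in
theorem proposition1 (n : ℕ) (M : Type*) [TopologicalSpace M] [ChartedSpace (Eu n) M]
    [IsManifold (𝓡 n) ∞ M] [T2Space M] [SecondCountableTopology M]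
    [MeasurableSpace M] [BorelSpace M] (A : ℕ) :
    -- `J_A` is a well-defined map from `C^∞(T*M)_+` to the smooth dual
    (∀ f : Cot n M → ℝ, PosDist f → MomentsConverge A f ∧ (JMap A f).Smooth) ∧
    -- differentiable functionals pull back to differentiable functionals
    (∀ f : Cot n M → ℝ, PosDist f → ∀ (F : SemiDual n M A → ℝ) (ξ : SemiAlg n M A),
      HasFluidDeriv F (JMap A f) ξ → HasKineticDeriv (F ∘ JMap A) f (liftDeriv f ξ)) ∧
    -- `J_A` respects the Poisson brackets
    (∀ f : Cot n M → ℝ, PosDist f →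
      ∀ (F G : SemiDual n M A → ℝ) (ξ η : SemiAlg n M A),
        HasFluidDeriv F (JMap A f) ξ → HasFluidDeriv G (JMap A f) η →
        DecaysAtInfinity f ξ η →
        ∃ r : ℝ, IsFluidBracket F G (JMap A f) r ∧
          IsKineticBracket (F ∘ JMap A) (G ∘ JMap A) f r) ∧
    -- the entropy component of `J_1` is the momentum integral of `f log f`
    (∀ f : Cot n M → ℝ, PosDist f → ∀ q : M,
      (JMap 1 f).s 1 q = fibreIntegral (fun z => f z * Real.log (f z)) q) := by
  refine ⟨fun f hf => ⟨hf.momentsConverge A, hf.smooth_JMap⟩,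
    fun f hf F ξ hF => hF.comp_JMap hf, fun f hf F G ξ η hF hG hdec => ?_,
    fun f hf q => by simp [JMap]⟩
  obtain ⟨h1, h2, h3⟩ := hf.brackets_of_decay hF.1 hG.1 hdec
  exact ⟨_, ⟨ξ, η, hF, hG, h2, rfl⟩,
    ⟨liftDeriv f ξ, liftDeriv f η, hF.comp_JMap hf, hG.comp_JMap hf, h1, h3⟩⟩
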